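/- Let $I=[0,1]$ and $n\ge 2$; all spaces are Hausdorff. For a based space $(X,x)$ let $\Omega^n(X,x)$ be the set of maps $f:(I^n,\partial I^n)\to (X,x)$ ($n$-loops). A sequence of maps into $X$ converges to $x$ if every neighbourhood of $x$ contains the images of all but finitely many of them. $(X,x)$ is sequentially $m$-connected if for every $0\le k\le m$ every sequence $f_1,f_2,\dots\in\Omega^k(X,x)$ converging to $x$ admits null-homotopies $H_1,H_2,\dots$ rel. $\partial I^k$ (from $f_i$ to the constant map at $x$) that converge to $x$. For a space $X$, points $x_j\in X$ and based spaces $(A_j,a_j)$ ($j\in\mathbb N$), the shrinking adjunction space $\mathbf{Adj}(X,x_j,A_j,a_j)$ is the inverse limit of the finite adjunction spaces $Y_k$ obtained from $X$ by attaching $A_j$, $j\le k$, along $a_j\sim x_j$, with bonding maps $Y_{k+1}\to Y_k$ that collapse $A_{k+1}$ to $x_{k+1}$. It contains the core $X$ and the attachment spaces $A_j$, and it retracts onto each $A_j$ by a map $r_j$ that sends everything else to $a_j$. Let a space $Z$ be decomposed as a core together with attachment spaces $S_k$, each meeting the core in one point $p_k$ only. An $n$-loop $f$ in $Z$ is in factored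 form with respect to this decomposition if there are sets $\mathscr C_k$ of non-degenerate $n$-cubes $\prod_i[c_i,d_i]\subseteq I^n$, all with pairwise disjoint interiors, such that $f(C)\subseteq S_k$ and $f(\partial C)=p_k$ for $C\in\mathscr C_k$ (where $\partial C$ is the union of the $(n-1)$-faces of $C$), and $f^{-1}(S_k\setminus\{p_k\})\subseteq\bigcup\mathscr C_k$. It is in single-factor form if moreover each $\mathscr C_k$ can be taken to have at most one element. (1) Let $Y=\mathbf{Adj}([0,1],y_i,B_i,b_i)$, where each $(B_i,b_i)$ is sequentially $(n-1)$-connected, and let $y_0\in[0,1]$. Every $f\in\Omega^n(Y,y_0)$ is homotopic rel. $\partial I^n$ to an $n$-loop $g$ in single-factor form (with respect to the core $[0,1]$ and the attachment spaces $B_i$). Moreover, the canonical map $\phi:\pi_n(Y,y_0)\to\prod_{i\in\mathbb N}\pi_n(B_i,b_i)$, $\phi([f])=([r_i\circ f])_i$, is an isomorphism of groups. (2) Let $Y=\mathbf{Adj}([0,1],x_j,A_j,a_j)$, where each $(A_j,a_j)$ is sequentially $(n-1)$-connected, let $Z=\mathbf{Adj}(Y,y_i,B_i,b_i)$, where the $(B_i,b_i)$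 are arbitrary based spaces, and let $z_0\in[0,1]$. Put $A_j^{\ast}=A_j\cup\bigcup\{B_i : y_i\in A_j\setminus\{a_j\}\}\subseteq Z$. If $f\in\Omega^n(Z,z_0)$ is in factored form with respect to the core $Y$ and the attachment spaces $B_i$, then $f$ is homotopic rel. $\partial I^n$, by a homotopy with image in $Y\cup\operatorname{Im}(f)$, to some $g\in\Omega^n(Z,z_0)$ that is in factored form with respect to the core $Y$ and the attachment spaces $B_i$, and in single-factor form with respect to the decomposition of $Z$ with core $[0,1]$ and attachment spaces $B_i$ for $y_i\in[0,1]$ and $A_j^{\ast}$ for $j\in\mathbb N$. -/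

import Mathlib

open scoped unitInterval Topology Topology.Homotopy

universe u v w

namespace ShrinkingAdjunction

/-! ### Induced maps on homotopy groups -/

section Induced

variable {X : Type u} {Y : Type v} [TopologicalSpace X] [TopologicalSpace Y] {N : Type w}

/-- Post-composition of an `N`-loop with a based map. -/
def loopMap {p : X} {q : Y} (φ : C(X, Y)) (h : φ p = q) (f : Ω^ N X p) : Ω^ N Y q :=
  ⟨φ.comp f.1, fun s hs => by
    have h1 : f.1 s = p := f.2 s hs
    rw [ContinuousMap.comp_apply, h1, h]⟩

/-- The function induced on homotopy groups by a based map. -/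
def piMap {p : X} {q : Y} (φ : C(X, Y)) (h : φ p = q) :
    HomotopyGroup N X p → HomotopyGroup N Y q :=
  Quotient.map (loopMap φ h) fun _ _ hfg => hfg.map fun H => H.compContinuousMap φ

end Induced

/-! ### Sequential connectedness -/

/-- `X` is sequentially `n`-connected at `p`: for every `0 ≤ k ≤ n`, every sequence of based maps
`f m : (I^k, ∂I^k) → (X, p)` (that is, of based maps from the `k`-sphere) that converges to `p`
is null-homotopic rel. `∂I^k` by a sequence of homotopies that converges to `p`. A sequence of maps
converges to `p` if every neighbourhood of `p` contains the images of all but finitely many of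
them. -/
def SeqConnected {X : Type u} [TopologicalSpace X] (n : ℕ) (p : X) : Prop :=
  ∀ k ≤ n, ∀ f : ℕ → Ω^ (Fin k) X p,
    (∀ U ∈ 𝓝 p, ∀ᶠ m in Filter.atTop, ∀ s, f m s ∈ U) →
    ∃ H : ∀ m, ContinuousMap.HomotopyRel (f m).1 (GenLoop.const : Ω^ (Fin k) X p).1
        (Cube.boundary (Fin k)),
      ∀ U ∈ 𝓝 p, ∀ᶠ m in Filter.atTop, ∀ s, H m s ∈ U

/-! ### Shrinking adjunction spaces -/

section Adjunction

variable {X : Type u} {A : ℕ → Type v}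

/-- The attachment relation `x j ∼ a j`, `j < k`, on `X ⊔ ∐_{j < k} A j`. -/
def StageRel (x : ℕ → X) (a : ∀ j, A j) (k : ℕ) (p q : X ⊕ (Σ j : Fin k, A j)) : Prop :=
  ∃ j : Fin k, p = Sum.inl (x j) ∧ q = Sum.inr ⟨j, a j⟩

/-- The finite adjunction space obtained from `X` by attaching `A 0, …, A (k - 1)`. -/
def Stage (x : ℕ → X) (a : ∀ j, A j) (k : ℕ) : Type (max u v) :=
  Quot (StageRel x a k)

/-- The finite adjunction spaces carry the quotient (weak) topology. -/
instance [TopologicalSpace X] [∀ j, TopologicalSpace (A j)] (x : ℕ → X) (a : ∀ j, A j) (k : ℕ) :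
    TopologicalSpace (Stage x a k) :=
  inferInstanceAs (TopologicalSpace (Quot (StageRel x a k)))

/-- The point of the `k`-th stage given by a point of the core. -/
def stageCore (x : ℕ → X) (a : ∀ j, A j) (k : ℕ) (p : X) : Stage x a k :=
  Quot.mk _ (Sum.inl p)

/-- The image in the `k`-th stage of `t : A j`; it is collapsed to `x j` when `A j` is not attached
yet. -/
def stageAttach (x : ℕ → X) (a : ∀ j, A j) (k j : ℕ) (t : A j) : Stage x a k :=
  if h : j < k then Quot.mk _ (Sum.inr ⟨⟨j, h⟩, t⟩) else stageCore x a k (x j)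

theorem stageAttach_base (x : ℕ → X) (a : ∀ j, A j) (k j : ℕ) :
    stageAttach x a k j (a j) = stageCore x a k (x j) := by
  by_cases h : j < k
  · exact (dif_pos h).trans (Quot.sound ⟨⟨j, h⟩, rfl, rfl⟩).symm
  · exact dif_neg h

/-- The retraction of the `(k + 1)`-st stage onto the `k`-th one that collapses `A k` to `x k` and
is the identity elsewhere. -/
def collapse (x : ℕ → X) (a : ∀ j, A j) (k : ℕ) : Stage x a (k + 1) → Stage x a k :=
  Quot.lift (Sum.elim (stageCore x a k) fun t => stageAttach x a k t.1 t.2) (by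
    rintro _ _ ⟨j, rfl, rfl⟩
    exact (stageAttach_base x a k j).symm)

/-- The shrinking adjunction space `Adj(X, x j, A j, a j)`: the inverse limit of the finite
adjunction spaces along the collapsing retractions, as a subspace of their product. -/
def Adj (x : ℕ → X) (a : ∀ j, A j) : Type (max u v) :=
  {y : ∀ k, Stage x a k // ∀ k, collapse x a k (y (k + 1)) = y k}

instance [TopologicalSpace X] [∀ j, TopologicalSpace (A j)] (x : ℕ → X) (a : ∀ j, A j) :
    TopologicalSpace (Adj x a) :=
  inferInstanceAs (TopologicalSpace {y : ∀ k, Stage x a k // ∀ k, collapse x a k (y (k + 1)) = y k})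

/-- The inclusion of the core `X` into the shrinking adjunction space. -/
def core (x : ℕ → X) (a : ∀ j, A j) (p : X) : Adj x a :=
  ⟨fun k => stageCore x a k p, fun _ => rfl⟩

/-- The inclusion of the attachment space `A j` into the shrinking adjunction space. -/
def attach (x : ℕ → X) (a : ∀ j, A j) (j : ℕ) (t : A j) : Adj x a :=
  ⟨fun k => stageAttach x a k j t, fun k => by
    by_cases h : j < k + 1
    · change collapse x a k (stageAttach x a (k + 1) j t) = stageAttach x a k j t
      have h1 : stageAttach x a (k + 1) j t = Quot.mk _ (Sum.inr ⟨⟨j, h⟩, t⟩) := dif_pos h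
      rw [h1]
      rfl
    · change collapse x a k (stageAttach x a (k + 1) j t) = stageAttach x a k j t
      have h1 : stageAttach x a (k + 1) j t = stageCore x a (k + 1) (x j) := dif_neg h
      have h2 : stageAttach x a k j t = stageCore x a k (x j) := dif_neg (by omega)
      rw [h1, h2]
      rfl⟩

/-- The map `A i → A j` that is the identity if `i = j` and constant at `a j` otherwise. -/
def coordMap (a : ∀ j, A j) (j i : ℕ) (t : A i) : A j :=
  if h : i = j then h ▸ t else a j

theorem coordMap_base (a : ∀ j, A j) (j i : ℕ) : coordMap a j i (a i) = a j := by
  by_cases h : i = j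
  · subst h
    exact dif_pos rfl
  · exact dif_neg h

/-- The retraction of the `(j + 1)`-st stage onto `A j` that collapses everything else to `a j`. -/
def stageRetraction (x : ℕ → X) (a : ∀ j, A j) (j : ℕ) : Stage x a (j + 1) → A j :=
  Quot.lift (Sum.elim (fun _ => a j) fun t => coordMap a j t.1 t.2) (by
    rintro _ _ ⟨i, rfl, rfl⟩
    exact (coordMap_base a j i).symm)

variable [TopologicalSpace X] [∀ j, TopologicalSpace (A j)]

theorem continuous_coordMap (a : ∀ j, A j) (j i : ℕ) : Continuous (coordMap a j i) := by
  unfold coordMap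
  by_cases h : i = j
  · subst h
    simpa using continuous_id'
  · simpa [h] using continuous_const

theorem continuous_stageRetraction (x : ℕ → X) (a : ∀ j, A j) (j : ℕ) :
    Continuous (stageRetraction x a j) := by
  refine continuous_quot_lift _ ?_
  exact continuous_const.sumElim (continuous_sigma fun i => continuous_coordMap a j i)

/-- The canonical retraction `r j` of the shrinking adjunction space onto `A j`. -/
def retraction (x : ℕ → X) (a : ∀ j, A j) (j : ℕ) : C(Adj x a, A j) :=
  ⟨fun y => stageRetraction x a j (y.1 (j + 1)),
    (continuous_stageRetraction x a j).comp
      ((continuous_apply (j + 1)).comp continuous_subtype_val)⟩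

theorem retraction_core (x : ℕ → X) (a : ∀ j, A j) (j : ℕ) (p : X) :
    retraction x a j (core x a p) = a j := rfl

end Adjunction

/-! ### Cubes and factored forms -/

/-- A (closed, non-degenerate) `n`-cube `∏ i, [lo i, hi i]` in `I^n`. -/
structure NCube (n : ℕ) where
  lo : Fin n → I
  hi : Fin n → I
  lt : ∀ i, lo i < hi i

namespace NCube

variable {n : ℕ}

/-- The points of an `n`-cube. -/
def carrier (C : NCube n) : Set (Fin n → I) := {s | ∀ i, C.lo i ≤ s i ∧ s i ≤ C.hi i}

/-- The open `n`-cube. -/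
def inner (C : NCube n) : Set (Fin n → I) := {s | ∀ i, C.lo i < s i ∧ s i < C.hi i}

/-- The boundary of an `n`-cube, that is, the union of its `(n - 1)`-faces. -/
def bd (C : NCube n) : Set (Fin n → I) := {s ∈ C.carrier | ∃ i, s i = C.lo i ∨ s i = C.hi i}

end NCube

section Factorization

variable {Y : Type u} [TopologicalSpace Y] {n : ℕ} {y₀ : Y} {K : Type v}

/-- Let the space `Y` be decomposed as a core together with attachment spaces `S k ⊆ Y` meeting the
core in `p k` only, `k : K`. A family of sets `𝒞 k` of `n`-cubes is a factorization of the `n`-loop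
`f` if the cubes have pairwise disjoint interiors, `f` restricts on every `C ∈ 𝒞 k` to an `n`-loop
`(C, ∂C) → (S k, p k)`, and every point that `f` maps into `S k \ {p k}` lies in one of the cubes
of `𝒞 k`. -/
structure IsFactorization (S : K → Set Y) (p : K → Y) (f : Ω^ (Fin n) Y y₀)
    (𝒞 : K → Set (NCube n)) : Prop where
  disjoint : ∀ k l : K, ∀ C ∈ 𝒞 k, ∀ D ∈ 𝒞 l, (k, C) ≠ (l, D) → Disjoint C.inner D.inner
  mapsTo : ∀ k : K, ∀ C ∈ 𝒞 k, ∀ s ∈ C.carrier, f s ∈ S k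
  bd_eq : ∀ k : K, ∀ C ∈ 𝒞 k, ∀ s ∈ C.bd, f s = p k
  cover : ∀ k : K, ∀ s, f s ∈ S k → f s ≠ p k → ∃ C ∈ 𝒞 k, s ∈ C.carrier

/-- `f` is in factored form with respect to the attachment spaces `S k` with base points `p k`. -/
def FactoredForm (S : K → Set Y) (p : K → Y) (f : Ω^ (Fin n) Y y₀) : Prop :=
  ∃ 𝒞 : K → Set (NCube n), IsFactorization S p f 𝒞

/-- `f` is in single-factor form: it has a factorization with at most one `n`-cube for each
attachment space. -/
def SingleFactorForm (S : K → Set Y) (p : K → Y) (f : Ω^ (Fin n) Y y₀) : Prop :=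
  ∃ 𝒞 : K → Set (NCube n), IsFactorization S p f 𝒞 ∧ ∀ k, (𝒞 k).Subsingleton

end Factorization

/-! ### Decompositions of (iterated) shrinking adjunction spaces -/

section Decompositions

variable {X : Type u} {A : ℕ → Type v}

/-- The attachment spaces of `Adj(X, x j, A j, a j)`, as subsets. -/
def attachSet (x : ℕ → X) (a : ∀ j, A j) (j : ℕ) : Set (Adj x a) := Set.range (attach x a j)

/-- The points at which the attachment spaces of `Adj(X, x j, A j, a j)` are attached. -/
def attachPt (x : ℕ → X) (a : ∀ j, A j) (j : ℕ) : Adj x a := core x a (x j)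

variable {B : ℕ → Type w}

/-- For `Y = Adj(X, x j, A j, a j)` and `Z = Adj(Y, y i, B i, b i)`, the subset
`A j ∪ ⋃ {B i | y i ∈ A j \ {a j}}` of `Z`. -/
def starSet (x : ℕ → X) (a : ∀ j, A j) (y : ℕ → Adj x a) (b : ∀ i, B i) (j : ℕ) :
    Set (Adj y b) :=
  core y b '' attachSet x a j ∪
    ⋃ i ∈ {i : ℕ | y i ∈ attachSet x a j \ {attachPt x a j}}, attachSet y b i

/-- The attachment spaces of the decomposition of `Z = Adj(Y, y i, B i, b i)`, where
`Y = Adj(X, x j, A j, a j)`, with core `X`: the `B i` with `y i ∈ X`, and the sets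
`A j ∪ ⋃ {B i | y i ∈ A j \ {a j}}`. -/
def iterSet (x : ℕ → X) (a : ∀ j, A j) (y : ℕ → Adj x a) (b : ∀ i, B i) :
    {i : ℕ // y i ∈ Set.range (core x a)} ⊕ ℕ → Set (Adj y b) :=
  Sum.elim (fun i => attachSet y b i) (starSet x a y b)

/-- The attachment points of the decomposition of the iterated space with core `X`. -/
def iterPt (x : ℕ → X) (a : ∀ j, A j) (y : ℕ → Adj x a) (b : ∀ i, B i) :
    {i : ℕ // y i ∈ Set.range (core x a)} ⊕ ℕ → Adj y b :=
  Sum.elim (fun i => attachPt y b i) (fun j => core y b (attachPt x a j))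

end Decompositions

end ShrinkingAdjunction

/-!
A shrinking adjunction space `Adj x a` is determined by coordinates: a point is given by its
position in the core and by its images in the attached spaces, and a filter converges as soon as
all of these do (`Adj.ext_coord`, `Adj.le_nhds`). Hence a family of maps to the core and to the
attached spaces, at most one of which is nontrivial at each point, glues to a continuous map
(`Adj.continuous_mk`). The homotopies are constructed one coordinate at a time. The iterated space
is treated in the same way, in terms of the arc, of the spaces `B i` attached to the arc, and of
the spaces `A j` together with what is attached to them (`ArcDecomposition`, `iterDecomposition`).
Loops are extended to maps on `ℝ^n` that are constant outside of the unit cube.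

The first half of the argument brings a loop into factored form over the arc. The component of the
loop in `A j` is supported in an open subset of the cube. This set is divided into dyadic cubes
that shrink towards its boundary (`whitneyCell`), and near the boundary the component is close to
the base point. Therefore the restrictions to the cells of a fixed dimension form a sequence that
converges to the base point. As `A j` is sequentially `(n-1)`-connected, the component can be
deformed to the base point on one skeleton after the other, up to dimension `n - 1`, without
losing the continuity at the boundary (`exists_whitney_homotopy`). Then the Whitney cubes
factorize the component. If spaces `B i` are attached to `A j`, the cubes over which the loop is
in `B i` are first shrunk into the interiors of Whitney cubes, and they are moved towards the
centres of these during the deformation, which just rescales the loop near the centres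
(`BoxFactored.exists_treeFactored`).

The second half replaces the possibly infinitely many cubes for one attached space by a single
cube. All cubes are boxes of the binary tree in which the unit cube is halved along the coordinate
axes in turn. Each box of the tree is given one loop per attached space `k`, its content. The
interval is reparametrized by a map `q` that is constant at the attachment point of `k` on an
interval `[a k, b k]`, where these intervals have disjoint interiors (`Plateaus`), and the content
for `k` is placed in the cube `[a k, b k]^n` of the box. When the contents of the two halves of a
box are merged along the axis of the halving, the contents for different `k` stay over disjoint
intervals of any other axis; this is where `n ≥ 2` is needed (`index_eq_of_ne`,
`levelCore_of_ne`). The merging goes from infinite depth to depth `0`. It is one homotopy, because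
the steps at large depths converge: only finitely many cubes have contents that leave a given
neighbourhood of the base point, and the position on the arc changes little on small boxes
(`exists_infinite_concatenation`, `TreeFactored.homotopicWith_arrange`). The result is an
arrangement (`arrange`) of the components of the loop, with one cube for each attached space.

The statement on a space with arc core is the case in which one-point spaces are attached in the
second stage. Every loop is homotopic to the arrangement of its components, and homotopies of the
components can be arranged as well; hence the homotopy classes of the components determine the
class of the loop, and arbitrary components can be realized (`bijective_piRetraction`).
-/

set_option linter.unusedSectionVars false

namespace ShrinkingAdjunction

/-! ### Coordinates on shrinking adjunction spaces -/

section Coordinates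

variable {X : Type u} {A : ℕ → Type v}

/-- The retraction of a finite adjunction space onto its core. -/
def stagePos (x : ℕ → X) (a : ∀ j, A j) (k : ℕ) : Stage x a k → X :=
  Quot.lift (Sum.elim id fun t => x t.1) (by rintro _ _ ⟨j, rfl, rfl⟩; rfl)

/-- The map of a finite adjunction space to `A j` that collapses everything but `A j`; it is
constant if `A j` is not attached yet. -/
def stageFib (x : ℕ → X) (a : ∀ j, A j) (k j : ℕ) : Stage x a k → A j :=
  Quot.lift (Sum.elim (fun _ => a j) fun t => coordMap a j t.1 t.2) (by
    rintro _ _ ⟨i, rfl, rfl⟩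
    exact (coordMap_base a j i).symm)

theorem coordMap_self (a : ∀ j, A j) (j : ℕ) (t : A j) : coordMap a j j t = t :=
  dif_pos rfl

theorem coordMap_of_ne (a : ∀ j, A j) {i j : ℕ} (h : i ≠ j) (t : A i) : coordMap a j i t = a j :=
  dif_neg h

variable (x : ℕ → X) (a : ∀ j, A j)

theorem stageFib_core (k j : ℕ) (p : X) : stageFib x a k j (stageCore x a k p) = a j := rfl

theorem stageAttach_of_lt {k j : ℕ} (h : j < k) (t : A j) :
    stageAttach x a k j t = Quot.mk _ (Sum.inr ⟨⟨j, h⟩, t⟩) := dif_pos h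

theorem stageAttach_of_le {k j : ℕ} (h : k ≤ j) (t : A j) :
    stageAttach x a k j t = stageCore x a k (x j) := dif_neg (by omega)

theorem stagePos_attach (k j : ℕ) (t : A j) : stagePos x a k (stageAttach x a k j t) = x j := by
  by_cases h : j < k
  · rw [stageAttach_of_lt x a h]; rfl
  · rw [stageAttach_of_le x a (by omega)]; rfl

theorem stageFib_attach {k i : ℕ} (h : i < k) (j : ℕ) (t : A i) :
    stageFib x a k j (stageAttach x a k i t) = coordMap a j i t := by
  rw [stageAttach_of_lt x a h]; rfl

theorem stage_cases (k : ℕ) (q : Stage x a k) :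
    (∃ p, q = stageCore x a k p) ∨ ∃ j, j < k ∧ ∃ t, q = stageAttach x a k j t := by
  obtain ⟨p | ⟨j, t⟩, rfl⟩ := Quot.exists_rep q
  · exact Or.inl ⟨p, rfl⟩
  · exact Or.inr ⟨j, j.2, t, (stageAttach_of_lt x a j.2 t).symm⟩

theorem eq_stageAttach_of_fib_ne {k j : ℕ} {q : Stage x a k} (h : stageFib x a k j q ≠ a j) :
    q = stageAttach x a k j (stageFib x a k j q) := by
  obtain ⟨p, rfl⟩ | ⟨i, hi, t, rfl⟩ := stage_cases x a k q
  · exact absurd rfl h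
  · rw [stageFib_attach x a hi] at h ⊢
    obtain rfl : i = j := by
      by_contra hne
      exact h (coordMap_of_ne a hne t)
    rw [coordMap_self]

theorem eq_stageCore_of_fib_eq {k : ℕ} {q : Stage x a k}
    (h : ∀ j, j < k → stageFib x a k j q = a j) : q = stageCore x a k (stagePos x a k q) := by
  obtain ⟨p, rfl⟩ | ⟨i, hi, t, rfl⟩ := stage_cases x a k q
  · rfl
  · have h1 := h i hi
    rw [stageFib_attach x a hi, coordMap_self] at h1
    rw [stagePos_attach, h1, stageAttach_base]

theorem stagePos_collapse (k : ℕ) (q : Stage x a (k + 1)) :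
    stagePos x a k (collapse x a k q) = stagePos x a (k + 1) q := by
  obtain ⟨p | ⟨j, t⟩, rfl⟩ := Quot.exists_rep q
  · rfl
  · exact stagePos_attach x a k j t

theorem stageFib_collapse {k j : ℕ} (hj : j < k) (q : Stage x a (k + 1)) :
    stageFib x a k j (collapse x a k q) = stageFib x a (k + 1) j q := by
  obtain ⟨p | ⟨i, t⟩, rfl⟩ := Quot.exists_rep q
  · rfl
  · change stageFib x a k j (stageAttach x a k i t) = coordMap a j i t
    by_cases h : (i : ℕ) < k
    · exact stageFib_attach x a h j t
    · rw [stageAttach_of_le x a (by omega), stageFib_core, coordMap_of_ne a (by omega)]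

theorem stagePos_adj (y : Adj x a) (k : ℕ) : stagePos x a k (y.1 k) = stagePos x a 0 (y.1 0) := by
  induction k with
  | zero => rfl
  | succ k ih => rw [← stagePos_collapse, y.2 k, ih]

theorem stageFib_adj (y : Adj x a) {k j : ℕ} (h : j < k) :
    stageFib x a k j (y.1 k) = stageFib x a (j + 1) j (y.1 (j + 1)) := by
  induction k, h using Nat.le_induction with
  | base => rfl
  | succ k hk ih => rw [← stageFib_collapse x a hk, y.2 k, ih]

variable [TopologicalSpace X] [∀ j, TopologicalSpace (A j)]

theorem continuous_stagePos (k : ℕ) : Continuous (stagePos x a k) := by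
  refine continuous_quot_lift _ ?_
  exact continuous_id.sumElim (continuous_sigma fun i =>
    (continuous_const : Continuous fun _ : A i => x i))

/-- The retraction of the shrinking adjunction space onto its core. -/
def coreRetraction : C(Adj x a, X) :=
  ⟨fun y => stagePos x a 0 (y.1 0),
    (continuous_stagePos x a 0).comp ((continuous_apply 0).comp continuous_subtype_val)⟩

@[simp] theorem coreRetraction_core (p : X) : coreRetraction x a (core x a p) = p := rfl

@[simp] theorem coreRetraction_attach (j : ℕ) (t : A j) :
    coreRetraction x a (attach x a j t) = x j := stagePos_attach x a 0 j t

theorem retraction_attach (j i : ℕ) (t : A i) :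
    retraction x a j (attach x a i t) = coordMap a j i t := by
  have h : retraction x a j (attach x a i t) =
      stageFib x a (max i j + 1) j ((attach x a i t).1 (max i j + 1)) :=
    (stageFib_adj x a (attach x a i t) (by omega)).symm
  rw [h]
  exact stageFib_attach x a (by omega) j t

@[simp] theorem retraction_attach_self (j : ℕ) (t : A j) :
    retraction x a j (attach x a j t) = t := by
  rw [retraction_attach, coordMap_self]

theorem retraction_attach_of_ne {i j : ℕ} (h : i ≠ j) (t : A i) :
    retraction x a j (attach x a i t) = a j := by
  rw [retraction_attach, coordMap_of_ne a h]

theorem attach_base (j : ℕ) : attach x a j (a j) = core x a (x j) :=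
  Subtype.ext (funext fun k => stageAttach_base x a k j)

theorem stageFib_eq_retraction (y : Adj x a) {k j : ℕ} (h : j < k) :
    stageFib x a k j (y.1 k) = retraction x a j y := stageFib_adj x a y h

variable {x a}

/-- A point is determined by its coordinates in the core and in the attachment spaces. -/
theorem Adj.ext_coord {y z : Adj x a} (h : coreRetraction x a y = coreRetraction x a z)
    (hr : ∀ j, retraction x a j y = retraction x a j z) : y = z := by
  refine Subtype.ext (funext fun k => ?_)
  by_cases hk : ∀ j, j < k → stageFib x a k j (y.1 k) = a j
  · rw [eq_stageCore_of_fib_eq x a hk, eq_stageCore_of_fib_eq x a (q := z.1 k),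
      stagePos_adj x a y k, stagePos_adj x a z k]
    · exact congrArg _ h
    · intro j hj
      rw [stageFib_eq_retraction x a z hj, ← hr, ← stageFib_eq_retraction x a y hj, hk j hj]
  · push Not at hk
    obtain ⟨j, hj, hne⟩ := hk
    have hne' : stageFib x a k j (z.1 k) ≠ a j := by
      rwa [stageFib_eq_retraction x a z hj, ← hr, ← stageFib_eq_retraction x a y hj]
    rw [eq_stageAttach_of_fib_ne x a hne, eq_stageAttach_of_fib_ne x a hne',
      stageFib_eq_retraction x a z hj, ← hr, ← stageFib_eq_retraction x a y hj]

/-- At most one coordinate in the attachment spaces is not trivial, and it determines the coordinate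
in the core. -/
theorem Adj.fib_of_ne {y : Adj x a} {j : ℕ} (h : retraction x a j y ≠ a j) :
    coreRetraction x a y = x j ∧ ∀ i, i ≠ j → retraction x a i y = a i := by
  have key : ∀ k, j < k → y.1 k = stageAttach x a k j (retraction x a j y) := by
    intro k hk
    rw [← stageFib_eq_retraction x a y hk] at h ⊢
    exact eq_stageAttach_of_fib_ne x a h
  constructor
  · change stagePos x a 0 (y.1 0) = _
    rw [← stagePos_adj x a y (j + 1), key _ (by omega), stagePos_attach]
  · intro i hi
    rw [← stageFib_eq_retraction x a y (show i < max i j + 1 by omega), key _ (by omega),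
      stageFib_attach x a (by omega), coordMap_of_ne a hi.symm]

theorem Adj.eq_attach {y : Adj x a} {j : ℕ} (h : retraction x a j y ≠ a j) :
    y = attach x a j (retraction x a j y) := by
  obtain ⟨h1, h2⟩ := Adj.fib_of_ne h
  refine Adj.ext_coord (by rw [h1, coreRetraction_attach]) fun i => ?_
  by_cases hi : i = j
  · subst hi; rw [retraction_attach_self]
  · rw [h2 i hi, retraction_attach_of_ne x a (Ne.symm hi)]

theorem Adj.eq_core {y : Adj x a} (h : ∀ j, retraction x a j y = a j) :
    y = core x a (coreRetraction x a y) :=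
  Adj.ext_coord rfl fun j => by rw [h, retraction_core]

theorem continuous_stageCore (k : ℕ) : Continuous (stageCore x a k) :=
  continuous_quot_mk.comp continuous_inl

theorem continuous_stageAttach (k j : ℕ) : Continuous (stageAttach x a k j) := by
  by_cases h : j < k
  · rw [funext (stageAttach_of_lt x a h)]
    exact continuous_quot_mk.comp (continuous_inr.comp continuous_sigmaMk)
  · rw [funext (stageAttach_of_le x a (not_lt.mp h))]
    exact continuous_const

open Filter in
/-- The topology of a finite adjunction space is the one induced by its coordinates. -/
theorem stage_le_nhds {k : ℕ} {q : Stage x a k} {l : Filter (Stage x a k)}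
    (hp : Tendsto (stagePos x a k) l (𝓝 (stagePos x a k q)))
    (hf : ∀ j, j < k → Tendsto (stageFib x a k j) l (𝓝 (stageFib x a k j q))) : l ≤ 𝓝 q := by
  refine (nhds_basis_opens q).ge_iff.2 fun W hW => ?_
  obtain ⟨hqW, hWo⟩ := hW
  have hU : IsOpen (stageCore x a k ⁻¹' W) := hWo.preimage (continuous_stageCore k)
  have hV : ∀ j, IsOpen (stageAttach x a k j ⁻¹' W) :=
    fun j => hWo.preimage (continuous_stageAttach k j)
  have hbase : ∀ j, a j ∈ stageAttach x a k j ⁻¹' W ↔ x j ∈ stageCore x a k ⁻¹' W := fun j => by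
    simp only [Set.mem_preimage, stageAttach_base]
  -- A neighbourhood that contains part of the core is cut out by the core coordinate and by the
  -- coordinates of the spaces attached within that part.
  have main : stagePos x a k q ∈ stageCore x a k ⁻¹' W →
      (∀ j, j < k → x j ∈ stageCore x a k ⁻¹' W →
        stageFib x a k j q ∈ stageAttach x a k j ⁻¹' W) → W ∈ l := by
    intro h1 h2
    have h3 : ∀ᶠ q' in l, ∀ j ∈ Finset.range k, x j ∈ stageCore x a k ⁻¹' W →
        stageFib x a k j q' ∈ stageAttach x a k j ⁻¹' W := by
      refine (Finset.eventually_all _).2 fun j hj => ?_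
      by_cases hx : x j ∈ stageCore x a k ⁻¹' W
      · filter_upwards [(hf j (Finset.mem_range.1 hj)).eventually
          ((hV j).mem_nhds (h2 j (Finset.mem_range.1 hj) hx))] with q' hq' _ using hq'
      · exact Eventually.of_forall fun _ h => absurd h hx
    filter_upwards [hp.eventually (hU.mem_nhds h1), h3] with q' hq1 hq2
    obtain ⟨p, rfl⟩ | ⟨i, hi, t, rfl⟩ := stage_cases x a k q'
    · exact hq1
    · have := hq2 i (Finset.mem_range.2 hi) (by rwa [stagePos_attach] at hq1)
      rwa [stageFib_attach x a hi, coordMap_self] at this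
  obtain ⟨p, rfl⟩ | ⟨j, hj, t, rfl⟩ := stage_cases x a k q
  · exact main hqW fun j _ hx => by rw [stageFib_core, hbase]; exact hx
  · by_cases ha : a j ∈ stageAttach x a k j ⁻¹' W
    · refine main (by rw [stagePos_attach, ← hbase]; exact ha) fun i _ hx => ?_
      rw [stageFib_attach x a hj]
      by_cases hij : j = i
      · subst hij; rw [coordMap_self]; exact hqW
      · rw [coordMap_of_ne a hij, hbase]; exact hx
    · have h1 : stageFib x a k j (stageAttach x a k j t) ∈ stageAttach x a k j ⁻¹' W := by
        rw [stageFib_attach x a hj, coordMap_self]; exact hqW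
      filter_upwards [(hf j hj).eventually ((hV j).mem_nhds h1)] with q' hq'
      have hne : stageFib x a k j q' ≠ a j := fun h => ha (h ▸ hq')
      rw [eq_stageAttach_of_fib_ne x a hne]
      exact hq'

open Filter in
/-- The topology of a shrinking adjunction space is the one induced by its coordinates, that is,
`Adj x a` is a subspace of `X × ∏ j, A j`. -/
theorem Adj.le_nhds {y : Adj x a} {l : Filter (Adj x a)}
    (hp : Tendsto (coreRetraction x a) l (𝓝 (coreRetraction x a y)))
    (hf : ∀ j, Tendsto (retraction x a j) l (𝓝 (retraction x a j y))) : l ≤ 𝓝 y := by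
  have hind : Topology.IsInducing fun (z : Adj x a) (k : ℕ) => z.1 k := ⟨rfl⟩
  rw [hind.nhds_eq_comap, ← tendsto_iff_comap]
  refine tendsto_pi_nhds.2 fun k => ?_
  refine stage_le_nhds (l := map _ l) ?_ fun j hj => ?_
  · rw [tendsto_map'_iff]
    refine Tendsto.congr (f₁ := coreRetraction x a) (fun z => (stagePos_adj x a z k).symm) ?_
    rw [stagePos_adj x a y k]
    exact hp
  · rw [tendsto_map'_iff]
    refine Tendsto.congr (f₁ := retraction x a j)
      (fun z => (stageFib_eq_retraction x a z hj).symm) ?_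
    rw [stageFib_eq_retraction x a y hj]
    exact hf j

theorem Adj.continuous_of_coord {T : Type*} [TopologicalSpace T] {g : T → Adj x a}
    (hp : Continuous fun t => coreRetraction x a (g t))
    (hf : ∀ j, Continuous fun t => retraction x a j (g t)) : Continuous g := by
  refine continuous_iff_continuousAt.2 fun t => ?_
  refine Adj.le_nhds (l := Filter.map g (𝓝 t)) ?_ fun j => ?_
  · exact Filter.tendsto_map'_iff.2 hp.continuousAt
  · exact Filter.tendsto_map'_iff.2 (hf j).continuousAt

theorem continuous_core : Continuous (core x a) :=
  Adj.continuous_of_coord continuous_id fun _ => continuous_const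

theorem continuous_attach (j : ℕ) : Continuous (attach x a j) := by
  refine Adj.continuous_of_coord (by simpa using continuous_const) fun i => ?_
  simp only [retraction_attach]
  exact continuous_coordMap a i j

open Classical in
/-- The point of a shrinking adjunction space with given coordinates: `p` in the core and `t j` in
the attachment spaces. It has these coordinates only if `Adj.Valid p t` holds. -/
noncomputable def Adj.mk (x : ℕ → X) (a : ∀ j, A j) (p : X) (t : ∀ j, A j) : Adj x a :=
  if h : ∃ j, t j ≠ a j then attach x a h.choose (t h.choose) else core x a p

/-- The condition for `p`, `t j` to be the coordinates of a point of `Adj x a`. -/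
def Adj.Valid (x : ℕ → X) (a : ∀ j, A j) (p : X) (t : ∀ j, A j) : Prop :=
  ∀ j, t j ≠ a j → p = x j ∧ ∀ i, i ≠ j → t i = a i

theorem Adj.Valid.coreRetraction_mk {p : X} {t : ∀ j, A j} (h : Adj.Valid x a p t) :
    coreRetraction x a (Adj.mk x a p t) = p := by
  unfold Adj.mk
  split_ifs with h1
  · rw [coreRetraction_attach, (h _ h1.choose_spec).1]
  · rfl

theorem Adj.Valid.retraction_mk {p : X} {t : ∀ j, A j} (h : Adj.Valid x a p t) (j : ℕ) :
    retraction x a j (Adj.mk x a p t) = t j := by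
  unfold Adj.mk
  split_ifs with h1
  · by_cases hj : j = h1.choose
    · rw [hj, retraction_attach_self]
    · rw [retraction_attach_of_ne x a (Ne.symm hj), (h _ h1.choose_spec).2 j hj]
  · push Not at h1
    rw [retraction_core, h1]

theorem Adj.valid_coord (y : Adj x a) :
    Adj.Valid x a (coreRetraction x a y) fun j => retraction x a j y :=
  fun _ hj => Adj.fib_of_ne hj

theorem Adj.mk_coord (y : Adj x a) :
    Adj.mk x a (coreRetraction x a y) (fun j => retraction x a j y) = y :=
  Adj.ext_coord (Adj.valid_coord y).coreRetraction_mk (Adj.valid_coord y).retraction_mk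

theorem Adj.continuous_mk {T : Type*} [TopologicalSpace T] {p : T → X} {t : ∀ j, T → A j}
    (h : ∀ s, Adj.Valid x a (p s) fun j => t j s) (hp : Continuous p)
    (ht : ∀ j, Continuous (t j)) : Continuous fun s => Adj.mk x a (p s) fun j => t j s := by
  refine Adj.continuous_of_coord ?_ fun j => ?_
  · simpa only [(h _).coreRetraction_mk] using hp
  · simpa only [(h _).retraction_mk] using ht j

theorem mem_attachSet_iff {y : Adj x a} {j : ℕ} :
    y ∈ attachSet x a j ↔ coreRetraction x a y = x j ∧ ∀ i, i ≠ j → retraction x a i y = a i := by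
  constructor
  · rintro ⟨t, rfl⟩
    exact ⟨coreRetraction_attach x a j t, fun i hi => retraction_attach_of_ne x a (Ne.symm hi) t⟩
  · rintro ⟨h1, h2⟩
    refine ⟨retraction x a j y, Adj.ext_coord ?_ fun i => ?_⟩
    · rw [coreRetraction_attach, h1]
    · by_cases hi : i = j
      · subst hi; rw [retraction_attach_self]
      · rw [h2 i hi, retraction_attach_of_ne x a (Ne.symm hi)]

theorem mem_attachSet_iff_eq {y : Adj x a} {j : ℕ} :
    y ∈ attachSet x a j ↔ attach x a j (retraction x a j y) = y := by
  constructor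
  · rintro ⟨t, rfl⟩; rw [retraction_attach_self]
  · exact fun h => ⟨_, h⟩

theorem retraction_ne_iff {y : Adj x a} {j : ℕ} :
    retraction x a j y ≠ a j ↔ y ∈ attachSet x a j ∧ y ≠ attachPt x a j := by
  constructor
  · intro h
    exact ⟨mem_attachSet_iff_eq.2 (Adj.eq_attach h).symm, fun h1 => h (by rw [h1]; rfl)⟩
  · rintro ⟨⟨t, rfl⟩, h2⟩ h3
    rw [retraction_attach_self] at h3
    exact h2 (by rw [h3, attach_base]; rfl)

end Coordinates

/-! ### The Whitney decomposition of an open set into dyadic cells -/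

section Cells

variable {n : ℕ}

/-- A dyadic cell `∏ r, [l r / 2 ^ m, h r / 2 ^ m]`, encoded as `(m, l, h)`. -/
abbrev DyadicCell (n : ℕ) : Type := ℕ × (Fin n → ℤ) × (Fin n → ℤ)

namespace DyadicCell

/-- The points of a closed dyadic cell. -/
def carrier (e : DyadicCell n) : Set (Fin n → ℝ) :=
  {s | ∀ r, (e.2.1 r : ℝ) ≤ 2 ^ e.1 * s r ∧ 2 ^ e.1 * s r ≤ e.2.2 r}

/-- The directions in which a dyadic cell is not degenerate. -/
def dirs (e : DyadicCell n) : Finset (Fin n) := Finset.univ.filter fun r => e.2.1 r < e.2.2 r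

/-- The dimension of a dyadic cell. -/
def dim (e : DyadicCell n) : ℕ := e.dirs.card

/-- The centre of a dyadic cell. -/
noncomputable def ctr (e : DyadicCell n) : Fin n → ℝ :=
  fun r => ((e.2.1 r : ℝ) + e.2.2 r) / 2 ^ (e.1 + 1)

/-- The distance from the centre of a dyadic cell, scaled so that it is `1` on the boundary. -/
noncomputable def nrm (e : DyadicCell n) (s : Fin n → ℝ) : ℝ := ‖(2 : ℝ) ^ (e.1 + 1) • (s - e.ctr)‖

/-- The dyadic cell of scale `m` that contains `s` in its relative interior. -/
noncomputable def cellAt (m : ℕ) (s : Fin n → ℝ) : DyadicCell n :=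
  (m, fun r => ⌊2 ^ m * s r⌋, fun r => ⌈2 ^ m * s r⌉)

theorem mem_dirs {e : DyadicCell n} {r : Fin n} : r ∈ e.dirs ↔ e.2.1 r < e.2.2 r := by
  simp [dirs]

theorem mem_carrier_at (m : ℕ) (s : Fin n → ℝ) : s ∈ (cellAt m s).carrier :=
  fun _ => ⟨Int.floor_le _, Int.le_ceil _⟩

theorem isClosed_carrier (e : DyadicCell n) : IsClosed e.carrier := by
  simp only [carrier, Set.ofPred_forall, Set.ofPred_and]
  refine isClosed_iInter fun r => IsClosed.inter ?_ ?_
  · exact isClosed_le continuous_const (by fun_prop)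
  · exact isClosed_le (by fun_prop) continuous_const

theorem floor_le_floor_of_mem {m : ℕ} {s s' : Fin n → ℝ} (h : s' ∈ (cellAt m s).carrier)
    (r : Fin n) :
    ⌊2 ^ m * s r⌋ ≤ ⌊2 ^ m * s' r⌋ ∧ ⌈2 ^ m * s' r⌉ ≤ ⌈2 ^ m * s r⌉ :=
  ⟨Int.le_floor.2 (h r).1, Int.ceil_le.2 (h r).2⟩

theorem carrier_at_mono {m' m : ℕ} (hm : m' ≤ m) (s : Fin n → ℝ) :
    (cellAt m s).carrier ⊆ (cellAt m' s).carrier := by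
  obtain ⟨d, rfl⟩ := Nat.exists_eq_add_of_le hm
  intro s' hs' r
  have h2 : (0 : ℝ) < 2 ^ d := by positivity
  obtain ⟨h3, h4⟩ := hs' r
  simp only [cellAt] at h3 h4 ⊢
  constructor
  · have h5 : ⌊(2 : ℝ) ^ m' * s r⌋ * 2 ^ d ≤ ⌊(2 : ℝ) ^ (m' + d) * s r⌋ := by
      refine Int.le_floor.2 ?_
      push_cast
      have := Int.floor_le ((2 : ℝ) ^ m' * s r)
      rw [pow_add]
      nlinarith
    have h6 : ((⌊(2 : ℝ) ^ m' * s r⌋ : ℝ)) * 2 ^ d ≤ ⌊(2 : ℝ) ^ (m' + d) * s r⌋ := by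
      exact_mod_cast h5
    refine le_of_mul_le_mul_right (h6.trans (h3.trans (le_of_eq ?_))) h2
    rw [pow_add]; ring
  · have h5 : ⌈(2 : ℝ) ^ (m' + d) * s r⌉ ≤ ⌈(2 : ℝ) ^ m' * s r⌉ * 2 ^ d := by
      refine Int.ceil_le.2 ?_
      push_cast
      have := Int.le_ceil ((2 : ℝ) ^ m' * s r)
      rw [pow_add]
      nlinarith
    have h6 : (⌈(2 : ℝ) ^ (m' + d) * s r⌉ : ℝ) ≤ ((⌈(2 : ℝ) ^ m' * s r⌉ : ℝ)) * 2 ^ d := by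
      exact_mod_cast h5
    refine le_of_mul_le_mul_right ((le_of_eq ?_).trans (h4.trans h6)) h2
    rw [pow_add]; ring

theorem not_floor_lt_ceil {x : ℝ} : ¬ ⌊x⌋ < ⌈x⌉ ↔ x = ⌊x⌋ := by
  rw [not_lt]
  constructor
  · intro h
    refine le_antisymm ?_ (Int.floor_le x)
    exact (Int.le_ceil x).trans (by exact_mod_cast h)
  · intro h
    exact Int.ceil_le.2 h.le

theorem dirs_at_mono {m' m : ℕ} (hm : m' ≤ m) (s : Fin n → ℝ) :
    (cellAt m s).dirs ⊆ (cellAt m' s).dirs := by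
  obtain ⟨d, rfl⟩ := Nat.exists_eq_add_of_le hm
  intro r hr
  rw [mem_dirs] at hr ⊢
  simp only [cellAt] at hr ⊢
  by_contra h
  rw [not_floor_lt_ceil] at h
  have h1 : (2 : ℝ) ^ (m' + d) * s r = ((⌊(2 : ℝ) ^ m' * s r⌋ * 2 ^ d : ℤ) : ℝ) := by
    push_cast
    rw [← h, pow_add]; ring
  rw [h1, Int.floor_intCast, Int.ceil_intCast] at hr
  exact lt_irrefl _ hr

theorem dirs_at_subset {m : ℕ} {s s' : Fin n → ℝ} (h : s' ∈ (cellAt m s).carrier) :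
    (cellAt m s').dirs ⊆ (cellAt m s).dirs := by
  intro r hr
  rw [mem_dirs] at hr ⊢
  obtain ⟨h1, h2⟩ := floor_le_floor_of_mem h r
  simp only [cellAt] at hr ⊢
  omega

/-- The points of a closed cell lie in the open cell or in cells of lower dimension. -/
theorem at_eq_or_dim_lt {m : ℕ} {s s' : Fin n → ℝ} (h : s' ∈ (cellAt m s).carrier) :
    cellAt m s' = cellAt m s ∨ (cellAt m s').dim < (cellAt m s).dim := by
  by_cases hd : (cellAt m s).dirs ⊆ (cellAt m s').dirs
  · left
    have key : ∀ r, ⌊2 ^ m * s' r⌋ = ⌊2 ^ m * s r⌋ ∧ ⌈2 ^ m * s' r⌉ = ⌈2 ^ m * s r⌉ := by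
      intro r
      obtain ⟨h1, h2⟩ := floor_le_floor_of_mem h r
      have h3 := Int.ceil_le_floor_add_one (2 ^ m * s r)
      have h4 := Int.floor_le_ceil (2 ^ m * s' r)
      by_cases hr : r ∈ (cellAt m s).dirs
      · have h5 := mem_dirs.1 (hd hr)
        simp only [cellAt] at h5
        omega
      · rw [mem_dirs] at hr
        simp only [cellAt] at hr
        omega
    simp only [cellAt, funext fun r => (key r).1, funext fun r => (key r).2]
  · right
    exact Finset.card_lt_card ⟨dirs_at_subset h, hd⟩

theorem nrm_nonneg (e : DyadicCell n) (s : Fin n → ℝ) : 0 ≤ e.nrm s := norm_nonneg _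

theorem continuous_nrm (e : DyadicCell n) : Continuous e.nrm := by
  unfold nrm; fun_prop

theorem nrm_ray (e : DyadicCell n) {c : ℝ} (hc : 0 ≤ c) (s : Fin n → ℝ) :
    e.nrm (e.ctr + c • (s - e.ctr)) = c * e.nrm s := by
  rw [nrm, nrm, add_sub_cancel_left, smul_comm, norm_smul c, Real.norm_of_nonneg hc]

theorem nrm_apply (e : DyadicCell n) (s : Fin n → ℝ) (r : Fin n) :
    ((2 : ℝ) ^ (e.1 + 1) • (s - e.ctr)) r = 2 * (2 ^ e.1 * s r) - (e.2.1 r + e.2.2 r) := by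
  simp only [Pi.smul_apply, Pi.sub_apply, smul_eq_mul, ctr]
  have h : (2 : ℝ) ^ (e.1 + 1) ≠ 0 := by positivity
  field_simp
  rw [pow_succ]; ring

/-- A dyadic cell as it occurs in the cubical decomposition: each side is a point or a dyadic
interval of length `2 ^ (-m)`. -/
def IsProper (e : DyadicCell n) : Prop := ∀ r, e.2.2 r = e.2.1 r ∨ e.2.2 r = e.2.1 r + 1

theorem isProper_at (m : ℕ) (s : Fin n → ℝ) : (cellAt m s).IsProper := by
  intro r
  have h3 := Int.ceil_le_floor_add_one (2 ^ m * s r)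
  have h4 := Int.floor_le_ceil (2 ^ m * s r)
  simp only [cellAt]
  omega

theorem IsProper.mem_carrier_iff {e : DyadicCell n} (he : e.IsProper) {s : Fin n → ℝ} :
    s ∈ e.carrier ↔ (∀ r, e.2.2 r = e.2.1 r → s r = e.ctr r) ∧ e.nrm s ≤ 1 := by
  have hb : ∀ r, e.2.2 r = e.2.1 r → (s r = e.ctr r ↔ 2 ^ e.1 * s r = e.2.1 r) := by
    intro r hr
    simp only [ctr, hr]
    have h : (2 : ℝ) ^ (e.1 + 1) ≠ 0 := by positivity
    rw [eq_div_iff h, pow_succ]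
    constructor <;> intro h <;> linarith
  rw [nrm, pi_norm_le_iff_of_nonneg zero_le_one]
  simp only [nrm_apply, Real.norm_eq_abs, abs_le]
  constructor
  · intro h
    refine ⟨fun r hr => (hb r hr).2 (le_antisymm ?_ (h r).1), fun r => ?_⟩
    · have := (h r).2; rwa [hr] at this
    · obtain ⟨h1, h2⟩ := h r
      rcases he r with hr | hr <;> rw [hr] at h2 ⊢ <;> push_cast at h2 ⊢ <;>
        constructor <;> linarith
  · rintro ⟨h1, h2⟩ r
    obtain ⟨h3, h4⟩ := h2 r
    rcases he r with hr | hr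
    · have := (hb r hr).1 (h1 r hr)
      rw [hr, this]; simp
    · rw [hr] at h3 h4 ⊢
      push_cast at h3 h4 ⊢
      constructor <;> linarith

theorem IsProper.ray_mem {e : DyadicCell n} (he : e.IsProper) {s : Fin n → ℝ} (hs : s ∈ e.carrier)
    {c : ℝ} (hc : 0 ≤ c) (hc1 : c * e.nrm s ≤ 1) : e.ctr + c • (s - e.ctr) ∈ e.carrier := by
  rw [he.mem_carrier_iff] at hs ⊢
  refine ⟨fun r hr => ?_, by rwa [nrm_ray e hc]⟩
  simp [hs.1 r hr]

/-- The points of a closed cell at scaled distance `1` from the centre are those of its proper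
faces. -/
theorem nrm_eq_one_iff {m : ℕ} {s s' : Fin n → ℝ} (hs : s' ∈ (cellAt m s).carrier) :
    (cellAt m s).nrm s' = 1 ↔ (cellAt m s').dim < (cellAt m s).dim := by
  have hp := isProper_at m s
  have hle := ((hp.mem_carrier_iff).1 hs).2
  constructor
  · intro h
    refine (at_eq_or_dim_lt hs).resolve_left fun heq => ?_
    have hlt : (cellAt m s).nrm s' < 1 := by
      rw [nrm, pi_norm_lt_iff zero_lt_one]
      intro r
      rw [nrm_apply, Real.norm_eq_abs, abs_lt]
      simp only [cellAt, Prod.mk.injEq, true_and] at heq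
      have h1 := congrFun heq.1 r
      have h2 := congrFun heq.2 r
      simp only [cellAt, ← h1, ← h2]
      have h3 := Int.floor_le (2 ^ m * s' r)
      have h4 := Int.le_ceil (2 ^ m * s' r)
      have h5 := Int.lt_floor_add_one (2 ^ m * s' r)
      have h6 := Int.ceil_lt_add_one (2 ^ m * s' r)
      constructor <;> linarith
    exact hlt.ne h
  · intro h
    refine le_antisymm hle ?_
    have : ∃ r ∈ (cellAt m s).dirs, r ∉ (cellAt m s').dirs := by
      by_contra hcon
      push Not at hcon
      exact absurd (Finset.card_le_card hcon) (not_le.2 h)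
    obtain ⟨r, hr, hr'⟩ := this
    rw [mem_dirs] at hr hr'
    have hpr := hp r
    simp only [cellAt] at hr hr' hpr
    rw [not_floor_lt_ceil] at hr'
    obtain ⟨h1, h2⟩ := floor_le_floor_of_mem hs r
    have h3 := Int.floor_le_ceil (2 ^ m * s' r)
    have h4 : ⌈2 ^ m * s r⌉ = ⌊2 ^ m * s r⌋ + 1 := by omega
    have h5 : ⌈2 ^ m * s' r⌉ = ⌊2 ^ m * s' r⌋ := by
      conv_lhs => rw [hr']
      exact Int.ceil_intCast _
    refine le_trans ?_ (norm_le_pi_norm _ r)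
    rw [nrm_apply, Real.norm_eq_abs]
    simp only [cellAt]
    rw [h4, hr']
    rcases (show ⌊2 ^ m * s' r⌋ = ⌊2 ^ m * s r⌋ ∨ ⌊2 ^ m * s' r⌋ = ⌊2 ^ m * s r⌋ + 1 by omega)
      with h6 | h6
    · rw [h6]; push_cast; rw [le_abs]; right; linarith
    · rw [h6]; push_cast; rw [le_abs]; left; linarith

end DyadicCell

open DyadicCell

/-- The union of the closed dyadic cubes of scale `m` that contain `s`. -/
def cubeStar (m : ℕ) (s : Fin n → ℝ) : Set (Fin n → ℝ) :=
  {s' | ∀ r, (⌈2 ^ m * s r⌉ : ℝ) - 1 ≤ 2 ^ m * s' r ∧ 2 ^ m * s' r ≤ ⌊2 ^ m * s r⌋ + 1}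

theorem carrier_at_subset_cubeStar (m : ℕ) (s : Fin n → ℝ) :
    (cellAt m s).carrier ⊆ cubeStar m s := by
  intro s' hs' r
  obtain ⟨h1, h2⟩ := hs' r
  have h3 : (⌈2 ^ m * s r⌉ : ℝ) ≤ ⌊2 ^ m * s r⌋ + 1 := by
    exact_mod_cast Int.ceil_le_floor_add_one (2 ^ m * s r)
  simp only [cellAt] at h1 h2
  constructor <;> linarith

/-- The star of a face of a cell contains the star of the cell. -/
theorem cubeStar_subset {m : ℕ} {s s' : Fin n → ℝ} (h : s' ∈ (cellAt m s).carrier) :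
    cubeStar m s ⊆ cubeStar m s' := by
  intro s'' h'' r
  obtain ⟨h1, h2⟩ := floor_le_floor_of_mem h r
  obtain ⟨h3, h4⟩ := h'' r
  have h1' : (⌊2 ^ m * s r⌋ : ℝ) ≤ ⌊2 ^ m * s' r⌋ := by exact_mod_cast h1
  have h2' : (⌈2 ^ m * s' r⌉ : ℝ) ≤ ⌈2 ^ m * s r⌉ := by exact_mod_cast h2
  constructor <;> linarith

theorem dist_le_of_mem_cubeStar {m : ℕ} {s s' : Fin n → ℝ} (h : s' ∈ cubeStar m s) :
    dist s' s ≤ (1 / 2) ^ m := by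
  rw [dist_pi_le_iff (by positivity)]
  intro r
  obtain ⟨h1, h2⟩ := h r
  have h3 := Int.le_ceil (2 ^ m * s r)
  have h4 := Int.floor_le (2 ^ m * s r)
  have h5 : s' r - s r = (2 ^ m * s' r - 2 ^ m * s r) * (2 ^ m)⁻¹ := by field_simp
  rw [Real.dist_eq, one_div, inv_pow, h5, abs_mul, abs_of_pos (a := (2 ^ m : ℝ)⁻¹) (by positivity)]
  refine mul_le_of_le_one_left (by positivity) ?_
  rw [abs_le]
  constructor <;> linarith

/-- The scale of the Whitney cell of `s`: the least `m` such that all closed dyadic cubes of scale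
`m` that contain `s` lie in `U`. -/
noncomputable def whitneyScale (U : Set (Fin n → ℝ)) (s : Fin n → ℝ) : ℕ :=
  sInf {m | cubeStar m s ⊆ U}

/-- The open cells `whitneyCell U s`, `s ∈ U`, are a partition of the open set `U`. -/
noncomputable def whitneyCell (U : Set (Fin n → ℝ)) (s : Fin n → ℝ) : DyadicCell n :=
  cellAt (whitneyScale U s) s

variable {U : Set (Fin n → ℝ)}

theorem exists_cubeStar_subset (hU : IsOpen U) {K : Set (Fin n → ℝ)} (hK : IsCompact K)
    (hKU : K ⊆ U) : ∃ M, ∀ s ∈ K, cubeStar M s ⊆ U := by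
  obtain ⟨δ, hδ, hδU⟩ := hK.exists_cthickening_subset_open hU hKU
  obtain ⟨M, hM⟩ := exists_pow_lt_of_lt_one hδ (show (1 / 2 : ℝ) < 1 by norm_num)
  refine ⟨M, fun s hs s' hs' => hδU ?_⟩
  exact Metric.mem_cthickening_of_dist_le s' s δ K hs
    ((dist_le_of_mem_cubeStar hs').trans hM.le)

theorem cubeStar_whitneyScale (hU : IsOpen U) {s : Fin n → ℝ} (hs : s ∈ U) :
    cubeStar (whitneyScale U s) s ⊆ U := by
  obtain ⟨M, hM⟩ := exists_cubeStar_subset hU isCompact_singleton (Set.singleton_subset_iff.2 hs)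
  exact Nat.sInf_mem (s := {m | cubeStar m s ⊆ U}) ⟨M, hM s rfl⟩

theorem whitneyScale_le {m : ℕ} {s : Fin n → ℝ} (h : cubeStar m s ⊆ U) : whitneyScale U s ≤ m :=
  Nat.sInf_le h

theorem mem_whitneyCell (U : Set (Fin n → ℝ)) (s : Fin n → ℝ) : s ∈ (whitneyCell U s).carrier :=
  mem_carrier_at _ s

theorem whitneyCell_subset (hU : IsOpen U) {s : Fin n → ℝ} (hs : s ∈ U) :
    (whitneyCell U s).carrier ⊆ U :=
  (carrier_at_subset_cubeStar _ s).trans (cubeStar_whitneyScale hU hs)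

/-- The faces of a Whitney cell are divided into cells of at least its scale: the star of a face
contains the star of the cell. -/
theorem whitneyScale_mono (hU : IsOpen U) {s s' : Fin n → ℝ} (hs : s ∈ U)
    (h : s' ∈ (whitneyCell U s).carrier) : whitneyScale U s ≤ whitneyScale U s' := by
  by_contra hlt
  push Not at hlt
  have h1 : s' ∈ (cellAt (whitneyScale U s') s).carrier := carrier_at_mono hlt.le s h
  have h2 := cubeStar_whitneyScale hU (whitneyCell_subset hU hs h)
  exact absurd (whitneyScale_le ((cubeStar_subset h1).trans h2)) (not_le.2 hlt)

theorem whitneyCell_eq_of_at_eq (hU : IsOpen U) {s s' : Fin n → ℝ} (hs : s ∈ U)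
    (h : s' ∈ (whitneyCell U s).carrier)
    (h1 : cellAt (whitneyScale U s) s' = cellAt (whitneyScale U s) s) :
    whitneyCell U s' = whitneyCell U s := by
  have h2 : cubeStar (whitneyScale U s) s' = cubeStar (whitneyScale U s) s := by
    simp only [cellAt, Prod.mk.injEq, true_and] at h1
    simp only [cubeStar, congrFun h1.1, congrFun h1.2]
  have h3 : whitneyScale U s' = whitneyScale U s :=
    le_antisymm (whitneyScale_le (h2 ▸ cubeStar_whitneyScale hU hs)) (whitneyScale_mono hU hs h)
  rw [whitneyCell, h3, h1, whitneyCell]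

theorem dim_whitneyCell_le (hU : IsOpen U) {s s' : Fin n → ℝ} (hs : s ∈ U)
    (h : s' ∈ (whitneyCell U s).carrier) :
    (whitneyCell U s').dim ≤ (cellAt (whitneyScale U s) s').dim :=
  Finset.card_le_card (dirs_at_mono (whitneyScale_mono hU hs h) s')

/-- A closed Whitney cell is the disjoint union of its open cell and of Whitney cells of lower
dimension. -/
theorem whitneyCell_eq_or_dim_lt (hU : IsOpen U) {s s' : Fin n → ℝ} (hs : s ∈ U)
    (h : s' ∈ (whitneyCell U s).carrier) :
    whitneyCell U s' = whitneyCell U s ∨ (whitneyCell U s').dim < (whitneyCell U s).dim := by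
  rcases at_eq_or_dim_lt h with h1 | h1
  · exact Or.inl (whitneyCell_eq_of_at_eq hU hs h h1)
  · exact Or.inr ((dim_whitneyCell_le hU hs h).trans_lt h1)

theorem nrm_whitneyCell_eq_one_iff (hU : IsOpen U) {s s' : Fin n → ℝ} (hs : s ∈ U)
    (h : s' ∈ (whitneyCell U s).carrier) :
    (whitneyCell U s).nrm s' = 1 ↔ (whitneyCell U s').dim < (whitneyCell U s).dim := by
  rw [whitneyCell, nrm_eq_one_iff h]
  constructor
  · exact fun h1 => (dim_whitneyCell_le hU hs h).trans_lt h1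
  · intro h1
    refine (at_eq_or_dim_lt h).resolve_left fun h2 => ?_
    rw [← whitneyCell, whitneyCell_eq_of_at_eq hU hs h h2] at h1
    exact lt_irrefl _ h1

theorem isCompact_carrier_whitneyCell (hU : IsOpen U) (hb : U ⊆ Set.Icc 0 1) {s : Fin n → ℝ}
    (hs : s ∈ U) : IsCompact (whitneyCell U s).carrier :=
  isCompact_Icc.of_isClosed_subset (isClosed_carrier _) ((whitneyCell_subset hU hs).trans hb)

/-- The Whitney decomposition is locally finite in `U`. -/
theorem finite_whitneyCell_meeting (hU : IsOpen U) (hb : U ⊆ Set.Icc 0 1) {K : Set (Fin n → ℝ)}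
    (hK : IsCompact K) (hKU : K ⊆ U) :
    {e | ∃ s ∈ U, whitneyCell U s = e ∧ (e.carrier ∩ K).Nonempty}.Finite := by
  obtain ⟨M, hM⟩ := exists_cubeStar_subset hU hK hKU
  have hfin : (Set.Iic M ×ˢ (Set.Icc (0 : Fin n → ℤ) (fun _ => 2 ^ M) ×ˢ
      Set.Icc (0 : Fin n → ℤ) (fun _ => 2 ^ M))).Finite :=
    (Set.finite_Iic M).prod ((Set.finite_Icc _ _).prod (Set.finite_Icc _ _))
  refine hfin.subset ?_
  rintro _ ⟨s, hs, rfl, s', hs', hsK⟩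
  have h1 : whitneyScale U s ≤ M :=
    (whitneyScale_mono hU hs hs').trans (whitneyScale_le (hM s' hsK))
  have h2 : ∀ r, (0 : ℝ) ≤ 2 ^ whitneyScale U s * s r ∧ 2 ^ whitneyScale U s * s r ≤ 2 ^ M := by
    intro r
    have h3 := (hb hs).1 r
    have h4 := (hb hs).2 r
    simp only [Pi.zero_apply, Pi.one_apply] at h3 h4
    refine ⟨by positivity, ?_⟩
    calc (2 : ℝ) ^ whitneyScale U s * s r ≤ 2 ^ whitneyScale U s * 1 := by gcongr
      _ ≤ 2 ^ M := by rw [mul_one]; exact pow_le_pow_right₀ (by norm_num) h1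
  refine ⟨h1, ⟨fun r => ?_, fun r => ?_⟩, fun r => ?_, fun r => ?_⟩
  · exact Int.floor_nonneg.2 (h2 r).1
  · have h3 : ((⌊2 ^ whitneyScale U s * s r⌋ : ℤ) : ℝ) ≤ ((2 ^ M : ℤ) : ℝ) := by
      push_cast
      exact (Int.floor_le _).trans (h2 r).2
    exact Int.cast_le.1 h3
  · exact Int.ceil_nonneg (h2 r).1
  · exact Int.ceil_le.2 (by push_cast; exact (h2 r).2)

end Cells

/-! ### Null-homotopies of countable families -/

/-- Sequential connectedness for families of `k`-loops with an arbitrary countable index type. -/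
theorem SeqConnected.exists_nullhomotopies {X : Type u} [TopologicalSpace X] {N : ℕ} {p : X}
    (h : SeqConnected N p) {k : ℕ} (hk : k ≤ N) {ι : Type*} [Countable ι]
    (f : ι → Ω^ (Fin k) X p) (hf : ∀ V ∈ 𝓝 p, {i | ∃ s, f i s ∉ V}.Finite) :
    ∃ H : ∀ i, ContinuousMap.HomotopyRel (f i).1 (GenLoop.const : Ω^ (Fin k) X p).1
        (Cube.boundary (Fin k)),
      ∀ V ∈ 𝓝 p, {i | ∃ s, H i s ∉ V}.Finite := by
  obtain ⟨φ, hφ⟩ := exists_injective_nat ι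
  let g : ℕ → Ω^ (Fin k) X p := Function.extend φ f fun _ => GenLoop.const
  have hg : ∀ i, g (φ i) = f i := fun i => hφ.extend_apply f _ i
  have hgc : ∀ m, (¬ ∃ i, φ i = m) → g m = GenLoop.const := fun m hm =>
    Function.extend_apply' f _ m hm
  obtain ⟨H, hH⟩ := h k hk g (by
    intro V hV
    rw [← Nat.cofinite_eq_atTop, Filter.eventually_cofinite]
    refine ((hf V hV).image φ).subset fun m hm => ?_
    simp only [Set.mem_ofPred_eq, not_forall] at hm
    obtain ⟨s, hs⟩ := hm
    by_cases hm' : ∃ i, φ i = m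
    · obtain ⟨i, rfl⟩ := hm'
      exact ⟨i, ⟨s, by rwa [hg] at hs⟩, rfl⟩
    · rw [hgc m hm', GenLoop.const_apply] at hs
      exact absurd (mem_of_mem_nhds hV) hs)
  refine ⟨fun i => (H (φ i)).cast (by rw [hg]) rfl, fun V hV => ?_⟩
  have h1 := hH V hV
  rw [← Nat.cofinite_eq_atTop, Filter.eventually_cofinite] at h1
  refine (h1.preimage hφ.injOn).subset ?_
  rintro i ⟨s, hs⟩
  simp only [Set.mem_preimage, Set.mem_ofPred_eq, not_forall]
  exact ⟨s, hs⟩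

theorem continuousOn_of_le {T Y : Type*} [TopologicalSpace T] [TopologicalSpace Y] {S : Set T}
    (hS : IsClosed S) {p q : T → ℝ} (hp : Continuous p) (hq : Continuous q) {F : T → Y}
    (h1 : ContinuousOn F (S ∩ {x | p x ≤ q x})) (h2 : ContinuousOn F (S ∩ {x | q x ≤ p x})) :
    ContinuousOn F S := by
  have h := h1.union_of_isClosed h2 (hS.inter (isClosed_le hp hq)) (hS.inter (isClosed_le hq hp))
  refine h.mono fun x hx => ?_
  rcases le_total (p x) (q x) with hx' | hx'
  · exact Or.inl ⟨hx, hx'⟩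
  · exact Or.inr ⟨hx, hx'⟩

/-! ### Deforming a map to the base point on the boundaries of the Whitney cubes -/

open DyadicCell

section Skeleton

variable {n : ℕ}

/-- A closed `k`-dimensional dyadic cell is a copy of `I^k`. -/
theorem DyadicCell.IsProper.exists_param {e : DyadicCell n} (he : e.IsProper) :
    ∃ (par : (Fin e.dim → I) → Fin n → ℝ) (crd : (Fin n → ℝ) → Fin e.dim → I),
      Continuous par ∧ Continuous crd ∧ (∀ u, par u ∈ e.carrier) ∧
      (∀ s ∈ e.carrier, par (crd s) = s) ∧
      (∀ u ∈ Cube.boundary (Fin e.dim), e.nrm (par u) = 1) ∧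
      ∀ s ∈ e.carrier, e.nrm s = 1 → crd s ∈ Cube.boundary (Fin e.dim) := by
  let ix : Fin e.dim ≃ e.dirs := e.dirs.equivFin.symm
  have h2 : (2 : ℝ) ^ e.1 ≠ 0 := by positivity
  have hdir : ∀ r ∈ e.dirs, e.2.2 r = e.2.1 r + 1 := fun r hr => by
    have := mem_dirs.1 hr
    rcases he r with h | h <;> omega
  have hndir : ∀ r, r ∉ e.dirs → e.2.2 r = e.2.1 r := fun r hr => by
    rw [mem_dirs] at hr
    rcases he r with h | h <;> omega
  let par : (Fin e.dim → I) → Fin n → ℝ := fun u r =>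
    ((e.2.1 r : ℝ) + if h : r ∈ e.dirs then (u (ix.symm ⟨r, h⟩) : ℝ) else 0) / 2 ^ e.1
  have hpar : ∀ u r, 2 ^ e.1 * par u r =
      (e.2.1 r : ℝ) + if h : r ∈ e.dirs then (u (ix.symm ⟨r, h⟩) : ℝ) else 0 :=
    fun u r => mul_div_cancel₀ _ h2
  have hparmem : ∀ u, par u ∈ e.carrier := by
    intro u r
    rw [hpar]
    split_ifs with h
    · have := (u (ix.symm ⟨r, h⟩)).2
      rw [hdir r h]
      push_cast
      constructor <;> linarith [this.1, this.2]
    · rw [hndir r h]; simp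
  let crd : (Fin n → ℝ) → Fin e.dim → I := fun s i =>
    Set.projIcc 0 1 zero_le_one (2 ^ e.1 * s (ix i) - e.2.1 (ix i))
  have hmem : ∀ s ∈ e.carrier, ∀ r ∈ e.dirs, 2 ^ e.1 * s r - e.2.1 r ∈ I := by
    intro s hs r hr
    have h3 := hs r
    rw [hdir r hr] at h3
    push_cast at h3
    constructor <;> linarith [h3.1, h3.2]
  have hcrd : ∀ s ∈ e.carrier, ∀ i, (crd s i : ℝ) = 2 ^ e.1 * s (ix i) - e.2.1 (ix i) := by
    intro s hs i
    simp only [crd]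
    rw [Set.projIcc_of_mem zero_le_one (hmem s hs _ (ix i).2)]
  refine ⟨par, crd, ?_, ?_, hparmem, ?_, ?_, ?_⟩
  · refine continuous_pi fun r => ?_
    simp only [par]
    split_ifs with h <;> fun_prop
  · refine continuous_pi fun i => continuous_projIcc.comp (by fun_prop)
  · intro s hs
    funext r
    refine mul_left_cancel₀ h2 ?_
    rw [hpar]
    split_ifs with h
    · rw [hcrd s hs, Equiv.apply_symm_apply]; ring
    · have h3 := hs r
      rw [hndir r h] at h3
      rw [add_zero]
      exact le_antisymm h3.1 h3.2
  · rintro u ⟨i, hi⟩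
    refine le_antisymm ((he.mem_carrier_iff.1 (hparmem u)).2) ?_
    refine le_trans ?_ (norm_le_pi_norm _ (ix i : Fin n))
    rw [nrm_apply, hpar, dif_pos (ix i).2, hdir _ (ix i).2, Real.norm_eq_abs, le_abs]
    have h3 : ix.symm ⟨(ix i : Fin n), (ix i).2⟩ = i := ix.symm_apply_apply i
    rw [h3]
    push_cast
    rcases hi with hi | hi
    · right; rw [hi, Set.Icc.coe_zero]; linarith
    · left; rw [hi, Set.Icc.coe_one]; linarith
  · intro s hs h1
    by_contra hcon
    refine absurd h1 (ne_of_lt ?_)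
    rw [nrm, pi_norm_lt_iff zero_lt_one]
    intro r
    rw [nrm_apply, Real.norm_eq_abs]
    by_cases hr : r ∈ e.dirs
    · have h3 := hcrd s hs (ix.symm ⟨r, hr⟩)
      rw [Equiv.apply_symm_apply] at h3
      simp only [Cube.boundary, Set.mem_ofPred_eq, not_exists, not_or] at hcon
      obtain ⟨h4, h5⟩ := hcon (ix.symm ⟨r, hr⟩)
      have h6 := unitInterval.pos_iff_ne_zero.2 h4
      have h7 := unitInterval.lt_one_iff_ne_one.2 h5
      rw [← Subtype.coe_lt_coe, h3] at h6 h7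
      rw [hdir r hr, abs_lt]
      push_cast at h6 h7 ⊢
      constructor <;> linarith
    · have h3 := hs r
      rw [hndir r hr] at h3 ⊢
      have h4 := le_antisymm h3.1 h3.2
      rw [← h4, show 2 * (e.2.1 r : ℝ) - (e.2.1 r + e.2.1 r) = 0 by ring, abs_zero]
      exact zero_lt_one

variable {A : Type u}

/-- Extension of a homotopy `F` from the boundary of a cell to the cell, given that `F` is defined
on the cell at time `0`: the map `F` is composed with the retraction of the cell times `[0, 1]` onto
its bottom and its sides that is given by projection from a point above the centre. -/
noncomputable def collar (e : DyadicCell n) (F : (Fin n → ℝ) → ℝ → A) (s : Fin n → ℝ) (t : ℝ) : A :=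
  F (e.ctr + (max (1 - t / 2) (e.nrm s))⁻¹ • (s - e.ctr)) (2 * max 0 (e.nrm s - (1 - t / 2)))

theorem collar_of_le {e : DyadicCell n} {F : (Fin n → ℝ) → ℝ → A} {s : Fin n → ℝ} {t : ℝ}
    (h : e.nrm s ≤ 1 - t / 2) :
    collar e F s t = F (e.ctr + (1 - t / 2)⁻¹ • (s - e.ctr)) 0 := by
  rw [collar, max_eq_left h, max_eq_left (by linarith), mul_zero]

theorem collar_of_ge {e : DyadicCell n} {F : (Fin n → ℝ) → ℝ → A} {s : Fin n → ℝ} {t : ℝ}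
    (h : 1 - t / 2 ≤ e.nrm s) :
    collar e F s t = F (e.ctr + (e.nrm s)⁻¹ • (s - e.ctr)) (2 * (e.nrm s - (1 - t / 2))) := by
  rw [collar, max_eq_right h, max_eq_right (by linarith)]

theorem collar_of_nrm_eq_one {e : DyadicCell n} {F : (Fin n → ℝ) → ℝ → A} {s : Fin n → ℝ} {t : ℝ}
    (h : e.nrm s = 1) (ht : 0 ≤ t) : collar e F s t = F s t := by
  rw [collar_of_ge (by linarith), h, inv_one, one_smul, add_sub_cancel]
  congr 1; ring

theorem collar_zero {e : DyadicCell n} (he : e.IsProper) {F : (Fin n → ℝ) → ℝ → A} {s : Fin n → ℝ}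
    (hs : s ∈ e.carrier) : collar e F s 0 = F s 0 := by
  rw [collar_of_le (by simpa using (he.mem_carrier_iff.1 hs).2)]
  simp

/-- The values of the extension over a cell are values of `F` on the cell at time `0`, or on its
boundary. -/
theorem collar_cases {e : DyadicCell n} (he : e.IsProper) (F : (Fin n → ℝ) → ℝ → A)
    {s : Fin n → ℝ} (hs : s ∈ e.carrier) {t : ℝ} (ht : t ∈ Set.Icc (0 : ℝ) 1) :
    ∃ s' ∈ e.carrier, collar e F s t = F s' 0 ∨
      e.nrm s' = 1 ∧ ∃ t' ∈ Set.Icc (0 : ℝ) 1, collar e F s t = F s' t' := by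
  have h1 := (he.mem_carrier_iff.1 hs).2
  rcases le_total (e.nrm s) (1 - t / 2) with h | h
  · have hpos : 0 < 1 - t / 2 := by linarith [ht.2]
    refine ⟨_, he.ray_mem hs (inv_nonneg.2 hpos.le) ?_, Or.inl (collar_of_le h)⟩
    rw [inv_mul_le_iff₀ hpos, mul_one]; exact h
  · have hpos : 0 < e.nrm s := by linarith [ht.2]
    refine ⟨_, he.ray_mem hs (inv_nonneg.2 hpos.le) ?_, Or.inr ⟨?_, _, ?_, collar_of_ge h⟩⟩
    · rw [inv_mul_cancel₀ hpos.ne']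
    · rw [nrm_ray e (inv_nonneg.2 hpos.le), inv_mul_cancel₀ hpos.ne']
    · constructor <;> linarith [ht.2]

variable [TopologicalSpace A]

theorem continuousOn_collar {e : DyadicCell n} (he : e.IsProper) {F : (Fin n → ℝ) → ℝ → A}
    (h0 : Continuous fun s => F s 0)
    (hF : ContinuousOn (Function.uncurry F) ({s ∈ e.carrier | e.nrm s = 1} ×ˢ Set.Icc 0 1)) :
    ContinuousOn (Function.uncurry (collar e F)) (e.carrier ×ˢ Set.Icc 0 1) := by
  have hn := continuous_nrm e
  refine continuousOn_of_le ((isClosed_carrier e).prod isClosed_Icc)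
    (p := fun x => e.nrm x.1) (q := fun x => 1 - x.2 / 2) (by fun_prop) (by fun_prop) ?_ ?_
  · refine ContinuousOn.congr (f := fun x : (Fin n → ℝ) × ℝ =>
      F (e.ctr + (1 - x.2 / 2)⁻¹ • (x.1 - e.ctr)) 0) ?_ fun x hx => collar_of_le hx.2
    refine h0.comp_continuousOn ?_
    have h1 : Continuous fun x : (Fin n → ℝ) × ℝ => 1 - x.2 / 2 := by fun_prop
    have h2 : Continuous fun x : (Fin n → ℝ) × ℝ => x.1 - e.ctr := by fun_prop
    refine continuousOn_const.add ((h1.continuousOn.inv₀ ?_).smul h2.continuousOn)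
    rintro x ⟨⟨_, hx⟩, _⟩
    have := hx.2
    linarith
  · refine ContinuousOn.congr (f := fun x : (Fin n → ℝ) × ℝ =>
      Function.uncurry F (e.ctr + (e.nrm x.1)⁻¹ • (x.1 - e.ctr),
        2 * (e.nrm x.1 - (1 - x.2 / 2)))) ?_ fun x hx => collar_of_ge hx.2
    refine hF.comp ?_ ?_
    · have h1 : Continuous fun x : (Fin n → ℝ) × ℝ => e.nrm x.1 := by fun_prop
      have h2 : Continuous fun x : (Fin n → ℝ) × ℝ => x.1 - e.ctr := by fun_prop
      have h3 : Continuous fun x : (Fin n → ℝ) × ℝ => 2 * (e.nrm x.1 - (1 - x.2 / 2)) := by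
        fun_prop
      refine ContinuousOn.prodMk (continuousOn_const.add ((h1.continuousOn.inv₀ ?_).smul
        h2.continuousOn)) h3.continuousOn
      rintro x ⟨⟨_, hx⟩, hx'⟩
      have := hx.2
      have : 1 - x.2 / 2 ≤ e.nrm x.1 := hx'
      linarith
    · rintro x ⟨⟨hx1, hx⟩, hx'⟩
      have h1 := hx.2
      have h2 : 1 - x.2 / 2 ≤ e.nrm x.1 := hx'
      have hpos : 0 < e.nrm x.1 := by linarith
      have h3 := (he.mem_carrier_iff.1 hx1).2
      refine ⟨⟨he.ray_mem hx1 (inv_nonneg.2 hpos.le) ?_, ?_⟩, ?_⟩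
      · rw [inv_mul_cancel₀ hpos.ne']
      · rw [nrm_ray e (inv_nonneg.2 hpos.le), inv_mul_cancel₀ hpos.ne']
      · constructor <;> linarith

/-- `H` is a homotopy of `f`, on the Whitney cells of dimension less than `k`, to the constant map
at `a`. It is continuous on each cell and, for each neighbourhood of `a`, stays in it on all but
finitely many cells. The values of `H` off these cells are irrelevant. -/
structure SkeletonHomotopy (U : Set (Fin n → ℝ)) (f : (Fin n → ℝ) → A) (a : A) (k : ℕ)
    (H : (Fin n → ℝ) → ℝ → A) : Prop where
  zero : ∀ s, H s 0 = f s
  one : ∀ s ∈ U, (whitneyCell U s).dim < k → H s 1 = a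
  cont : ∀ s ∈ U, (whitneyCell U s).dim < k →
    ContinuousOn (Function.uncurry H) ((whitneyCell U s).carrier ×ˢ Set.Icc 0 1)
  decay : ∀ V ∈ 𝓝 a, {e | ∃ s ∈ U, whitneyCell U s = e ∧ e.dim < k ∧
    ∃ s' ∈ e.carrier, ∃ t ∈ Set.Icc (0 : ℝ) 1, H s' t ∉ V}.Finite

variable {U : Set (Fin n → ℝ)} {f : (Fin n → ℝ) → A} {a : A} {k : ℕ} {H : (Fin n → ℝ) → ℝ → A}

theorem isProper_whitneyCell (U : Set (Fin n → ℝ)) (s : Fin n → ℝ) : (whitneyCell U s).IsProper :=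
  DyadicCell.isProper_at _ s

/-- The boundary of a cell meets only finitely many of the lower cells, so that the homotopy is
continuous on it. -/
theorem SkeletonHomotopy.continuousOn_boundary (hH : SkeletonHomotopy U f a k H) (hU : IsOpen U)
    (hb : U ⊆ Set.Icc 0 1) {s₀ : Fin n → ℝ} (hs₀ : s₀ ∈ U) (hk : (whitneyCell U s₀).dim ≤ k) :
    ContinuousOn (Function.uncurry H)
      ({s ∈ (whitneyCell U s₀).carrier | (whitneyCell U s₀).nrm s = 1} ×ˢ Set.Icc 0 1) := by
  have hfin := finite_whitneyCell_meeting hU hb (isCompact_carrier_whitneyCell hU hb hs₀)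
    (whitneyCell_subset hU hs₀)
  let J := {e : DyadicCell n // (∃ s ∈ U, whitneyCell U s = e ∧
    (e.carrier ∩ (whitneyCell U s₀).carrier).Nonempty) ∧ e.dim < k}
  have : Finite J := (hfin.subset (t := {e | (∃ s ∈ U, whitneyCell U s = e ∧
    (e.carrier ∩ (whitneyCell U s₀).carrier).Nonempty) ∧ e.dim < k}) fun e he => he.1).to_subtype
  have h1 : ContinuousOn (Function.uncurry H)
      (⋃ e : J, e.1.carrier ×ˢ Set.Icc (0 : ℝ) 1) := by
    refine (locallyFinite_of_finite _).continuousOn_iUnion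
      (fun e => (isClosed_carrier _).prod isClosed_Icc) ?_
    rintro ⟨_, ⟨s, hs, rfl, _⟩, hlt⟩
    exact hH.cont s hs hlt
  refine h1.mono ?_
  rintro ⟨s, t⟩ ⟨⟨hs, hs1⟩, ht⟩
  have hlt := (nrm_whitneyCell_eq_one_iff hU hs₀ hs).1 hs1
  refine Set.mem_iUnion.2 ⟨⟨whitneyCell U s, ⟨s, whitneyCell_subset hU hs₀ hs, rfl, s,
    mem_whitneyCell U s, hs⟩, hlt.trans_le hk⟩, mem_whitneyCell U s, ht⟩

theorem SkeletonHomotopy.continuousOn_collar (hH : SkeletonHomotopy U f a k H) (hU : IsOpen U)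
    (hb : U ⊆ Set.Icc 0 1) (hf : Continuous f) {s₀ : Fin n → ℝ} (hs₀ : s₀ ∈ U)
    (hk : (whitneyCell U s₀).dim ≤ k) :
    ContinuousOn (Function.uncurry (collar (whitneyCell U s₀) H))
      ((whitneyCell U s₀).carrier ×ˢ Set.Icc 0 1) :=
  ShrinkingAdjunction.continuousOn_collar (isProper_whitneyCell U s₀)
    (by simpa only [hH.zero] using hf) (hH.continuousOn_boundary hU hb hs₀ hk)

/-- The extensions to the cells of dimension at most `k` converge to the base point, since the
values of `f` and of the homotopy on the lower cells do and the Whitney decomposition is locally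
finite. -/
theorem SkeletonHomotopy.finite_collar (hH : SkeletonHomotopy U f a k H) (hU : IsOpen U)
    (hb : U ⊆ Set.Icc 0 1) (hf : Continuous f) (hfU : ∀ s, s ∉ U → f s = a) {V : Set A}
    (hV : V ∈ 𝓝 a) :
    {e | ∃ s ∈ U, whitneyCell U s = e ∧ e.dim ≤ k ∧
      ∃ s' ∈ e.carrier, ∃ t ∈ Set.Icc (0 : ℝ) 1, collar e H s' t ∉ V}.Finite := by
  obtain ⟨W, hWV, hWo, haW⟩ := mem_nhds_iff.1 hV
  let 𝓑 := {e | ∃ s ∈ U, whitneyCell U s = e ∧ e.dim < k ∧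
    ∃ s' ∈ e.carrier, ∃ t ∈ Set.Icc (0 : ℝ) 1, H s' t ∉ V}
  have h𝓑 : 𝓑.Finite := hH.decay V hV
  let K : Set (Fin n → ℝ) := f ⁻¹' Wᶜ ∪ ⋃ e ∈ 𝓑, e.carrier
  have hK1 : f ⁻¹' Wᶜ ⊆ U := by
    intro s hs
    by_contra h
    exact hs (by rwa [hfU s h])
  have hKU : K ⊆ U := by
    refine Set.union_subset hK1 (Set.iUnion₂_subset ?_)
    rintro _ ⟨s, hs, rfl, _⟩
    exact whitneyCell_subset hU hs
  have hK : IsCompact K := by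
    refine (isCompact_Icc.of_isClosed_subset (hWo.isClosed_compl.preimage hf)
      (hK1.trans hb)).union (h𝓑.isCompact_biUnion ?_)
    rintro _ ⟨s, hs, rfl, _⟩
    exact isCompact_carrier_whitneyCell hU hb hs
  -- A cell whose collar leaves `V` meets the compact set `K`.
  refine (finite_whitneyCell_meeting hU hb hK hKU).subset ?_
  rintro _ ⟨s, hs, rfl, hk, s', hs', t, ht, hnV⟩
  refine ⟨s, hs, rfl, ?_⟩
  obtain ⟨s'', h1, h2 | ⟨h2, t', ht', h3⟩⟩ := collar_cases (isProper_whitneyCell U s) H hs' ht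
  · refine ⟨s'', h1, Or.inl fun h => hnV (hWV ?_)⟩
    rw [h2, hH.zero]; exact h
  · refine ⟨s'', h1, Or.inr (Set.mem_iUnion₂.2 ⟨whitneyCell U s'', ?_, mem_whitneyCell U s''⟩)⟩
    have hlt := (nrm_whitneyCell_eq_one_iff hU hs h1).1 h2
    exact ⟨s'', whitneyCell_subset hU hs h1, rfl, hlt.trans_le hk, s'', mem_whitneyCell U s'', t',
      ht', h3 ▸ hnV⟩

end Skeleton

open DyadicCell

section Skeleton

variable {n : ℕ} {A : Type u} [TopologicalSpace A] {U : Set (Fin n → ℝ)} {f : (Fin n → ℝ) → A}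
  {a : A} {k : ℕ} {H : (Fin n → ℝ) → ℝ → A}

/-- The inductive step: after the homotopy on the lower cells, `f` restricts to a `k`-loop on each
`k`-cell, and these `k`-loops converge to the base point, so that they are null-homotopic by
null-homotopies that converge to the base point. -/
theorem SkeletonHomotopy.exists_succ (hH : SkeletonHomotopy U f a k H) (hU : IsOpen U)
    (hb : U ⊆ Set.Icc 0 1) (hf : Continuous f) (hfU : ∀ s, s ∉ U → f s = a) {N : ℕ}
    (hA : SeqConnected N a) (hk : k ≤ N) : ∃ H', SkeletonHomotopy U f a (k + 1) H' := by
  classical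
  let J := {e : DyadicCell n // ∃ s ∈ U, whitneyCell U s = e ∧ e.dim = k}
  have hprop : ∀ e : J, e.1.IsProper := by
    rintro ⟨_, s, hs, rfl, _⟩
    exact isProper_whitneyCell U s
  have hparam : ∀ e : J, ∃ (par : (Fin k → I) → Fin n → ℝ) (crd : (Fin n → ℝ) → Fin k → I),
      Continuous par ∧ Continuous crd ∧ (∀ u, par u ∈ e.1.carrier) ∧
      (∀ s ∈ e.1.carrier, par (crd s) = s) ∧
      (∀ u ∈ Cube.boundary (Fin k), e.1.nrm (par u) = 1) ∧
      ∀ s ∈ e.1.carrier, e.1.nrm s = 1 → crd s ∈ Cube.boundary (Fin k) := by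
    intro e
    have h1 := (hprop e).exists_param
    have h2 : e.1.dim = k := by obtain ⟨_, s, hs, _, h⟩ := e; exact h
    rw [h2] at h1
    exact h1
  choose par crd hpar hcrd hparmem hparcrd hparbd hcrdbd using hparam
  have hcol : ∀ e : J, ContinuousOn (Function.uncurry (collar e.1 H))
      (e.1.carrier ×ˢ Set.Icc 0 1) := by
    rintro ⟨_, s, hs, rfl, hd⟩
    exact hH.continuousOn_collar hU hb hf hs hd.le
  have hbd : ∀ e : J, ∀ s ∈ e.1.carrier, e.1.nrm s = 1 → H s 1 = a := by
    rintro ⟨_, s, hs, rfl, hd⟩ s' hs' h1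
    have := (nrm_whitneyCell_eq_one_iff hU hs hs').1 h1
    exact hH.one s' (whitneyCell_subset hU hs hs') (this.trans_le hd.le)
  -- The `k`-loops on the `k`-cells at the end of the collar homotopies.
  let g : J → Ω^ (Fin k) A a := fun e => ⟨⟨fun u => collar e.1 H (par e u) 1, by
      refine (hcol e).comp_continuous (f := fun u => (par e u, (1 : ℝ)))
        ((hpar e).prodMk continuous_const) fun u => ⟨hparmem e u, ?_⟩
      exact ⟨zero_le_one, le_rfl⟩⟩, fun u hu => by
      have h1 := hparbd e u hu
      change collar e.1 H (par e u) 1 = a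
      rw [collar_of_nrm_eq_one h1 zero_le_one]
      exact hbd e _ (hparmem e u) h1⟩
  obtain ⟨N', hN'⟩ := hA.exists_nullhomotopies hk g (by
    intro V hV
    refine Set.Finite.of_finite_image ((hH.finite_collar hU hb hf hfU hV).subset ?_)
      Subtype.val_injective.injOn
    rintro _ ⟨e, ⟨u, hu⟩, rfl⟩
    obtain ⟨s, hs, h1, h2⟩ := e.2
    exact ⟨s, hs, h1, h2.le, par e u, hparmem e u, 1, ⟨zero_le_one, le_rfl⟩, hu⟩)
  -- On a `k`-cell the collar homotopy is followed by the null-homotopy.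
  let M : J → (Fin n → ℝ) → ℝ → A := fun e s t =>
    if t ≤ 1 / 2 then collar e.1 H s (2 * t)
    else N' e (Set.projIcc 0 1 zero_le_one (2 * t - 1), crd e s)
  have hMhalf : ∀ e : J, ∀ s ∈ e.1.carrier, ∀ t : ℝ, 1 / 2 ≤ t →
      M e s t = N' e (Set.projIcc 0 1 zero_le_one (2 * t - 1), crd e s) := by
    intro e s hs t ht
    simp only [M]
    split_ifs with h
    · have ht' : t = 1 / 2 := le_antisymm h ht
      subst ht'
      have h1 : Set.projIcc (0 : ℝ) 1 zero_le_one (2 * (1 / 2) - 1) = 0 := by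
        norm_num [Set.projIcc_left]
      rw [h1, (N' e).apply_zero]
      change _ = collar e.1 H (par e (crd e s)) 1
      rw [hparcrd e s hs]
      norm_num
    · rfl
  have hMcont : ∀ e : J, ContinuousOn (Function.uncurry (M e)) (e.1.carrier ×ˢ Set.Icc 0 1) := by
    intro e
    refine continuousOn_of_le ((isClosed_carrier _).prod isClosed_Icc) (p := fun x => x.2)
      (q := fun _ => 1 / 2) continuous_snd continuous_const ?_ ?_
    · refine ContinuousOn.congr (f := fun x : (Fin n → ℝ) × ℝ =>
        Function.uncurry (collar e.1 H) (x.1, 2 * x.2)) ?_ fun x hx => if_pos hx.2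
      refine (hcol e).comp (by fun_prop) ?_
      rintro ⟨s, t⟩ ⟨⟨hs, ht⟩, ht'⟩
      have h1 : t ≤ 1 / 2 := ht'
      exact ⟨hs, by linarith [ht.1], by linarith⟩
    · refine ContinuousOn.congr (f := fun x : (Fin n → ℝ) × ℝ =>
        N' e (Set.projIcc 0 1 zero_le_one (2 * x.2 - 1), crd e x.1)) ?_
        fun x hx => hMhalf e _ hx.1.1 _ hx.2
      refine Continuous.continuousOn ((N' e).continuous.comp (Continuous.prodMk ?_ ?_))
      · exact continuous_projIcc.comp (by fun_prop)
      · exact (hcrd e).comp continuous_fst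
  -- On the boundary of a cell this is the given homotopy, run at double speed.
  have hMbd : ∀ e : J, ∀ s ∈ e.1.carrier, e.1.nrm s = 1 → ∀ t ∈ Set.Icc (0 : ℝ) 1,
      M e s t = H s (min (2 * t) 1) := by
    intro e s hs h1 t ht
    rcases le_total t (1 / 2) with h | h
    · simp only [M, if_pos h]
      rw [collar_of_nrm_eq_one h1 (by linarith [ht.1]), min_eq_left (by linarith)]
    · rw [hMhalf e s hs t h, (N' e).eq_fst _ (hcrdbd e s hs h1), min_eq_right (by linarith)]
      change collar e.1 H (par e (crd e s)) 1 = _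
      rw [hparcrd e s hs, collar_of_nrm_eq_one h1 zero_le_one]
  let H' : (Fin n → ℝ) → ℝ → A := fun s t =>
    if h : s ∈ U ∧ (whitneyCell U s).dim = k then M ⟨whitneyCell U s, s, h.1, rfl, h.2⟩ s t
    else H s (min (2 * t) 1)
  have hH'lt : ∀ s ∈ U, (whitneyCell U s).dim < k → ∀ t, H' s t = H s (min (2 * t) 1) :=
    fun s hs hlt t => dif_neg fun h => hlt.ne h.2
  have hH'M : ∀ e : J, ∀ s ∈ e.1.carrier, ∀ t ∈ Set.Icc (0 : ℝ) 1, H' s t = M e s t := by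
    rintro ⟨_, s₀, hs₀, rfl, hd⟩ s hs t ht
    have hsU := whitneyCell_subset hU hs₀ hs
    rcases whitneyCell_eq_or_dim_lt hU hs₀ hs with h | h
    · simp only [H', h, dif_pos (And.intro hsU hd)]
    · rw [hH'lt s hsU (h.trans_le hd.le)]
      exact (hMbd ⟨_, s₀, hs₀, rfl, hd⟩ s hs
        ((nrm_whitneyCell_eq_one_iff hU hs₀ hs).2 h) t ht).symm
  refine ⟨H', ⟨fun s => ?_, fun s hs hlt => ?_, fun s hs hlt => ?_, fun V hV => ?_⟩⟩
  · by_cases h : s ∈ U ∧ (whitneyCell U s).dim = k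
    · have h1 := hH'M ⟨whitneyCell U s, s, h.1, rfl, h.2⟩ s (mem_whitneyCell U s) 0
        ⟨le_rfl, zero_le_one⟩
      rw [h1]
      simp only [M]
      rw [if_pos (by norm_num), mul_zero,
        collar_zero (isProper_whitneyCell U s) (mem_whitneyCell U s), hH.zero]
    · simp only [H', dif_neg h]
      rw [mul_zero, min_eq_left zero_le_one, hH.zero]
  · rcases (Nat.lt_succ_iff_lt_or_eq.1 hlt) with h | h
    · rw [hH'lt s hs h, min_eq_right (by norm_num), hH.one s hs h]
    · rw [hH'M ⟨whitneyCell U s, s, hs, rfl, h⟩ s (mem_whitneyCell U s) 1 ⟨zero_le_one, le_rfl⟩,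
        hMhalf _ _ (mem_whitneyCell U s) _ (by norm_num)]
      have h1 : Set.projIcc (0 : ℝ) 1 zero_le_one (2 * 1 - 1) = 1 := by
        norm_num [Set.projIcc_right]
      rw [h1, (N' _).apply_one]
      rfl
  · rcases (Nat.lt_succ_iff_lt_or_eq.1 hlt) with h | h
    · refine ContinuousOn.congr (f := fun x : (Fin n → ℝ) × ℝ =>
        Function.uncurry H (x.1, min (2 * x.2) 1)) ?_ ?_
      · refine (hH.cont s hs h).comp (Continuous.continuousOn (by fun_prop)) ?_
        rintro ⟨s', t⟩ ⟨hs', ht⟩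
        exact ⟨hs', le_min (by linarith [ht.1]) zero_le_one, min_le_right _ _⟩
      · rintro ⟨s', t⟩ ⟨hs', ht⟩
        refine hH'lt s' (whitneyCell_subset hU hs hs') ?_ t
        rcases whitneyCell_eq_or_dim_lt hU hs hs' with h1 | h1
        · rwa [h1]
        · exact h1.trans h
    · refine (hMcont ⟨whitneyCell U s, s, hs, rfl, h⟩).congr ?_
      rintro ⟨s', t⟩ ⟨hs', ht⟩
      exact hH'M ⟨whitneyCell U s, s, hs, rfl, h⟩ s' hs' t ht
  · refine ((hH.decay V hV).union ((hH.finite_collar hU hb hf hfU hV).union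
      ((hN' V hV).image Subtype.val))).subset ?_
    rintro _ ⟨s, hs, rfl, hlt, s', hs', t, ht, hnV⟩
    rcases (Nat.lt_succ_iff_lt_or_eq.1 hlt) with h | h
    · left
      refine ⟨s, hs, rfl, h, s', hs', min (2 * t) 1,
        ⟨le_min (by linarith [ht.1]) zero_le_one, min_le_right _ _⟩, ?_⟩
      rwa [← hH'lt s' (whitneyCell_subset hU hs hs')]
      rcases whitneyCell_eq_or_dim_lt hU hs hs' with h1 | h1
      · rwa [h1]
      · exact h1.trans h
    · right
      rw [hH'M ⟨whitneyCell U s, s, hs, rfl, h⟩ s' hs' t ht] at hnV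
      rcases le_total t (1 / 2) with h1 | h1
      · left
        simp only [M, if_pos h1] at hnV
        exact ⟨s, hs, rfl, h.le, s', hs', 2 * t, ⟨by linarith [ht.1], by linarith⟩, hnV⟩
      · right
        rw [hMhalf _ _ hs' _ h1] at hnV
        exact ⟨⟨whitneyCell U s, s, hs, rfl, h⟩, ⟨_, hnV⟩, rfl⟩

theorem skeletonHomotopy_zero (U : Set (Fin n → ℝ)) (f : (Fin n → ℝ) → A) (a : A) :
    SkeletonHomotopy U f a 0 fun s _ => f s :=
  ⟨fun _ => rfl, fun _ _ h => absurd h (Nat.not_lt_zero _),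
    fun _ _ h => absurd h (Nat.not_lt_zero _), fun V _ => by
      convert Set.finite_empty
      ext e
      simp⟩

theorem exists_skeletonHomotopy (hU : IsOpen U) (hb : U ⊆ Set.Icc 0 1) (hf : Continuous f)
    (hfU : ∀ s, s ∉ U → f s = a) {N : ℕ} (hA : SeqConnected N a) :
    ∀ k ≤ N + 1, ∃ H, SkeletonHomotopy U f a k H := by
  intro k
  induction k with
  | zero => exact fun _ => ⟨_, skeletonHomotopy_zero U f a⟩
  | succ k ih =>
    intro hk
    obtain ⟨H, hH⟩ := ih (by omega)
    exact hH.exists_succ hU hb hf hfU hA (by omega)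

/-- A map to a sequentially `(n - 1)`-connected space is homotopic, by a homotopy that is supported
where the map differs from the base point, to a map that sends the boundaries of the cubes of the
Whitney decomposition of this set to the base point. On each cube the homotopy shrinks the given map
to a smaller concentric cube. -/
theorem exists_whitney_homotopy (hU : IsOpen U) (hb : U ⊆ Set.Icc 0 1) (hf : Continuous f)
    (hfU : ∀ s, s ∉ U → f s = a) (hn : 1 ≤ n) (hA : SeqConnected (n - 1) a) :
    ∃ h : (Fin n → ℝ) → ℝ → A,
      ContinuousOn (Function.uncurry h) (Set.univ ×ˢ Set.Icc 0 1) ∧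
      (∀ s, h s 0 = f s) ∧ (∀ s, s ∉ U → ∀ t, h s t = a) ∧
      (∀ s ∈ U, (whitneyCell U s).dim < n → h s 1 = a) ∧
      ∀ s₀ ∈ U, (whitneyCell U s₀).dim = n → ∀ s ∈ (whitneyCell U s₀).carrier,
        ∀ t ∈ Set.Icc (0 : ℝ) 1, (whitneyCell U s₀).nrm s ≤ 1 - t / 2 →
          h s t = f ((whitneyCell U s₀).ctr + (1 - t / 2)⁻¹ • (s - (whitneyCell U s₀).ctr)) := by
  classical
  obtain ⟨H, hH⟩ := exists_skeletonHomotopy hU hb hf hfU hA n (by omega)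
  have hdim : ∀ s, (whitneyCell U s).dim ≤ n := fun s =>
    (Finset.card_le_univ _).trans (Fintype.card_fin n).le
  let h : (Fin n → ℝ) → ℝ → A := fun s t =>
    if s ∈ U then if (whitneyCell U s).dim < n then H s t else collar (whitneyCell U s) H s t
    else a
  have hlow : ∀ s ∈ U, (whitneyCell U s).dim < n → ∀ t, h s t = H s t := by
    intro s hs hd t
    simp only [h, if_pos hs, if_pos hd]
  have htop : ∀ s₀ ∈ U, (whitneyCell U s₀).dim = n → ∀ s ∈ (whitneyCell U s₀).carrier,
      ∀ t ∈ Set.Icc (0 : ℝ) 1, h s t = collar (whitneyCell U s₀) H s t := by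
    intro s₀ hs₀ hd s hs t ht
    have hsU := whitneyCell_subset hU hs₀ hs
    rcases whitneyCell_eq_or_dim_lt hU hs₀ hs with h1 | h1
    · simp only [h, if_pos hsU]
      rw [h1, if_neg (by omega)]
    · rw [hlow s hsU (h1.trans_le hd.le),
        collar_of_nrm_eq_one ((nrm_whitneyCell_eq_one_iff hU hs₀ hs).2 h1) ht.1]
  have hcell : ∀ s ∈ U, ContinuousOn (Function.uncurry h)
      ((whitneyCell U s).carrier ×ˢ Set.Icc 0 1) := by
    intro s hs
    rcases (hdim s).lt_or_eq with hd | hd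
    · refine (hH.cont s hs hd).congr ?_
      rintro ⟨s', t⟩ ⟨hs', ht⟩
      refine hlow s' (whitneyCell_subset hU hs hs') ?_ t
      rcases whitneyCell_eq_or_dim_lt hU hs hs' with h1 | h1
      · rwa [h1]
      · exact h1.trans hd
    · refine (hH.continuousOn_collar hU hb hf hs hd.le).congr ?_
      rintro ⟨s', t⟩ ⟨hs', ht⟩
      exact htop s hs hd s' hs' t ht
  refine ⟨h, ?_, ?_, fun s hs t => if_neg hs, fun s hs hd => ?_, ?_⟩
  · rintro ⟨s, t⟩ ⟨-, ht⟩
    by_cases hs : s ∈ U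
    · obtain ⟨K, hK, hsK, hKU⟩ := exists_compact_subset hU hs
      have hfin := finite_whitneyCell_meeting hU hb hK hKU
      let J := {e : DyadicCell n // ∃ s ∈ U, whitneyCell U s = e ∧ (e.carrier ∩ K).Nonempty}
      have : Finite J := hfin.to_subtype
      have h1 : ContinuousOn (Function.uncurry h) (⋃ e : J, e.1.carrier ×ˢ Set.Icc (0 : ℝ) 1) := by
        refine (locallyFinite_of_finite _).continuousOn_iUnion
          (fun e => (isClosed_carrier _).prod isClosed_Icc) ?_
        rintro ⟨_, s, hs, rfl, _⟩
        exact hcell s hs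
      have h2 : K ×ˢ Set.Icc (0 : ℝ) 1 ⊆ ⋃ e : J, e.1.carrier ×ˢ Set.Icc (0 : ℝ) 1 := by
        rintro ⟨s', t'⟩ ⟨hs', ht'⟩
        exact Set.mem_iUnion.2 ⟨⟨whitneyCell U s', s', hKU hs', rfl, s', mem_whitneyCell U s', hs'⟩,
          mem_whitneyCell U s', ht'⟩
      refine ((h1.mono h2) (s, t) ⟨interior_subset hsK, ht⟩).mono_of_mem_nhdsWithin ?_
      rw [nhdsWithin_prod_eq, nhdsWithin_univ]
      exact Filter.prod_mem_prod (mem_interior_iff_mem_nhds.1 hsK) self_mem_nhdsWithin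
    · -- Near a point outside of `U`, all but finitely many cells are mapped close to the base
      -- point.
      change Filter.Tendsto _ _ _
      have hval : Function.uncurry h (s, t) = a := if_neg hs
      rw [hval]
      intro V hV
      let 𝓑 : Set (DyadicCell n) :=
        {e | ∃ s ∈ U, whitneyCell U s = e ∧ e.dim ≤ n ∧
          ∃ s' ∈ e.carrier, ∃ t ∈ Set.Icc (0 : ℝ) 1, collar e H s' t ∉ V} ∪
        {e | ∃ s ∈ U, whitneyCell U s = e ∧ e.dim < n ∧
          ∃ s' ∈ e.carrier, ∃ t ∈ Set.Icc (0 : ℝ) 1, H s' t ∉ V}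
      have hfin : 𝓑.Finite := (hH.finite_collar hU hb hf hfU hV).union (hH.decay V hV)
      have hclosed : IsClosed (⋃ e ∈ 𝓑, e.carrier) :=
        hfin.isClosed_biUnion fun e _ => isClosed_carrier e
      have hns : s ∈ (⋃ e ∈ 𝓑, e.carrier)ᶜ := by
        intro hmem
        obtain ⟨e, he, hse⟩ := Set.mem_iUnion₂.1 hmem
        rcases he with ⟨s', hs', rfl, _⟩ | ⟨s', hs', rfl, _⟩ <;>
          exact hs (whitneyCell_subset hU hs' hse)
      have hnhds : ((⋃ e ∈ 𝓑, e.carrier)ᶜ ×ˢ Set.Icc (0 : ℝ) 1) ∈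
          𝓝[Set.univ ×ˢ Set.Icc 0 1] (s, t) := by
        rw [nhdsWithin_prod_eq, nhdsWithin_univ]
        exact Filter.prod_mem_prod (hclosed.isOpen_compl.mem_nhds hns) self_mem_nhdsWithin
      refine Filter.mem_map.2 (Filter.mem_of_superset hnhds ?_)
      rintro ⟨s', t'⟩ ⟨hs', ht'⟩
      by_contra hnV
      change h s' t' ∉ V at hnV
      by_cases hsU : s' ∈ U
      · refine hs' (Set.mem_iUnion₂.2 ⟨whitneyCell U s', ?_, mem_whitneyCell U s'⟩)
        rcases (hdim s').lt_or_eq with hd | hd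
        · right
          rw [hlow s' hsU hd] at hnV
          exact ⟨s', hsU, rfl, hd, s', mem_whitneyCell U s', t', ht', hnV⟩
        · left
          rw [htop s' hsU hd s' (mem_whitneyCell U s') t' ht'] at hnV
          exact ⟨s', hsU, rfl, hd.le, s', mem_whitneyCell U s', t', ht', hnV⟩
      · have h1 : h s' t' = a := if_neg hsU
        rw [h1] at hnV
        exact hnV (mem_of_mem_nhds hV)
  · intro s
    by_cases hs : s ∈ U
    · rcases (hdim s).lt_or_eq with hd | hd
      · rw [hlow s hs hd, hH.zero]
      · rw [htop s hs hd s (mem_whitneyCell U s) 0 ⟨le_rfl, zero_le_one⟩,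
          collar_zero (isProper_whitneyCell U s) (mem_whitneyCell U s), hH.zero]
    · rw [hfU s hs]; exact if_neg hs
  · rw [hlow s hs hd, hH.one s hs hd]
  · intro s₀ hs₀ hd s hs t ht hle
    rw [htop s₀ hs₀ hd s hs t ht, collar_of_le hle, hH.zero]

end Skeleton

/-! ### Boxes and maps that are supported in disjoint boxes -/

/-- The truncation of a real number to `[0, 1]`. -/
def clamp (x : ℝ) : ℝ := max 0 (min x 1)

theorem continuous_clamp : Continuous clamp := by unfold clamp; fun_prop

theorem clamp_nonneg (x : ℝ) : 0 ≤ clamp x := le_max_left _ _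

theorem clamp_le_one (x : ℝ) : clamp x ≤ 1 := max_le zero_le_one (min_le_right _ _)

theorem clamp_of_mem {x : ℝ} (h0 : 0 ≤ x) (h1 : x ≤ 1) : clamp x = x := by
  rw [clamp, min_eq_left h1, max_eq_right h0]

theorem clamp_of_nonpos {x : ℝ} (h : x ≤ 0) : clamp x = 0 :=
  max_eq_left ((min_le_left _ _).trans h)

theorem clamp_of_one_le {x : ℝ} (h : 1 ≤ x) : clamp x = 1 := by
  rw [clamp, min_eq_right h, max_eq_right zero_le_one]

theorem pos_of_clamp_ne_zero {x : ℝ} (h : clamp x ≠ 0) : 0 < x := by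
  by_contra hx
  exact h (clamp_of_nonpos (not_lt.1 hx))

theorem lt_one_of_clamp_ne_one {x : ℝ} (h : clamp x ≠ 1) : x < 1 := by
  by_contra hx
  exact h (clamp_of_one_le (not_lt.1 hx))

/-- A closed box with nonempty interior in `ℝ^n`. -/
@[ext] structure Box (n : ℕ) where
  lo : Fin n → ℝ
  hi : Fin n → ℝ
  lt : ∀ i, lo i < hi i

namespace Box

variable {n : ℕ}

/-- The points of a box. -/
def carrier (C : Box n) : Set (Fin n → ℝ) := {s | ∀ i, C.lo i ≤ s i ∧ s i ≤ C.hi i}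

/-- The open box. -/
def inner (C : Box n) : Set (Fin n → ℝ) := {s | ∀ i, C.lo i < s i ∧ s i < C.hi i}

/-- The boundary of a box. -/
def bd (C : Box n) : Set (Fin n → ℝ) := {s ∈ C.carrier | ∃ i, s i = C.lo i ∨ s i = C.hi i}

theorem inner_subset (C : Box n) : C.inner ⊆ C.carrier := fun _ h i => ⟨(h i).1.le, (h i).2.le⟩

theorem mem_inner_or_bd {C : Box n} {s : Fin n → ℝ} (h : s ∈ C.carrier) :
    s ∈ C.inner ∨ s ∈ C.bd := by
  by_cases hb : ∃ i, s i = C.lo i ∨ s i = C.hi i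
  · exact Or.inr ⟨h, hb⟩
  · push Not at hb
    exact Or.inl fun i => ⟨lt_of_le_of_ne (h i).1 (hb i).1.symm, lt_of_le_of_ne (h i).2 (hb i).2⟩

theorem notMem_inner_of_mem_bd {C : Box n} {s : Fin n → ℝ} (h : s ∈ C.bd) : s ∉ C.inner := by
  rintro h1
  obtain ⟨-, i, hi | hi⟩ := h
  · exact (h1 i).1.ne' hi
  · exact (h1 i).2.ne hi

theorem isOpen_inner (C : Box n) : IsOpen C.inner := by
  have h : C.inner = ⋂ i, ((fun s : Fin n → ℝ => s i) ⁻¹' Set.Ioo (C.lo i) (C.hi i)) := by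
    ext s; simp [inner]
  rw [h]
  exact isOpen_iInter_of_finite fun i => isOpen_Ioo.preimage (continuous_apply i)

theorem isClosed_carrier (C : Box n) : IsClosed C.carrier := by
  have h : C.carrier = ⋂ i, ((fun s : Fin n → ℝ => s i) ⁻¹' Set.Icc (C.lo i) (C.hi i)) := by
    ext s; simp [carrier]
  rw [h]
  exact isClosed_iInter fun i => isClosed_Icc.preimage (continuous_apply i)

/-- An open set that meets a box meets its interior. -/
theorem inter_inner_nonempty {C : Box n} {O : Set (Fin n → ℝ)} (hO : IsOpen O) {s : Fin n → ℝ}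
    (hs : s ∈ C.carrier) (hsO : s ∈ O) : (O ∩ C.inner).Nonempty := by
  let c : Fin n → ℝ := fun i => (C.lo i + C.hi i) / 2
  let p : ℝ → Fin n → ℝ := fun t i => (1 - t) * s i + t * c i
  have hp : Continuous p := by unfold p; fun_prop
  have h0 : p 0 ∈ O := by
    have : p 0 = s := by funext i; simp [p]
    rwa [this]
  have h1 : ∀ᶠ t in 𝓝[>] (0 : ℝ), p t ∈ O :=
    nhdsWithin_le_nhds ((hO.preimage hp).mem_nhds h0)
  have h2 : ∀ᶠ t in 𝓝[>] (0 : ℝ), t ∈ Set.Ioo (0 : ℝ) 1 := Ioo_mem_nhdsGT zero_lt_one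
  obtain ⟨t, ht1, ht2⟩ := (h1.and h2).exists
  refine ⟨p t, ht1, fun i => ?_⟩
  have h3 := hs i
  have h4 := C.lt i
  simp only [p, c]
  constructor <;> nlinarith [ht2.1, ht2.2, h3.1, h3.2]

theorem notMem_inner_of_disjoint {C D : Box n} (h : Disjoint C.inner D.inner) {s : Fin n → ℝ}
    (hs : s ∈ C.carrier) : s ∉ D.inner := fun hD => by
  obtain ⟨x, hx1, hx2⟩ := inter_inner_nonempty D.isOpen_inner hs hD
  exact Set.disjoint_left.1 h hx2 hx1

/-- The affine map of the box `C` onto the box `D`, precomposed with the truncation to `C`. -/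
noncomputable def map (C D : Box n) (s : Fin n → ℝ) : Fin n → ℝ :=
  fun r => D.lo r + (D.hi r - D.lo r) * clamp ((s r - C.lo r) / (C.hi r - C.lo r))

theorem map_mem (C D : Box n) (s : Fin n → ℝ) : C.map D s ∈ D.carrier := by
  intro r
  have h := D.lt r
  have h1 := clamp_nonneg ((s r - C.lo r) / (C.hi r - C.lo r))
  have h2 := clamp_le_one ((s r - C.lo r) / (C.hi r - C.lo r))
  simp only [map]
  constructor <;> nlinarith

theorem map_self {C : Box n} {s : Fin n → ℝ} (hs : s ∈ C.carrier) : C.map C s = s := by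
  funext r
  have h := C.lt r
  have h1 := hs r
  have h2 : (s r - C.lo r) / (C.hi r - C.lo r) ≤ 1 := (div_le_one (by linarith)).2 (by linarith)
  rw [map, clamp_of_mem (div_nonneg (by linarith) (by linarith)) h2,
    mul_div_cancel₀ _ (by linarith : C.hi r - C.lo r ≠ 0)]
  ring

/-- The truncation moves points outside of the open box to its boundary. -/
theorem map_mem_inner_iff {C D : Box n} {s : Fin n → ℝ} : C.map D s ∈ D.inner ↔ s ∈ C.inner := by
  refine forall_congr' fun r => ?_
  have h := D.lt r
  have h' := C.lt r
  have h3 : 0 < C.hi r - C.lo r := by linarith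
  have h1 := clamp_nonneg ((s r - C.lo r) / (C.hi r - C.lo r))
  have h2 := clamp_le_one ((s r - C.lo r) / (C.hi r - C.lo r))
  simp only [map]
  constructor
  · rintro ⟨h4, h5⟩
    have h6 : clamp ((s r - C.lo r) / (C.hi r - C.lo r)) ≠ 0 := fun h0 => by
      rw [h0] at h4; linarith
    have h7 : clamp ((s r - C.lo r) / (C.hi r - C.lo r)) ≠ 1 := fun h0 => by
      rw [h0] at h5; linarith
    have h8 := pos_of_clamp_ne_zero h6
    have h9 := lt_one_of_clamp_ne_one h7
    rw [div_pos_iff_of_pos_right h3] at h8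
    rw [div_lt_one h3] at h9
    constructor <;> linarith
  · rintro ⟨h4, h5⟩
    have h8 : 0 < (s r - C.lo r) / (C.hi r - C.lo r) := div_pos (by linarith) h3
    have h9 : (s r - C.lo r) / (C.hi r - C.lo r) < 1 := (div_lt_one h3).2 (by linarith)
    rw [clamp_of_mem h8.le h9.le]
    constructor <;> nlinarith

theorem map_mem_bd_iff {C D : Box n} {s : Fin n → ℝ} : C.map D s ∈ D.bd ↔ s ∉ C.inner := by
  rw [← map_mem_inner_iff (D := D)]
  constructor
  · exact notMem_inner_of_mem_bd
  · exact fun h => (mem_inner_or_bd (map_mem C D s)).resolve_left h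

/-- The box `(1 - t) C + t D`. -/
@[simps] noncomputable def interp (C D : Box n) (t : I) : Box n where
  lo := fun r => (1 - t) * C.lo r + t * D.lo r
  hi := fun r => (1 - t) * C.hi r + t * D.hi r
  lt := fun r => by
    have h1 := C.lt r
    have h2 := D.lt r
    have h3 := t.2.2
    have h4 : 0 ≤ (1 - (t : ℝ)) * (C.hi r - C.lo r) := mul_nonneg (by linarith) (by linarith)
    rcases t.2.1.eq_or_lt with h | h
    · rw [← h]; linarith
    · have h5 : 0 < (t : ℝ) * (D.hi r - D.lo r) := mul_pos h (by linarith)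
      linarith

@[simp] theorem interp_zero (C D : Box n) : C.interp D 0 = C := by ext <;> simp

@[simp] theorem interp_one (C D : Box n) : C.interp D 1 = D := by ext <;> simp

theorem interp_subset {C D : Box n} (h : D.carrier ⊆ C.carrier) (t : I) :
    (C.interp D t).inner ⊆ C.inner := by
  have hlo : D.lo ∈ C.carrier := h fun i => ⟨le_rfl, (D.lt i).le⟩
  have hhi : D.hi ∈ C.carrier := h fun i => ⟨(D.lt i).le, le_rfl⟩
  intro s hs r
  obtain ⟨h1, h2⟩ := hs r
  simp only [interp_lo, interp_hi] at h1 h2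
  have h3 := (hlo r).1
  have h4 := (hhi r).2
  have h5 := t.2.1
  have h6 := t.2.2
  constructor <;> nlinarith

theorem continuous_interp_map (C D E : Box n) :
    Continuous fun x : (Fin n → ℝ) × I => (C.interp D x.2).map E x.1 := by
  refine continuous_pi fun r => ?_
  simp only [map, interp_lo, interp_hi]
  refine continuous_const.add (continuous_const.mul (continuous_clamp.comp ?_))
  refine Continuous.div (by fun_prop) (by fun_prop) fun x => ?_
  have := (C.interp D x.2).lt r
  simp only [interp_lo, interp_hi] at this
  linarith

end Box

section Glue

variable {T : Type*} [TopologicalSpace T] {B : Type u} [TopologicalSpace B] {ι : Type*}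

/-- Maps with supports in disjoint open sets can be combined to a continuous map, if they converge
to the base point. -/
theorem exists_glue {b : B} {h : ι → T → B} {O : ι → Set T} (hh : ∀ i, Continuous (h i))
    (hO : ∀ i, IsOpen (O i)) (hd : ∀ i j, i ≠ j → Disjoint (O i) (O j))
    (hsupp : ∀ i x, x ∉ O i → h i x = b) (hfin : ∀ V ∈ 𝓝 b, {i | ∃ x, h i x ∉ V}.Finite) :
    ∃ F : T → B, Continuous F ∧ (∀ i, ∀ x ∈ O i, F x = h i x) ∧
      ∀ x, (∀ i, x ∉ O i) → F x = b := by
  classical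
  let F : T → B := fun x => if hx : ∃ i, x ∈ O i then h hx.choose x else b
  have hF1 : ∀ i, ∀ x ∈ O i, F x = h i x := by
    intro i x hx
    have hex : ∃ i, x ∈ O i := ⟨i, hx⟩
    have heq : hex.choose = i := by
      by_contra hne
      exact Set.disjoint_left.1 (hd _ _ hne) hex.choose_spec hx
    simp only [F, dif_pos hex, heq]
  have hF2 : ∀ x, (∀ i, x ∉ O i) → F x = b := fun x hx => dif_neg (by simpa using hx)
  refine ⟨F, continuous_iff_continuousAt.2 fun x => ?_, hF1, hF2⟩
  by_cases hx : ∃ i, x ∈ O i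
  · obtain ⟨i, hi⟩ := hx
    refine (hh i).continuousAt.congr ?_
    filter_upwards [(hO i).mem_nhds hi] with y hy using (hF1 i y hy).symm
  · push Not at hx
    change Filter.Tendsto F (𝓝 x) (𝓝 (F x))
    rw [hF2 x hx]
    intro V hV
    have h1 : ∀ᶠ y in 𝓝 x, ∀ i ∈ {i | ∃ x, h i x ∉ V}, h i y ∈ V := by
      rw [Filter.eventually_all_finite (hfin V hV)]
      intro i _
      refine (hh i).continuousAt.eventually ?_
      rw [hsupp i x (hx i)]
      exact hV
    refine Filter.mem_map.2 (Filter.mem_of_superset h1 fun y hy => ?_)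
    by_cases hy' : ∃ i, y ∈ O i
    · obtain ⟨i, hi⟩ := hy'
      rw [Set.mem_preimage, hF1 i y hi]
      by_contra hcon
      exact hcon (hy i ⟨y, hcon⟩)
    · push Not at hy'
      rw [Set.mem_preimage, hF2 y hy']
      exact mem_of_mem_nhds hV

variable {n : ℕ}

/-- The map `φ` into a space with base point `b` is supported in the boxes `C i`, which have
disjoint interiors and lie in the unit cube, and it sends their boundaries to `b`. -/
structure BoxSupported (C : ι → Box n) (b : B) (φ : (Fin n → ℝ) → B) : Prop where
  cont : Continuous φ
  disjoint : ∀ i j, i ≠ j → Disjoint (C i).inner (C j).inner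
  bd : ∀ i, ∀ s ∈ (C i).bd, φ s = b
  cover : ∀ s, φ s ≠ b → ∃ i, s ∈ (C i).carrier
  unit : ∀ i, (C i).carrier ⊆ Set.Icc 0 1

variable {C : ι → Box n} {b : B} {φ : (Fin n → ℝ) → B}

theorem BoxSupported.exists_inner (h : BoxSupported C b φ) {s : Fin n → ℝ} (hs : φ s ≠ b) :
    ∃ i, s ∈ (C i).inner := by
  obtain ⟨i, hi⟩ := h.cover s hs
  exact ⟨i, (Box.mem_inner_or_bd hi).resolve_right fun h1 => hs (h.bd i s h1)⟩

/-- The restrictions of `φ` to the boxes converge to the base point. -/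
theorem BoxSupported.finite (h : BoxSupported C b φ) {V : Set B} (hV : V ∈ 𝓝 b) :
    {i | ∃ s ∈ (C i).carrier, φ s ∉ V}.Finite := by
  obtain ⟨W, hWV, hWo, hbW⟩ := mem_nhds_iff.1 hV
  have hne : ∀ s ∈ φ ⁻¹' Wᶜ, φ s ≠ b := fun s hs h1 => hs (by rwa [h1])
  -- The compact set of points with values off `W` is covered by the open boxes.
  have hK : IsCompact (φ ⁻¹' Wᶜ) := by
    refine (isCompact_Icc (a := (0 : Fin n → ℝ)) (b := 1)).of_isClosed_subset
      (hWo.isClosed_compl.preimage h.cont) fun s hs => ?_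
    obtain ⟨i, hi⟩ := h.cover s (hne s hs)
    exact h.unit i hi
  obtain ⟨t, ht⟩ := hK.elim_finite_subcover (fun i => (C i).inner) (fun i => (C i).isOpen_inner)
    fun s hs => Set.mem_iUnion.2 (h.exists_inner (hne s hs))
  refine t.finite_toSet.subset ?_
  rintro i ⟨s, hs, hsV⟩
  have hsW : s ∈ φ ⁻¹' Wᶜ := fun h1 => hsV (hWV h1)
  obtain ⟨j, hj, hsj⟩ := Set.mem_iUnion₂.1 (ht hsW)
  have : i = j := by
    by_contra hne
    exact Box.notMem_inner_of_disjoint (h.disjoint i j hne) hs hsj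
  rwa [this]

/-- The contents of the boxes can be moved along with the boxes, if these stay disjoint. -/
theorem BoxSupported.exists_move (h : BoxSupported C b φ) {D : ι → Box n}
    (hD : ∀ i j, i ≠ j → ∀ t,
      Disjoint ((C i).interp (D i) t).inner ((C j).interp (D j) t).inner) :
    ∃ F : (Fin n → ℝ) × I → B, Continuous F ∧
      (∀ i s t, s ∈ ((C i).interp (D i) t).carrier →
        F (s, t) = φ (((C i).interp (D i) t).map (C i) s)) ∧
      (∀ s t, (∀ i, s ∉ ((C i).interp (D i) t).inner) → F (s, t) = b) ∧ ∀ s, F (s, 0) = φ s := by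
  have hb : ∀ i (x : (Fin n → ℝ) × I), x.1 ∉ ((C i).interp (D i) x.2).inner →
      φ (((C i).interp (D i) x.2).map (C i) x.1) = b := fun i x hx =>
    h.bd i _ (Box.map_mem_bd_iff.2 hx)
  obtain ⟨F, hF, hF1, hF2⟩ := exists_glue (T := (Fin n → ℝ) × I) (b := b)
    (h := fun i x => φ (((C i).interp (D i) x.2).map (C i) x.1))
    (O := fun i => {x | x.1 ∈ ((C i).interp (D i) x.2).inner})
    (fun i => h.cont.comp (Box.continuous_interp_map _ _ _))
    (fun i => by
      have := (C i).isOpen_inner.preimage (Box.continuous_interp_map (C i) (D i) (C i))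
      simpa only [Set.preimage, Box.map_mem_inner_iff] using this)
    (fun i j hij => Set.disjoint_left.2 fun x hx hy => Set.disjoint_left.1 (hD i j hij x.2) hx hy)
    hb (fun V hV => (h.finite hV).subset (by
      rintro i ⟨x, hx⟩
      exact ⟨_, Box.map_mem _ _ _, hx⟩))
  have hF2' : ∀ s t, (∀ i, s ∉ ((C i).interp (D i) t).inner) → F (s, t) = b :=
    fun s t hs => hF2 (s, t) hs
  have hF1' : ∀ i s t, s ∈ ((C i).interp (D i) t).carrier →
      F (s, t) = φ (((C i).interp (D i) t).map (C i) s) := by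
    intro i s t hs
    rcases Box.mem_inner_or_bd hs with h1 | h1
    · exact hF1 i (s, t) h1
    · have h2 : ∀ j, s ∉ ((C j).interp (D j) t).inner := by
        intro j
        by_cases hij : i = j
        · subst hij; exact Box.notMem_inner_of_mem_bd h1
        · exact Box.notMem_inner_of_disjoint (hD i j hij t) hs
      rw [hF2' s t h2]
      exact (hb i (s, t) (h2 i)).symm
  refine ⟨F, hF, hF1', hF2', fun s => ?_⟩
  by_cases hs : ∃ i, s ∈ (C i).inner
  · obtain ⟨i, hi⟩ := hs
    rw [hF1' i s 0 (by rw [Box.interp_zero]; exact Box.inner_subset _ hi), Box.interp_zero,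
      Box.map_self (Box.inner_subset _ hi)]
  · rw [hF2' s 0 (by simpa only [Box.interp_zero, not_exists] using hs)]
    by_contra hne
    exact hs (h.exists_inner (Ne.symm hne))

/-- The content of each box can be shrunk to a smaller box. -/
theorem BoxSupported.exists_shrink (h : BoxSupported C b φ) {D : ι → Box n}
    (hD : ∀ i, (D i).carrier ⊆ (C i).carrier) :
    ∃ F : (Fin n → ℝ) × I → B, Continuous F ∧
      (∀ i, ∀ s ∈ (C i).carrier, ∀ t, F (s, t) = φ (((C i).interp (D i) t).map (C i) s)) ∧
      (∀ s, (∀ i, s ∉ (C i).inner) → ∀ t, F (s, t) = b) ∧ ∀ s, F (s, 0) = φ s := by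
  obtain ⟨F, hF, hF1, hF2, hF0⟩ := h.exists_move (D := D) fun i j hij t =>
    (h.disjoint i j hij).mono (Box.interp_subset (hD i) t) (Box.interp_subset (hD j) t)
  refine ⟨F, hF, fun i s hs t => ?_,
    fun s hs t => hF2 s t fun i hi => hs i (Box.interp_subset (hD i) t hi), hF0⟩
  by_cases hs' : s ∈ ((C i).interp (D i) t).inner
  · exact hF1 i s t (Box.inner_subset _ hs')
  · rw [h.bd i _ (Box.map_mem_bd_iff.2 hs'), hF2 s t fun j hj => ?_]
    by_cases hij : i = j
    · subst hij; exact hs' hj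
    · exact Box.notMem_inner_of_disjoint (h.disjoint i j hij) hs (Box.interp_subset (hD j) t hj)

end Glue

/-! ### Blowing up countably many points of the unit interval -/

/-- There is a map `q` to the unit interval that is constant at `π k` on an interval
`[u k, v k]` of positive length, these intervals having disjoint interiors. -/
theorem exists_plateaus {K : Type*} [Countable K] (π : K → ℝ) (hπ : ∀ k, π k ∈ I) :
    ∃ (u v : K → ℝ) (q : ℝ → ℝ), Continuous q ∧ (∀ x, q x ∈ I) ∧
      (∀ k, 1 / 3 ≤ u k ∧ u k < v k ∧ v k ≤ 2 / 3) ∧ (∀ k, ∀ x ∈ Set.Icc (u k) (v k), q x = π k) ∧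
      ∀ k l, k ≠ l → Disjoint (Set.Ioo (u k) (v k)) (Set.Ioo (u l) (v l)) := by
  classical
  obtain ⟨e, he⟩ := exists_injective_nat K
  let w : K → ℝ := fun k => (1 / 2) ^ e k / 2
  have hw : ∀ k, 0 < w k := fun k => by positivity
  have hgeom : Summable fun m : ℕ => (1 / 2 : ℝ) ^ m / 2 := summable_geometric_two.div_const 2
  have hsum : Summable w := hgeom.comp_injective he
  have hsum1 : ∑' k, w k ≤ 1 := by
    have h1 : ∑' k, w k ≤ ∑' m : ℕ, (1 / 2 : ℝ) ^ m / 2 :=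
      hsum.tsum_le_tsum_of_inj e he (fun _ _ => by positivity) (fun _ => le_rfl) hgeom
    have h2 : ∑' m : ℕ, (1 / 2 : ℝ) ^ m / 2 = 1 := by
      rw [tsum_div_const, tsum_geometric_two, div_self two_ne_zero]
    exact h1.trans h2.le
  -- The order of the intervals: by the position `π`, ties being decided by the enumeration.
  let R : K → K → Prop := fun l k => π l < π k ∨ (π l = π k ∧ e l < e k)
  let ind : K → K → ℝ := fun k l => if R l k then w l else 0
  have hind0 : ∀ k l, 0 ≤ ind k l := fun k l => by
    simp only [ind]; split_ifs; exacts [(hw l).le, le_rfl]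
  have hindw : ∀ k l, ind k l ≤ w l := fun k l => by
    simp only [ind]; split_ifs; exacts [le_rfl, (hw l).le]
  have hinds : ∀ k, Summable (ind k) := fun k =>
    hsum.of_nonneg_of_le (hind0 k) (hindw k)
  have hirr : ∀ k, ¬ R k k := fun k h => by rcases h with h | h <;> simp at h
  have hadd : ∀ k (g : K → ℝ), Summable g → (∀ l, ind k l ≤ g l) → w k ≤ g k →
      ∑' l, ind k l + w k ≤ ∑' l, g l := by
    intro k g hg h1 h2
    have h3 : ∑' l, ind k l + w k = ∑' l, (ind k l + if l = k then w k else 0) := by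
      rw [(hinds k).tsum_add, tsum_ite_eq]
      exact (hasSum_ite_eq k (w k)).summable
    rw [h3]
    refine Summable.tsum_le_tsum (fun l => ?_) ((hinds k).add (hasSum_ite_eq k (w k)).summable) hg
    split_ifs with h
    · subst h
      have : ind l l = 0 := if_neg (hirr l)
      rw [this]; linarith
    · linarith [h1 l]
  -- The interval of `k` starts, up to scale, at `π k` plus the total length of the preceding ones.
  let U : K → ℝ := fun k => π k + ∑' l, ind k l
  have hU0 : ∀ k, 0 ≤ U k := fun k => add_nonneg (hπ k).1 (tsum_nonneg (hind0 k))
  have hU2 : ∀ k, U k + w k ≤ 2 := fun k => by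
    have := hadd k w hsum (hindw k) le_rfl
    have := (hπ k).2
    simp only [U]; linarith
  have htrans : ∀ {i l k}, R i l → R l k → R i k := by
    rintro i l k (h1 | h1) (h2 | h2)
    · exact Or.inl (h1.trans h2)
    · exact Or.inl (h2.1 ▸ h1)
    · exact Or.inl (h1.1 ▸ h2)
    · exact Or.inr ⟨h1.1.trans h2.1, h1.2.trans h2.2⟩
  have hUlt : ∀ l k, R l k → U l + w l + (π k - π l) ≤ U k := by
    intro l k hlk
    have := hadd l (ind k) (hinds k) (fun i => by
      by_cases hi : R i l
      · simp only [ind, if_pos hi, if_pos (htrans hi hlk), le_rfl]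
      · simp only [ind, if_neg hi]; exact hind0 k i) (by simp only [ind, if_pos hlk, le_rfl])
    simp only [U]; linarith
  have htri : ∀ k l, k ≠ l → R k l ∨ R l k := by
    intro k l hkl
    rcases lt_trichotomy (π k) (π l) with h | h | h
    · exact Or.inl (Or.inl h)
    · rcases lt_trichotomy (e k) (e l) with h' | h' | h'
      · exact Or.inl (Or.inr ⟨h, h'⟩)
      · exact absurd (he h') hkl
      · exact Or.inr (Or.inr ⟨h.symm, h'⟩)
    · exact Or.inr (Or.inl h)
  have hRπ : ∀ l k, R l k → π l ≤ π k := fun l k h => h.elim le_of_lt fun h => h.1.le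
  let u : K → ℝ := fun k => 1 / 3 + U k / 6
  let v : K → ℝ := fun k => 1 / 3 + (U k + w k) / 6
  have hsep : ∀ l k, R l k → ∀ x ∈ Set.Icc (u l) (v l), ∀ y ∈ Set.Icc (u k) (v k),
      π k - π l ≤ 6 * (y - x) := by
    intro l k h x hx y hy
    have h1 := hUlt l k h
    have h2 := hx.2
    have h3 := hy.1
    simp only [u, v] at h2 h3
    linarith
  -- The required map is Lipschitz on the union of the intervals, so that it extends to the line.
  let g₀ : ℝ → ℝ := fun x => if h : ∃ k, x ∈ Set.Icc (u k) (v k) then π h.choose else 0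
  have hdist : ∀ k l, ∀ x ∈ Set.Icc (u k) (v k), ∀ y ∈ Set.Icc (u l) (v l),
      |π k - π l| ≤ 6 * |x - y| := by
    intro k l x hx y hy
    by_cases hkl : k = l
    · subst hkl; simp
    · rcases htri k l hkl with h | h
      · have h1 := hsep k l h x hx y hy
        have h2 := hRπ k l h
        rw [abs_sub_comm, abs_of_nonneg (by linarith), abs_sub_comm]
        exact h1.trans (by gcongr; exact le_abs_self _)
      · have h1 := hsep l k h y hy x hx
        have h2 := hRπ l k h
        rw [abs_of_nonneg (by linarith)]
        exact h1.trans (by gcongr; exact le_abs_self _)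
  have hg₀ : ∀ k, ∀ x ∈ Set.Icc (u k) (v k), g₀ x = π k := by
    intro k x hx
    have hex : ∃ k, x ∈ Set.Icc (u k) (v k) := ⟨k, hx⟩
    have h1 := hdist _ k x hex.choose_spec x hx
    rw [sub_self, abs_zero, mul_zero] at h1
    simp only [g₀, dif_pos hex]
    exact sub_eq_zero.1 (abs_eq_zero.1 (le_antisymm h1 (abs_nonneg _)))
  have hlip : LipschitzOnWith 6 g₀ {x | ∃ k, x ∈ Set.Icc (u k) (v k)} := by
    refine LipschitzOnWith.of_dist_le_mul ?_
    rintro x ⟨k, hx⟩ y ⟨l, hy⟩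
    rw [hg₀ k x hx, hg₀ l y hy, Real.dist_eq, Real.dist_eq]
    exact hdist k l x hx y hy
  obtain ⟨g, hg, hgeq⟩ := hlip.extend_real
  refine ⟨u, v, fun x => clamp (g x), continuous_clamp.comp hg.continuous,
    fun x => ⟨clamp_nonneg _, clamp_le_one _⟩, fun k => ⟨?_, ?_, ?_⟩, fun k x hx => ?_, ?_⟩
  · have := hU0 k; simp only [u]; linarith
  · have := hw k; simp only [u, v]; linarith
  · have := hU2 k; simp only [v]; linarith
  · have : g x = π k := by rw [← hgeq ⟨k, hx⟩, hg₀ k x hx]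
    simp only [this]
    exact clamp_of_mem (hπ k).1 (hπ k).2
  · intro k l hkl
    rw [Set.disjoint_left]
    rintro x ⟨hx1, hx2⟩ ⟨hx3, hx4⟩
    simp only [u, v] at hx1 hx2 hx3 hx4
    rcases htri k l hkl with h | h
    · have h1 := hUlt k l h
      have h2 := hRπ k l h
      linarith
    · have h1 := hUlt l k h
      have h2 := hRπ l k h
      linarith

/-! ### Spaces that consist of an arc and of spaces attached to it -/

open Filter in
/-- A space `Z` that consists of an arc and of subspaces that meet the arc in one point each, with
the topology of a shrinking adjunction space. The `k`-th subspace is the set of fixed points of the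
retraction `proj k`, which maps everything else to the point `arc (base k)`. -/
structure ArcDecomposition (Z : Type u) [TopologicalSpace Z] (K : Type w) where
  /-- the position on the arc of the attachment points -/
  base : K → ℝ
  /-- the arc, parametrized by `[0, 1]` and extended to the line by constant maps -/
  arc : ℝ → Z
  /-- the retraction to the arc -/
  pos : Z → ℝ
  /-- the retractions to the attached spaces -/
  proj : K → Z → Z
  continuous_pos : Continuous pos
  continuous_proj : ∀ k, Continuous (proj k)
  base_mem : ∀ k, base k ∈ I
  pos_mem : ∀ z, pos z ∈ I
  pos_arc : ∀ p ∈ I, pos (arc p) = p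
  proj_arc : ∀ k p, proj k (arc p) = arc (base k)
  proj_proj : ∀ k z, proj k (proj k z) = proj k z
  proj_proj_of_ne : ∀ k l z, l ≠ k → proj l (proj k z) = arc (base l)
  pos_proj : ∀ k z, pos (proj k z) = base k
  eq_or_eq : ∀ z, z = arc (pos z) ∨ ∃ k, proj k z = z
  /-- the topology is the one induced by the retractions -/
  le_nhds : ∀ (z : Z) (l : Filter Z), Tendsto pos l (𝓝 (pos z)) →
    (∀ k, Tendsto (proj k) l (𝓝 (proj k z))) → l ≤ 𝓝 z

namespace ArcDecomposition

variable {Z : Type u} [TopologicalSpace Z] {K : Type w} (D : ArcDecomposition Z K)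

/-- The point at which the `k`-th space is attached. -/
def pt (k : K) : Z := D.arc (D.base k)

theorem proj_pt (k l : K) : D.proj k (D.pt l) = D.pt k := D.proj_arc k _

variable {D}

theorem eq_proj {k : K} {z : Z} (h : D.proj k z ≠ D.pt k) : D.proj k z = z := by
  rcases D.eq_or_eq z with h1 | ⟨l, h1⟩
  · exact absurd (by rw [h1]; exact D.proj_arc k _) h
  · by_cases hkl : k = l
    · rw [hkl, h1]
    · exact absurd (by rw [← h1]; exact D.proj_proj_of_ne l k z hkl) h

theorem pos_of_proj_eq {k : K} {z : Z} (h : D.proj k z = z) : D.pos z = D.base k := by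
  rw [← h, D.pos_proj]

theorem proj_of_proj_eq {k l : K} {z : Z} (h : D.proj k z = z) (hl : l ≠ k) :
    D.proj l z = D.pt l := by
  rw [← h, D.proj_proj_of_ne k l z hl]; rfl

variable (D)

/-- The condition for a point `p` of the arc and points `z k` of the attached spaces to be the
coordinates of a point. -/
structure Valid (p : ℝ) (z : K → Z) : Prop where
  mem : p ∈ I
  proj : ∀ k, D.proj k (z k) = z k
  base : ∀ k, z k ≠ D.pt k → p = D.base k
  eq_pt : ∀ k, z k ≠ D.pt k → ∀ l, l ≠ k → z l = D.pt l

open Classical in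
/-- The point with coordinates `p` and `z k`, provided that these are valid. -/
noncomputable def glue (p : ℝ) (z : K → Z) : Z :=
  if h : ∃ k, z k ≠ D.pt k then z h.choose else D.arc p

variable {D}

theorem Valid.pos_glue {p : ℝ} {z : K → Z} (h : D.Valid p z) : D.pos (D.glue p z) = p := by
  unfold glue
  split_ifs with h1
  · rw [pos_of_proj_eq (h.proj _), h.base _ h1.choose_spec]
  · exact D.pos_arc p h.mem

theorem Valid.proj_glue {p : ℝ} {z : K → Z} (h : D.Valid p z) (k : K) :
    D.proj k (D.glue p z) = z k := by
  unfold glue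
  split_ifs with h1
  · by_cases hk : k = h1.choose
    · rw [hk, h.proj]
    · rw [proj_of_proj_eq (h.proj _) hk, h.eq_pt _ h1.choose_spec k hk]
  · push Not at h1
    rw [D.proj_arc, h1]; rfl

theorem Valid.glue_eq {p : ℝ} {z : K → Z} (h : D.Valid p z) {k : K} (hk : z k ≠ D.pt k) :
    D.glue p z = z k := by
  have h1 := h.proj_glue k
  rw [← h1]
  exact (eq_proj (by rwa [h1])).symm

theorem glue_of_forall {p : ℝ} {z : K → Z} (h : ∀ k, z k = D.pt k) : D.glue p z = D.arc p :=
  dif_neg (by simpa using h)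

theorem valid_coord (z : Z) : D.Valid (D.pos z) fun k => D.proj k z where
  mem := D.pos_mem z
  proj := fun k => D.proj_proj k z
  base := fun _ hk => pos_of_proj_eq (eq_proj hk)
  eq_pt := fun _ hk _ hl => proj_of_proj_eq (eq_proj hk) hl

theorem glue_coord (z : Z) : D.glue (D.pos z) (fun k => D.proj k z) = z := by
  by_cases h : ∃ k, D.proj k z ≠ D.pt k
  · obtain ⟨k, hk⟩ := h
    rw [(valid_coord z).glue_eq hk, eq_proj hk]
  · push Not at h
    rw [glue_of_forall h]
    rcases D.eq_or_eq z with h1 | ⟨k, h1⟩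
    · exact h1.symm
    · rw [pos_of_proj_eq h1, ← h1, h k]; rfl

theorem glue_mem {W : Set Z} (hW : ∀ p, D.arc p ∈ W) {p : ℝ} {z : K → Z}
    (hz : ∀ k, z k ≠ D.pt k → z k ∈ W) : D.glue p z ∈ W := by
  unfold glue
  split_ifs with h1
  · exact hz _ h1.choose_spec
  · exact hW p

theorem continuous_glue {T : Type*} [TopologicalSpace T] {p : T → ℝ} {z : K → T → Z}
    (h : ∀ s, D.Valid (p s) fun k => z k s) (hp : Continuous p) (hz : ∀ k, Continuous (z k)) :
    Continuous fun s => D.glue (p s) fun k => z k s := by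
  refine continuous_iff_continuousAt.2 fun s => ?_
  refine D.le_nhds _ _ (Filter.tendsto_map'_iff.2 ?_) fun k => Filter.tendsto_map'_iff.2 ?_
  · simp only [Function.comp_def, (h _).pos_glue]
    exact hp.continuousAt
  · simp only [Function.comp_def, (h _).proj_glue]
    exact (hz k).continuousAt

end ArcDecomposition

/-! ### The tree of dyadic boxes -/

section Tree

variable {n : ℕ} [NeZero n]

/-- The direction in which the boxes of depth `d` are halved; the directions take turns. -/
def splitAxis (n : ℕ) [NeZero n] (d : ℕ) : Fin n := ⟨d % n, Nat.mod_lt _ (NeZero.pos n)⟩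

/-- The number of halvings in direction `r` that lead to the boxes of depth `d`. -/
def treeScale (n d : ℕ) (r : Fin n) : ℕ := (d + (n - 1 - r)) / n

theorem treeScale_zero (r : Fin n) : treeScale n 0 r = 0 :=
  Nat.div_eq_of_lt (by have := r.2; omega)

theorem treeScale_mul (m : ℕ) (r : Fin n) : treeScale n (n * m) r = m := by
  rw [treeScale, Nat.mul_add_div (NeZero.pos n), Nat.div_eq_of_lt (by have := r.2; omega), add_zero]

theorem treeScale_succ (d : ℕ) (r : Fin n) :
    treeScale n (d + 1) r = treeScale n d r + if r = splitAxis n d then 1 else 0 := by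
  unfold treeScale
  rw [show d + 1 + (n - 1 - (r : ℕ)) = d + (n - 1 - r) + 1 by omega, Nat.succ_div]
  congr 1
  have hr := r.2
  have hiff : n ∣ d + (n - 1 - r) + 1 ↔ r = splitAxis n d := by
    rw [show d + (n - 1 - (r : ℕ)) + 1 = d + (n - r) by omega]
    have h1 : n * (d / n) + d % n = d := Nat.div_add_mod d n
    have h2 : d % n < n := Nat.mod_lt _ (NeZero.pos n)
    have h3 : d + (n - (r : ℕ)) = n * (d / n) + (d % n + (n - r)) := by omega
    rw [h3, Nat.dvd_add_right (dvd_mul_right _ _), splitAxis, Fin.ext_iff]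
    constructor
    · rintro ⟨c, hc⟩
      have hc1 : c = 1 := by
        have hc0 : c ≠ 0 := by rintro rfl; omega
        have hc2 : c < 2 := by
          by_contra hcon
          have : n * 2 ≤ n * c := Nat.mul_le_mul_left n (by omega)
          omega
        omega
      subst hc1
      change (r : ℕ) = d % n
      omega
    · intro h
      refine ⟨1, ?_⟩
      change (r : ℕ) = d % n at h
      omega
  simp only [hiff]

theorem treeScale_mono {d d' : ℕ} (h : d ≤ d') (r : Fin n) : treeScale n d r ≤ treeScale n d' r :=
  Nat.div_le_div_right (by omega)

/-- The `j`-th box of depth `d`. Its side lengths are `2 ^ (-treeScale n d r)`. -/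
@[simps] noncomputable def treeBox (d : ℕ) (j : Fin n → ℤ) : Box n where
  lo := fun r => j r / 2 ^ treeScale n d r
  hi := fun r => (j r + 1) / 2 ^ treeScale n d r
  lt := fun r => by
    have : (0 : ℝ) < 2 ^ treeScale n d r := by positivity
    exact div_lt_div_of_pos_right (by linarith) this

/-- The coordinates in `[0, 1]^n` of the points of a box of the tree. -/
noncomputable def normalize (d : ℕ) (j : Fin n → ℤ) (s : Fin n → ℝ) : Fin n → ℝ :=
  fun r => 2 ^ treeScale n d r * s r - j r

/-- The point of a box of the tree with the given coordinates in `[0, 1]^n`. -/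
noncomputable def embed (d : ℕ) (j : Fin n → ℤ) (x : Fin n → ℝ) : Fin n → ℝ :=
  fun r => (j r + x r) / 2 ^ treeScale n d r

theorem normalize_embed (d : ℕ) (j : Fin n → ℤ) (x : Fin n → ℝ) :
    normalize d j (embed d j x) = x := by
  funext r
  have : (2 : ℝ) ^ treeScale n d r ≠ 0 := by positivity
  rw [normalize, embed, mul_div_cancel₀ _ this, add_sub_cancel_left]

theorem mem_treeBox {d : ℕ} {j : Fin n → ℤ} {s : Fin n → ℝ} : s ∈ (treeBox d j).carrier ↔
    ∀ r, 0 ≤ normalize d j s r ∧ normalize d j s r ≤ 1 := by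
  refine forall_congr' fun r => ?_
  have h : (0 : ℝ) < 2 ^ treeScale n d r := by positivity
  rw [treeBox_lo, treeBox_hi, div_le_iff₀ h, le_div_iff₀ h, normalize]
  constructor <;> rintro ⟨h1, h2⟩ <;> constructor <;> linarith

theorem mem_inner_treeBox {d : ℕ} {j : Fin n → ℤ} {s : Fin n → ℝ} : s ∈ (treeBox d j).inner ↔
    ∀ r, 0 < normalize d j s r ∧ normalize d j s r < 1 := by
  refine forall_congr' fun r => ?_
  have h : (0 : ℝ) < 2 ^ treeScale n d r := by positivity
  rw [treeBox_lo, treeBox_hi, div_lt_iff₀ h, lt_div_iff₀ h, normalize]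
  constructor <;> rintro ⟨h1, h2⟩ <;> constructor <;> linarith

theorem continuous_normalize (d : ℕ) (j : Fin n → ℤ) : Continuous (normalize d j) := by
  unfold normalize; fun_prop

theorem continuous_embed (d : ℕ) (j : Fin n → ℤ) : Continuous (embed d j) := by
  unfold embed; fun_prop

/-- Boxes of the tree are nested or have disjoint interiors. -/
theorem treeBox_subset {d d' : ℕ} (hd : d ≤ d') {j j' : Fin n → ℤ}
    (h : ((treeBox d j).inner ∩ (treeBox d' j').inner).Nonempty) :
    (treeBox d' j').carrier ⊆ (treeBox d j).carrier := by
  obtain ⟨x, hx, hx'⟩ := h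
  rw [mem_inner_treeBox] at hx hx'
  intro s hs
  rw [mem_treeBox] at hs ⊢
  intro r
  obtain ⟨e, he⟩ := Nat.exists_eq_add_of_le (treeScale_mono hd r)
  have h1 := hx r
  have h2 := hx' r
  have h3 := hs r
  simp only [normalize, he, pow_add] at h1 h2 h3 ⊢
  have he' : (0 : ℝ) < 2 ^ e := by positivity
  have h4 : j r * 2 ^ e < j' r + 1 := by
    have : (j r : ℝ) * 2 ^ e < j' r + 1 := by nlinarith
    exact_mod_cast this
  have h5 : j' r < (j r + 1) * 2 ^ e := by
    have : (j' r : ℝ) < (j r + 1) * 2 ^ e := by nlinarith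
    exact_mod_cast this
  have h6 : (j r : ℝ) * 2 ^ e ≤ j' r := by
    have : j r * 2 ^ e ≤ j' r := by omega
    exact_mod_cast this
  have h7 : (j' r : ℝ) + 1 ≤ (j r + 1) * 2 ^ e := by
    have : j' r + 1 ≤ (j r + 1) * 2 ^ e := by omega
    exact_mod_cast this
  constructor
  · refine sub_nonneg.2 (le_of_mul_le_mul_right ?_ he')
    linarith
  · refine sub_le_iff_le_add'.2 (le_of_mul_le_mul_right ?_ he')
    linarith

theorem treeBox_index_eq {d : ℕ} {j j' : Fin n → ℤ}
    (h : ((treeBox d j).inner ∩ (treeBox d j').inner).Nonempty) : j = j' := by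
  obtain ⟨x, hx, hx'⟩ := h
  rw [mem_inner_treeBox] at hx hx'
  funext r
  have h1 := hx r
  have h2 := hx' r
  simp only [normalize] at h1 h2
  have h3 : j r < j' r + 1 := by
    have : (j r : ℝ) < j' r + 1 := by linarith
    exact_mod_cast this
  have h4 : j' r < j r + 1 := by
    have : (j' r : ℝ) < j r + 1 := by linarith
    exact_mod_cast this
  omega

theorem Box.inner_subset_inner {n : ℕ} {C D : Box n} (h : D.carrier ⊆ C.carrier) :
    D.inner ⊆ C.inner := by
  have := Box.interp_subset h 1
  rwa [Box.interp_one] at this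

theorem Box.inner_nonempty {n : ℕ} (C : Box n) : C.inner.Nonempty :=
  ⟨fun i => (C.lo i + C.hi i) / 2, fun i => by have := C.lt i; constructor <;> linarith⟩

/-- The index of a box of depth `d` that contains `s`. -/
noncomputable def treeIndex (d : ℕ) (s : Fin n → ℝ) : Fin n → ℤ :=
  fun r => ⌊2 ^ treeScale n d r * s r⌋

theorem mem_treeIndex (d : ℕ) (s : Fin n → ℝ) : s ∈ (treeBox d (treeIndex d s)).carrier := by
  rw [mem_treeBox]
  intro r
  have h1 := Int.floor_le (2 ^ treeScale n d r * s r)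
  have h2 := Int.lt_floor_add_one (2 ^ treeScale n d r * s r)
  simp only [normalize, treeIndex]
  constructor <;> linarith

theorem treeIndex_succ_of_ne {d : ℕ} {r : Fin n} (hr : r ≠ splitAxis n d) (s : Fin n → ℝ) :
    treeScale n (d + 1) r = treeScale n d r ∧ treeIndex (d + 1) s r = treeIndex d s r := by
  have h : treeScale n (d + 1) r = treeScale n d r := by rw [treeScale_succ, if_neg hr, add_zero]
  exact ⟨h, by rw [treeIndex, treeIndex, h]⟩

theorem treeIndex_succ (d : ℕ) (s : Fin n → ℝ) :
    treeScale n (d + 1) (splitAxis n d) = treeScale n d (splitAxis n d) + 1 ∧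
    (treeIndex (d + 1) s (splitAxis n d) = 2 * treeIndex d s (splitAxis n d) ∧
      2 * normalize d (treeIndex d s) s (splitAxis n d) < 1 ∨
    treeIndex (d + 1) s (splitAxis n d) = 2 * treeIndex d s (splitAxis n d) + 1 ∧
      1 ≤ 2 * normalize d (treeIndex d s) s (splitAxis n d)) := by
  have h : treeScale n (d + 1) (splitAxis n d) = treeScale n d (splitAxis n d) + 1 := by
    rw [treeScale_succ, if_pos rfl]
  refine ⟨h, ?_⟩
  simp only [treeIndex, normalize, h, pow_succ]
  set y := (2 : ℝ) ^ treeScale n d (splitAxis n d) * s (splitAxis n d) with hy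
  rw [show (2 : ℝ) ^ treeScale n d (splitAxis n d) * 2 * s (splitAxis n d) = 2 * y by rw [hy]; ring]
  have h1 := Int.floor_le y
  have h2 := Int.lt_floor_add_one y
  rcases lt_or_ge (2 * (y - ⌊y⌋)) 1 with h3 | h3
  · left
    refine ⟨Int.floor_eq_iff.2 ⟨?_, ?_⟩, h3⟩ <;> push_cast <;> linarith
  · right
    refine ⟨Int.floor_eq_iff.2 ⟨?_, ?_⟩, h3⟩ <;> push_cast <;> linarith

theorem treeBox_succ_subset (d : ℕ) (s : Fin n → ℝ) :
    (treeBox (d + 1) (treeIndex (d + 1) s)).carrier ⊆ (treeBox d (treeIndex d s)).carrier := by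
  intro s' hs'
  rw [mem_treeBox] at hs' ⊢
  intro r
  by_cases hr : r = splitAxis n d
  · subst hr
    have h0 := hs' (splitAxis n d)
    obtain ⟨h1, ⟨h2, -⟩ | ⟨h2, -⟩⟩ := treeIndex_succ d s <;>
    · simp only [normalize, h1, h2, pow_succ] at h0 ⊢
      push_cast at h0
      constructor <;> linarith
  · obtain ⟨h1, h2⟩ := treeIndex_succ_of_ne hr s
    have h0 := hs' r
    simpa only [normalize, h1, h2] using h0

theorem locallyFinite_treeBox (d : ℕ) :
    LocallyFinite fun j : Fin n → ℤ => (treeBox d j).carrier := by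
  intro s
  let O : Set (Fin n → ℝ) :=
    ⋂ r, (fun s' : Fin n → ℝ => 2 ^ treeScale n d r * s' r) ⁻¹'
      Set.Ioo (2 ^ treeScale n d r * s r - 1) (2 ^ treeScale n d r * s r + 1)
  have hO : IsOpen O := isOpen_iInter_of_finite fun r =>
    isOpen_Ioo.preimage (by fun_prop)
  refine ⟨O, hO.mem_nhds (Set.mem_iInter.2 fun r => ⟨by linarith, by linarith⟩), ?_⟩
  refine (Set.finite_Icc (fun r => treeIndex d s r - 2) (fun r => treeIndex d s r + 2)).subset ?_
  rintro j ⟨s', hs', hO'⟩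
  rw [mem_treeBox] at hs'
  have key : ∀ r, treeIndex d s r - 2 ≤ j r ∧ j r ≤ treeIndex d s r + 2 := by
    intro r
    have h1 := hs' r
    obtain ⟨h2, h3⟩ := Set.mem_iInter.1 hO' r
    have h4 := Int.floor_le (2 ^ treeScale n d r * s r)
    have h5 := Int.lt_floor_add_one (2 ^ treeScale n d r * s r)
    simp only [normalize] at h1
    constructor
    · have : (treeIndex d s r : ℝ) - 2 ≤ j r := by simp only [treeIndex]; linarith
      exact_mod_cast this
    · have : (j r : ℝ) ≤ treeIndex d s r + 2 := by simp only [treeIndex]; linarith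
      exact_mod_cast this
  exact ⟨fun r => (key r).1, fun r => (key r).2⟩

/-- Maps on the boxes of depth `d` that agree on the intersections combine to a continuous map. -/
theorem continuous_treeGlue {B : Type*} [TopologicalSpace B] {T : Type*} [TopologicalSpace T]
    (d : ℕ) {G : (Fin n → ℤ) → (Fin n → ℝ) × T → B} (hG : ∀ j, Continuous (G j))
    (hag : ∀ j j' s t, s ∈ (treeBox d j).carrier → s ∈ (treeBox d j').carrier →
      G j (s, t) = G j' (s, t)) :
    Continuous fun x : (Fin n → ℝ) × T => G (treeIndex d x.1) x := by
  have hlf : LocallyFinite fun j : Fin n → ℤ => (treeBox d j).carrier ×ˢ (Set.univ : Set T) := by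
    have := (locallyFinite_treeBox (n := n) d).preimage_continuous
      (continuous_fst (X := Fin n → ℝ) (Y := T))
    simpa only [Set.prod_univ] using this
  refine hlf.continuous ?_ (fun j => (Box.isClosed_carrier _).prod isClosed_univ) fun j => ?_
  · exact Set.eq_univ_of_forall fun x => Set.mem_iUnion.2
      ⟨treeIndex d x.1, mem_treeIndex d x.1, trivial⟩
  · refine (hG j).continuousOn.congr ?_
    rintro ⟨s, t⟩ ⟨hs, -⟩
    exact hag _ _ s t (mem_treeIndex d s) hs

theorem notMem_inner_of_mem_of_ne {d : ℕ} {j j' : Fin n → ℤ} (hne : j ≠ j') {s : Fin n → ℝ}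
    (hs' : s ∈ (treeBox d j').carrier) : s ∉ (treeBox d j).inner := fun hs => by
  have := Box.inter_inner_nonempty (treeBox d j).isOpen_inner hs' hs
  exact hne (treeBox_index_eq this)

end Tree

/-! ### Infinite concatenation of homotopies -/

open Filter in
/-- Infinitely many homotopies `H d`, from `H (d + 1) (·, 1)` to `H d (·, 1)`, that converge to `g`
can be concatenated to a homotopy from `g` to `H 0 (·, 1)`. -/
theorem exists_infinite_concatenation {T : Type*} [TopologicalSpace T] {Z : Type u}
    [TopologicalSpace Z] {H : ℕ → T × I → Z} (hH : ∀ d, Continuous (H d))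
    (hstep : ∀ d s, H d (s, 0) = H (d + 1) (s, 1)) {g : T → Z} (hg : Continuous g)
    (hlim : ∀ s, ∀ V ∈ 𝓝 (g s), ∃ N ∈ 𝓝 s, ∃ d₀, ∀ d ≥ d₀, ∀ s' ∈ N, ∀ t, H d (s', t) ∈ V) :
    ∃ F : T × I → Z, Continuous F ∧ (∀ s, F (s, 0) = g s) ∧ (∀ s, F (s, 1) = H 0 (s, 1)) ∧
      ∀ s t, F (s, t) = g s ∨ ∃ d t', F (s, t) = H d (s, t') := by
  classical
  -- The homotopy `H d` is run through on the interval `[2 ^ (-d-1), 2 ^ (-d)]`.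
  let τ : ℕ → ℝ → I := fun d t => Set.projIcc 0 1 zero_le_one (2 ^ (d + 1) * t - 1)
  have hτ : ∀ d, Continuous (τ d) := fun d => continuous_projIcc.comp (by fun_prop)
  have hτ0 : ∀ d, τ d ((1 / 2) ^ (d + 1)) = 0 := fun d => by
    refine Set.projIcc_of_le_left _ ?_
    rw [← mul_pow]; norm_num
  have hτ1 : ∀ d, τ d ((1 / 2) ^ d) = 1 := fun d => by
    refine Set.projIcc_of_right_le _ ?_
    rw [pow_succ, mul_right_comm, ← mul_pow]; norm_num
  -- The index of the interval that contains `t`.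
  let δ : ℝ → ℕ := fun t => sInf {d | (1 / 2 : ℝ) ^ (d + 1) < t}
  have hδ : ∀ t : ℝ, 0 < t → t ≤ 1 → (1 / 2 : ℝ) ^ (δ t + 1) < t ∧ t ≤ (1 / 2) ^ δ t := by
    intro t ht ht1
    have hne : {d | (1 / 2 : ℝ) ^ (d + 1) < t}.Nonempty := by
      obtain ⟨d, hd⟩ := exists_pow_lt_of_lt_one ht (show (1 / 2 : ℝ) < 1 by norm_num)
      exact ⟨d, (pow_le_pow_of_le_one (by norm_num) (by norm_num) (Nat.le_succ d)).trans_lt hd⟩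
    refine ⟨Nat.sInf_mem hne, ?_⟩
    rcases Nat.eq_zero_or_pos (δ t) with h | h
    · rw [h, pow_zero]; exact ht1
    · by_contra hcon
      push Not at hcon
      obtain ⟨m, hm⟩ : ∃ m, δ t = m + 1 := ⟨δ t - 1, by omega⟩
      rw [hm] at hcon
      have : δ t ≤ m := Nat.sInf_le (s := {d | (1 / 2 : ℝ) ^ (d + 1) < t}) hcon
      omega
  let F : T × I → Z := fun x => if (x.2 : ℝ) = 0 then g x.1 else H (δ x.2) (x.1, τ (δ x.2) x.2)
  have hFd : ∀ d s (t : I), (1 / 2 : ℝ) ^ (d + 1) ≤ t → (t : ℝ) ≤ (1 / 2) ^ d →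
      F (s, t) = H d (s, τ d t) := by
    intro d s t h1 h2
    have hpos : (0 : ℝ) < t := lt_of_lt_of_le (by positivity) h1
    obtain ⟨h3, h4⟩ := hδ t hpos t.2.2
    have hF : F (s, t) = H (δ t) (s, τ (δ t) t) := if_neg hpos.ne'
    have hle : δ t ≤ d + 1 := by
      by_contra hcon
      have : (1 / 2 : ℝ) ^ δ t < (1 / 2) ^ (d + 1) :=
        pow_lt_pow_right_of_lt_one₀ (by norm_num) (by norm_num) (by omega)
      linarith
    have hge : d ≤ δ t := by
      by_contra hcon
      have : (1 / 2 : ℝ) ^ d ≤ (1 / 2) ^ (δ t + 1) :=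
        pow_le_pow_of_le_one (by norm_num) (by norm_num) (by omega)
      linarith
    rcases (show δ t = d ∨ δ t = d + 1 by omega) with h | h
    · rw [hF, h]
    · rw [h] at h4
      have ht : (t : ℝ) = (1 / 2) ^ (d + 1) := le_antisymm h4 h1
      rw [hF, h, ht, hτ1, hτ0, hstep]
  refine ⟨F, continuous_iff_continuousAt.2 ?_, fun s => if_pos rfl, fun s => ?_, fun s t => ?_⟩
  · rintro ⟨s, t⟩
    by_cases ht : (t : ℝ) = 0
    · change Tendsto F (𝓝 (s, t)) (𝓝 (F (s, t)))
      have hF : F (s, t) = g s := if_pos ht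
      rw [hF]
      intro V hV
      obtain ⟨N, hN, d₀, hd₀⟩ := hlim s V hV
      have h1 : ∀ᶠ x : T × I in 𝓝 (s, t), (x.2 : ℝ) < (1 / 2) ^ d₀ := by
        refine (isOpen_lt (by fun_prop) continuous_const).mem_nhds ?_
        change (t : ℝ) < _
        rw [ht]; positivity
      have h2 : ∀ᶠ x : T × I in 𝓝 (s, t), x.1 ∈ N ∧ g x.1 ∈ V :=
        (continuous_fst.tendsto (s, t)).eventually
          ((show ∀ᶠ x in 𝓝 s, x ∈ N from hN).and
            (show ∀ᶠ x in 𝓝 s, g x ∈ V from hg.continuousAt hV))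
      refine mem_map.2 (mem_of_superset (h1.and h2) ?_)
      rintro ⟨s', t'⟩ ⟨h3, h4, h5⟩
      change F (s', t') ∈ V
      by_cases ht' : (t' : ℝ) = 0
      · have hF : F (s', t') = g s' := if_pos ht'
        rwa [hF]
      · have hF : F (s', t') = H (δ t') (s', τ (δ t') t') := if_neg ht'
        rw [hF]
        refine hd₀ _ ?_ _ h4 _
        by_contra hcon
        have h6 := (hδ t' (lt_of_le_of_ne t'.2.1 (Ne.symm ht')) t'.2.2).1
        have h7 : (1 / 2 : ℝ) ^ d₀ ≤ (1 / 2) ^ (δ t' + 1) :=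
          pow_le_pow_of_le_one (by norm_num) (by norm_num) (by omega)
        have h3' : (t' : ℝ) < (1 / 2) ^ d₀ := h3
        linarith
    · have hpos : (0 : ℝ) < t := lt_of_le_of_ne t.2.1 (Ne.symm ht)
      obtain ⟨d₁, hd₁⟩ := exists_pow_lt_of_lt_one hpos (show (1 / 2 : ℝ) < 1 by norm_num)
      have hc : Continuous fun x : T × I => (x.2 : ℝ) := by fun_prop
      have h1 : ContinuousOn F (⋃ d : Fin d₁, {x : T × I |
          (1 / 2 : ℝ) ^ ((d : ℕ) + 1) ≤ x.2 ∧ (x.2 : ℝ) ≤ (1 / 2) ^ (d : ℕ)}) := by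
        refine (locallyFinite_of_finite _).continuousOn_iUnion (fun d => ?_) fun d => ?_
        · exact (isClosed_le continuous_const hc).inter (isClosed_le hc continuous_const)
        · refine ContinuousOn.congr (f := fun x : T × I => H d (x.1, τ d x.2)) ?_ ?_
          · exact ((hH d).comp (continuous_fst.prodMk ((hτ d).comp (by fun_prop)))).continuousOn
          · rintro ⟨s', t'⟩ ⟨h2, h3⟩
            exact hFd d s' t' h2 h3
      refine h1.continuousAt ?_
      have h2 : ∀ᶠ x : T × I in 𝓝 (s, t), (1 / 2 : ℝ) ^ d₁ < x.2 :=
        hc.continuousAt.eventually_const_lt hd₁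
      filter_upwards [h2] with x hx
      have hpos' : (0 : ℝ) < x.2 := lt_of_le_of_lt (by positivity) hx
      obtain ⟨h3, h4⟩ := hδ x.2 hpos' x.2.2.2
      refine Set.mem_iUnion.2 ⟨⟨δ x.2, ?_⟩, h3.le, h4⟩
      by_contra hcon
      have : (1 / 2 : ℝ) ^ δ x.2 ≤ (1 / 2) ^ d₁ :=
        pow_le_pow_of_le_one (by norm_num) (by norm_num) (by omega)
      linarith
  · rw [hFd 0 s 1 (by norm_num) (by norm_num)]
    have := hτ1 0
    rw [pow_zero] at this
    rw [Set.Icc.coe_one, this]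
  · by_cases ht : (t : ℝ) = 0
    · exact Or.inl (if_pos ht)
    · exact Or.inr ⟨_, _, if_neg ht⟩

/-! ### Auxiliary functions on cubes -/

section Auxiliary

variable {n : ℕ}

/-- The monotone map of the line that stretches `[a, b]` to `[0, 1]`. -/
noncomputable def stretch (a b x : ℝ) : ℝ := clamp ((x - a) / (b - a))

theorem continuous_stretch (a b : ℝ) : Continuous (stretch a b) := by
  unfold stretch
  exact continuous_clamp.comp (by fun_prop)

theorem stretch_nonneg (a b x : ℝ) : 0 ≤ stretch a b x := clamp_nonneg _

theorem stretch_le_one (a b x : ℝ) : stretch a b x ≤ 1 := clamp_le_one _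

theorem stretch_of_le {a b x : ℝ} (h : a < b) (hx : x ≤ a) : stretch a b x = 0 :=
  clamp_of_nonpos (div_nonpos_of_nonpos_of_nonneg (by linarith) (by linarith))

theorem stretch_of_ge {a b x : ℝ} (h : a < b) (hx : b ≤ x) : stretch a b x = 1 :=
  clamp_of_one_le ((one_le_div (by linarith)).2 (by linarith))

theorem lt_of_stretch_pos {a b x : ℝ} (h : a < b) (hx : 0 < stretch a b x) : a < x := by
  by_contra hcon
  exact hx.ne' (stretch_of_le h (not_lt.1 hcon))

theorem lt_of_stretch_lt_one {a b x : ℝ} (h : a < b) (hx : stretch a b x < 1) : x < b := by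
  by_contra hcon
  exact hx.ne (stretch_of_ge h (not_lt.1 hcon))

/-- A function on the unit cube that vanishes on the boundary and is `1` on `[1/6, 5/6]^n`. -/
noncomputable def bump (x : Fin n → ℝ) : ℝ := ∏ r, clamp (6 * x r) * clamp (6 * (1 - x r))

theorem continuous_bump : Continuous (bump (n := n)) := by
  have h := continuous_clamp
  unfold bump
  fun_prop

theorem bump_nonneg (x : Fin n → ℝ) : 0 ≤ bump x :=
  Finset.prod_nonneg fun _ _ => mul_nonneg (clamp_nonneg _) (clamp_nonneg _)

theorem bump_le_one (x : Fin n → ℝ) : bump x ≤ 1 :=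
  Finset.prod_le_one (fun _ _ => mul_nonneg (clamp_nonneg _) (clamp_nonneg _))
    fun _ _ => mul_le_one₀ (clamp_le_one _) (clamp_nonneg _) (clamp_le_one _)

theorem bump_eq_one {x : Fin n → ℝ} (h : ∀ r, 1 / 6 ≤ x r ∧ x r ≤ 5 / 6) : bump x = 1 := by
  refine Finset.prod_eq_one fun r _ => ?_
  have := h r
  rw [clamp_of_one_le (by linarith), clamp_of_one_le (by linarith), one_mul]

theorem bump_eq_zero {x : Fin n → ℝ} {r : Fin n} (h : x r ≤ 0 ∨ 1 ≤ x r) : bump x = 0 := by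
  refine Finset.prod_eq_zero (Finset.mem_univ r) ?_
  rcases h with h | h
  · rw [clamp_of_nonpos (by linarith), zero_mul]
  · rw [clamp_of_nonpos (x := 6 * (1 - x r)) (by linarith), mul_zero]

/-- The truncation of `y` to the interval `[c - e, c + e]`. -/
noncomputable def clampTo (c e y : ℝ) : ℝ := max (c - e) (min y (c + e))

theorem continuous_clampTo (c e : ℝ) : Continuous (clampTo c e) := by unfold clampTo; fun_prop

theorem clampTo_of_abs_le {c e y : ℝ} (h : |y - c| ≤ e) : clampTo c e y = y := by
  rw [abs_le] at h
  rw [clampTo, min_eq_left (by linarith), max_eq_right (by linarith)]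

theorem abs_clampTo_le {c e : ℝ} (he : 0 ≤ e) (y : ℝ) : |clampTo c e y - c| ≤ e := by
  rw [abs_le, clampTo]
  constructor
  · linarith [le_max_left (c - e) (min y (c + e))]
  · linarith [max_le (by linarith : c - e ≤ c + e) (min_le_right y (c + e))]

theorem clampTo_mem {c e y : ℝ} (he : 0 ≤ e) (hc : c ∈ I) (hy : y ∈ I) : clampTo c e y ∈ I :=
  ⟨le_max_of_le_right (le_min hy.1 (by linarith [hc.1])),
    max_le (by linarith [hc.2]) ((min_le_left _ _).trans hy.2)⟩

/-- The family of self-maps of the unit cube that connects two copies of `stretch a b` in the two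
halves of the cube to one copy. -/
noncomputable def blend (r : Fin n) (a b τ : ℝ) (x : Fin n → ℝ) : Fin n → ℝ := fun i =>
  if i = r then (1 - τ) * ((stretch a b (2 * x i) + stretch a b (2 * x i - 1)) / 2) +
    τ * stretch a b (x i) else stretch a b (x i)

theorem blend_one (r : Fin n) (a b : ℝ) (x : Fin n → ℝ) :
    blend r a b 1 x = fun i => stretch a b (x i) := by
  funext i
  simp [blend]

theorem blend_mem (r : Fin n) (a b : ℝ) {τ : ℝ} (hτ : τ ∈ I) (x : Fin n → ℝ) (i : Fin n) :
    blend r a b τ x i ∈ I := by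
  have h1 := stretch_nonneg a b
  have h2 := stretch_le_one a b
  unfold blend
  split_ifs
  · have ha := h1 (2 * x i)
    have hb := h1 (2 * x i - 1)
    have hc := h1 (x i)
    have ha' := h2 (2 * x i)
    have hb' := h2 (2 * x i - 1)
    have hc' := h2 (x i)
    exact convex_Icc (0 : ℝ) 1 ⟨by linarith, by linarith⟩ ⟨hc, hc'⟩ (by linarith [hτ.2]) hτ.1
      (by ring)
  · exact ⟨h1 _, h2 _⟩

theorem blend_eq_zero {r : Fin n} {a b τ : ℝ} (ha : 0 ≤ a) (hab : a < b) {x : Fin n → ℝ} {i : Fin n}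
    (hi : 2 * x i ≤ a) : blend r a b τ x i = 0 := by
  unfold blend
  rw [stretch_of_le hab hi, stretch_of_le hab (by linarith), stretch_of_le hab (by linarith)]
  simp

theorem blend_eq_one {r : Fin n} {a b τ : ℝ} (hab : a < b) (hb : b ≤ 1) {x : Fin n → ℝ} {i : Fin n}
    (hi : 1 + b ≤ 2 * x i) : blend r a b τ x i = 1 := by
  unfold blend
  rw [stretch_of_ge hab (by linarith), stretch_of_ge hab (by linarith),
    stretch_of_ge hab (by linarith)]
  simp

theorem continuous_blend (r : Fin n) (a b : ℝ) :
    Continuous fun x : ℝ × (Fin n → ℝ) => blend r a b x.1 x.2 := by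
  have h := continuous_stretch a b
  refine continuous_pi fun i => ?_
  unfold blend
  split_ifs <;> fun_prop

/-- If `blend` takes a value in the open cube, then the argument lies in `[1/6, 5/6]^n`, and it lies
in `(a, b)^n` up to the coordinate that is blended. -/
theorem mem_of_blend_mem {r : Fin n} {a b τ : ℝ} (ha : 1 / 3 ≤ a) (hab : a < b) (hb : b ≤ 2 / 3)
    {x : Fin n → ℝ} (h : ∀ i, 0 < blend r a b τ x i ∧ blend r a b τ x i < 1) :
    (∀ i, 1 / 6 ≤ x i ∧ x i ≤ 5 / 6) ∧ (∀ i, i ≠ r → x i ∈ Set.Ioo a b) ∧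
      (τ = 1 → x r ∈ Set.Ioo a b) := by
  refine ⟨fun i => ⟨?_, ?_⟩, fun i hi => ?_, ?_⟩
  · by_contra hcon
    exact (h i).1.ne' (blend_eq_zero (by linarith) hab (by linarith))
  · by_contra hcon
    exact (h i).2.ne (blend_eq_one hab (by linarith) (by linarith))
  · have := h i
    simp only [blend, if_neg hi] at this
    exact ⟨lt_of_stretch_pos hab this.1, lt_of_stretch_lt_one hab this.2⟩
  · rintro rfl
    have := h r
    rw [blend_one] at this
    exact ⟨lt_of_stretch_pos hab this.1, lt_of_stretch_lt_one hab this.2⟩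

end Auxiliary

/-- A reparametrization `q` of the unit interval that is constant at `π k` on `[a k, b k]`, where
these intervals have disjoint interiors. -/
structure Plateaus {K : Type w} (π a b : K → ℝ) (q : ℝ → ℝ) : Prop where
  cont : Continuous q
  mem : ∀ x, q x ∈ I
  ge : ∀ k, 1 / 3 ≤ a k
  lt : ∀ k, a k < b k
  le : ∀ k, b k ≤ 2 / 3
  const : ∀ k, ∀ x ∈ Set.Icc (a k) (b k), q x = π k
  disjoint : ∀ k l, k ≠ l → Disjoint (Set.Ioo (a k) (b k)) (Set.Ioo (a l) (b l))

theorem Plateaus.eq_of_mem {K : Type w} {π a b : K → ℝ} {q : ℝ → ℝ} (h : Plateaus π a b q)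
    {k l : K} {x : ℝ} (hk : x ∈ Set.Ioo (a k) (b k)) (hl : x ∈ Set.Ioo (a l) (b l)) : k = l := by
  by_contra hne
  exact Set.disjoint_left.1 (h.disjoint k l hne) hk hl

/-! ### Merging the cubes of a factored loop -/

section Merge

variable {n : ℕ} [NeZero n]

theorem normalize_zero (s : Fin n → ℝ) : normalize 0 0 s = s := by
  funext r
  simp [normalize, treeScale_zero]

theorem embed_zero (s : Fin n → ℝ) : embed 0 0 s = s := by
  funext r
  simp [embed, treeScale_zero]

theorem mem_unitBox {s : Fin n → ℝ} :
    s ∈ (treeBox 0 0 : Box n).carrier ↔ ∀ r, 0 ≤ s r ∧ s r ≤ 1 := by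
  rw [mem_treeBox, normalize_zero]

theorem mem_inner_unitBox {s : Fin n → ℝ} :
    s ∈ (treeBox 0 0 : Box n).inner ↔ ∀ r, 0 < s r ∧ s r < 1 := by
  rw [mem_inner_treeBox, normalize_zero]

theorem embed_mem {d : ℕ} {j : Fin n → ℤ} {x : Fin n → ℝ} (h : ∀ i, x i ∈ I) :
    embed d j x ∈ (treeBox d j).carrier := by
  rw [mem_treeBox, normalize_embed]
  exact h

theorem embed_mem_inner {d : ℕ} {j : Fin n → ℤ} {x : Fin n → ℝ} :
    embed d j x ∈ (treeBox d j).inner ↔ ∀ i, 0 < x i ∧ x i < 1 := by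
  rw [mem_inner_treeBox, normalize_embed]

/-- A bound for the oscillation of `p` on the boxes of depth `d`. -/
noncomputable def treeOsc (p : (Fin n → ℝ) → ℝ) (d : ℕ) : ℝ :=
  sSup {e | ∃ j, ∃ s ∈ (treeBox d j).carrier, ∃ s' ∈ (treeBox d j).carrier, e = |p s - p s'|}

section Osc

variable {p : (Fin n → ℝ) → ℝ}

theorem treeOsc_nonneg (p : (Fin n → ℝ) → ℝ) (d : ℕ) : 0 ≤ treeOsc p d :=
  Real.sSup_nonneg (by rintro _ ⟨j, s, hs, s', hs', rfl⟩; exact abs_nonneg _)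

theorem abs_sub_le_treeOsc (hp : ∀ s, p s ∈ I) {d : ℕ} {j : Fin n → ℤ} {s s' : Fin n → ℝ}
    (hs : s ∈ (treeBox d j).carrier) (hs' : s' ∈ (treeBox d j).carrier) :
    |p s - p s'| ≤ treeOsc p d := by
  refine le_csSup ⟨1, ?_⟩ ⟨j, s, hs, s', hs', rfl⟩
  rintro _ ⟨j, s, -, s', -, rfl⟩
  have h1 := hp s
  have h2 := hp s'
  rw [abs_le]
  constructor <;> linarith [h1.1, h1.2, h2.1, h2.2]

theorem dist_le_of_mem_treeBox {d : ℕ} {j : Fin n → ℤ} {s s' : Fin n → ℝ}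
    (hs : s ∈ (treeBox d j).carrier) (hs' : s' ∈ (treeBox d j).carrier) :
    dist s s' ≤ (1 / 2) ^ (d / n) := by
  rw [dist_pi_le_iff (by positivity)]
  intro r
  have h1 := hs r
  have h2 := hs' r
  simp only [treeBox_lo, treeBox_hi] at h1 h2
  have h3 : dist (s r) (s' r) ≤ (1 / 2) ^ treeScale n d r := by
    rw [Real.dist_eq, abs_le, one_div, inv_pow]
    have h4 : ((j r : ℝ) + 1) / 2 ^ treeScale n d r =
        j r / 2 ^ treeScale n d r + (2 ^ treeScale n d r)⁻¹ := by rw [add_div, one_div]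
    constructor <;> linarith
  refine h3.trans (pow_le_pow_of_le_one (by norm_num) (by norm_num) ?_)
  exact Nat.div_le_div_right (by omega)

open Filter in
theorem tendsto_treeOsc (hp : UniformContinuous p) : Tendsto (treeOsc p) atTop (𝓝 0) := by
  rw [Metric.tendsto_atTop]
  intro e he
  obtain ⟨δ, hδ, h⟩ := Metric.uniformContinuous_iff.1 hp (e / 2) (by linarith)
  obtain ⟨m, hm⟩ := exists_pow_lt_of_lt_one hδ (show (1 / 2 : ℝ) < 1 by norm_num)
  refine ⟨m * n, fun d hd => ?_⟩
  rw [Real.dist_eq, sub_zero, abs_of_nonneg (treeOsc_nonneg p d)]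
  refine lt_of_le_of_lt (Real.sSup_le ?_ (by linarith : 0 ≤ e / 2)) (by linarith)
  rintro _ ⟨j, s, hs, s', hs', rfl⟩
  have h1 : dist s s' < δ := by
    refine ((dist_le_of_mem_treeBox hs hs').trans ?_).trans_lt hm
    exact pow_le_pow_of_le_one (by norm_num) (by norm_num)
      ((Nat.le_div_iff_mul_le (NeZero.pos n)).2 hd)
  exact (h h1).le

/-- A continuous function that is constant outside of the open unit cube is uniformly continuous. -/
theorem uniformContinuous_of_const (hp : Continuous p) {c : ℝ}
    (h : ∀ s, s ∉ (treeBox 0 0 : Box n).inner → p s = c) : UniformContinuous p := by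
  have h1 : UniformContinuous fun s => p s - c := by
    refine Continuous.uniformContinuous_of_tendsto_cocompact (x := 0) (by fun_prop) ?_
    refine HasCompactSupport.is_zero_at_infty (HasCompactSupport.of_support_subset_isCompact
      (isCompact_Icc (a := (0 : Fin n → ℝ)) (b := 1)) fun s hs => ?_)
    by_contra hcon
    refine hs (sub_eq_zero.2 (h s fun h2 => hcon ?_))
    rw [mem_inner_unitBox] at h2
    exact ⟨fun r => (h2 r).1.le, fun r => (h2 r).2.le⟩
  simpa using h1.add (uniformContinuous_const (b := c))

end Osc

variable {Z : Type u} [TopologicalSpace Z] {K : Type w}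

/-- A map on `ℝ^n` that represents a loop at `arc y₀` in a space with an arc decomposition, together
with a factorization by boxes of the tree, which are given by their depths and indices. -/
structure TreeFactored (D : ArcDecomposition Z K) (y₀ : ℝ) (cubes : K → Set (ℕ × (Fin n → ℤ)))
    (f : (Fin n → ℝ) → Z) : Prop where
  cont : Continuous f
  mem : y₀ ∈ I
  out : ∀ s, s ∉ (treeBox 0 0 : Box n).inner → f s = D.arc y₀
  disjoint : ∀ k l, ∀ c ∈ cubes k, ∀ c' ∈ cubes l, (k, c) ≠ (l, c') →
    Disjoint (treeBox c.1 c.2).inner (treeBox c'.1 c'.2).inner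
  mapsTo : ∀ k, ∀ c ∈ cubes k, ∀ s ∈ (treeBox c.1 c.2).carrier, D.proj k (f s) = f s
  bd : ∀ k, ∀ c ∈ cubes k, ∀ s ∈ (treeBox c.1 c.2).bd, f s = D.pt k
  cover : ∀ k s, D.proj k (f s) ≠ D.pt k → ∃ c ∈ cubes k, s ∈ (treeBox c.1 c.2).carrier
  unit : ∀ k, ∀ c ∈ cubes k, (treeBox c.1 c.2).carrier ⊆ (treeBox 0 0).carrier

/-- A box is split if it is contained in the unit cube but not in a cube of the factorization of at
most the same depth. -/
def IsSplit (cubes : K → Set (ℕ × (Fin n → ℤ))) (d : ℕ) (j : Fin n → ℤ) : Prop :=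
  (treeBox d j).carrier ⊆ (treeBox 0 0).carrier ∧ ∀ l, ∀ c ∈ cubes l, c.1 ≤ d →
    ¬ (treeBox d j).carrier ⊆ (treeBox c.1 c.2).carrier

/-- The box `[a, b]^n` in the box `c` of the tree. -/
noncomputable def subBox {a b : ℝ} (hab : a < b) (c : ℕ × (Fin n → ℤ)) : Box n where
  lo := embed c.1 c.2 fun _ => a
  hi := embed c.1 c.2 fun _ => b
  lt := fun r => by
    have : (0 : ℝ) < 2 ^ treeScale n c.1 r := by positivity
    exact div_lt_div_of_pos_right (by linarith) this

theorem subBox_map {a b : ℝ} (hab : a < b) (c : ℕ × (Fin n → ℤ)) (s : Fin n → ℝ) :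
    (subBox hab c).map (treeBox c.1 c.2) s =
      embed c.1 c.2 fun i => stretch a b (normalize c.1 c.2 s i) := by
  funext r
  have h1 : (0 : ℝ) < 2 ^ treeScale n c.1 r := by positivity
  have h2 : b - a ≠ 0 := by linarith
  simp only [Box.map, subBox, embed, treeBox_lo, treeBox_hi, stretch, normalize]
  have h3 : (s r - (c.2 r + a) / 2 ^ treeScale n c.1 r) /
      ((c.2 r + b) / 2 ^ treeScale n c.1 r - (c.2 r + a) / 2 ^ treeScale n c.1 r) =
      (2 ^ treeScale n c.1 r * s r - c.2 r - a) / (b - a) := by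
    field_simp
    rw [show (c.2 r : ℝ) + b - (c.2 r + a) = b - a by ring]
    field_simp
    ring
  rw [h3]
  ring

namespace TreeFactored

variable {D : ArcDecomposition Z K} {y₀ : ℝ} {cubes : K → Set (ℕ × (Fin n → ℤ))}
  {f : (Fin n → ℝ) → Z} (h : TreeFactored D y₀ cubes f)

include h

theorem boxSupported (k : K) :
    BoxSupported (fun c : cubes k => treeBox c.1.1 c.1.2) (D.pt k) fun s => D.proj k (f s) where
  cont := (D.continuous_proj k).comp h.cont
  disjoint := fun c c' hc => h.disjoint k k c c.2 c' c'.2 fun h1 =>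
    hc (Subtype.ext (Prod.ext_iff.1 h1).2)
  bd := fun c s hs => by rw [h.bd k c c.2 s hs, D.proj_pt]
  cover := fun s hs => by
    obtain ⟨c, hc, hsc⟩ := h.cover k s hs
    exact ⟨⟨c, hc⟩, hsc⟩
  unit := fun c s hs => by
    have := mem_unitBox.1 (h.unit k c c.2 hs)
    exact ⟨fun r => (this r).1, fun r => (this r).2⟩

theorem exists_inner {k : K} {s : Fin n → ℝ} (hs : D.proj k (f s) ≠ D.pt k) :
    ∃ c ∈ cubes k, s ∈ (treeBox c.1 c.2).inner := by
  obtain ⟨c, hc⟩ := (h.boxSupported k).exists_inner hs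
  exact ⟨c, c.2, hc⟩

theorem index_eq {k l : K} {c c' : ℕ × (Fin n → ℤ)} (hc : c ∈ cubes k) (hc' : c' ∈ cubes l)
    {s : Fin n → ℝ} (hs : s ∈ (treeBox c.1 c.2).carrier) (hs' : s ∈ (treeBox c'.1 c'.2).inner) :
    k = l := by
  by_contra hne
  exact Box.notMem_inner_of_disjoint
    (h.disjoint k l c hc c' hc' fun h1 => hne (Prod.ext_iff.1 h1).1) hs hs'

/-- A split box is not cut by the cubes of the factorization: its boundary is mapped to the arc. -/
theorem proj_of_isSplit {d : ℕ} {j : Fin n → ℤ} (hj : IsSplit cubes d j) (k : K) {s : Fin n → ℝ}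
    (hs : s ∈ (treeBox d j).carrier) (hs' : s ∉ (treeBox d j).inner) :
    D.proj k (f s) = D.pt k := by
  by_contra hne
  obtain ⟨c, hc, hsc⟩ := h.exists_inner hne
  have h1 := Box.inter_inner_nonempty (Box.isOpen_inner _) hs hsc
  rcases le_total c.1 d with h2 | h2
  · exact hj.2 k c hc h2 (treeBox_subset h2 h1)
  · exact hs' (Box.inner_subset_inner (treeBox_subset h2 (by rwa [Set.inter_comm])) hsc)

variable (a b : K → ℝ)

/-- The first step of the merging: the content of each cube of the factorization for the index `k`
is shrunk to the subcube with normalized coordinates in `[a k, b k]`. -/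
theorem exists_shrink {π : K → ℝ} {q : ℝ → ℝ} (hq : Plateaus π a b q) (k : K) :
    ∃ F : (Fin n → ℝ) × I → Z, Continuous F ∧ (∀ s, F (s, 0) = D.proj k (f s)) ∧
      (∀ s t, ∃ s', F (s, t) = D.proj k (f s')) ∧
      (∀ s t, F (s, t) ≠ D.pt k → ∃ c ∈ cubes k, s ∈ (treeBox c.1 c.2).inner) ∧
      ∀ l, ∀ c ∈ cubes l, ∀ s ∈ (treeBox c.1 c.2).carrier,
        F (s, 1) =
          D.proj k (f (embed c.1 c.2 fun i => stretch (a k) (b k) (normalize c.1 c.2 s i))) := by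
  obtain ⟨F, hF, hF1, hF2, hF0⟩ := (h.boxSupported k).exists_shrink
    (D := fun c : cubes k => subBox (hq.lt k) c.1) (fun c s hs => by
      rw [mem_treeBox]
      intro r
      have h1 : (0 : ℝ) < 2 ^ treeScale n c.1.1 r := by positivity
      obtain ⟨h2, h3⟩ := hs r
      simp only [subBox, embed] at h2 h3
      rw [div_le_iff₀ h1] at h2
      rw [le_div_iff₀ h1] at h3
      have h4 := hq.ge k
      have h5 := hq.le k
      simp only [normalize]
      constructor <;> linarith)
  have hin : ∀ s t, F (s, t) ≠ D.pt k → ∃ c ∈ cubes k, s ∈ (treeBox c.1 c.2).inner := by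
    intro s t hne
    by_contra hcon
    push Not at hcon
    exact hne (hF2 s (fun c => hcon c c.2) t)
  refine ⟨F, hF, hF0, fun s t => ?_, hin, fun l c hc s hs => ?_⟩
  · by_cases hs : ∃ c : cubes k, s ∈ (treeBox c.1.1 c.1.2).inner
    · obtain ⟨c, hc⟩ := hs
      exact ⟨_, hF1 c s (Box.inner_subset _ hc) t⟩
    · push Not at hs
      refine ⟨fun _ => 0, ?_⟩
      rw [hF2 s hs t, h.out _ fun h1 => lt_irrefl _ ((mem_inner_unitBox.1 h1) 0).1, D.proj_arc]
      rfl
  · by_cases hlk : l = k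
    · subst hlk
      rw [hF1 ⟨c, hc⟩ s hs 1, Box.interp_one, subBox_map]
    · have h1 : F (s, 1) = D.pt k := by
        by_contra hne
        obtain ⟨c', hc', hs'⟩ := hin s 1 hne
        exact hlk (h.index_eq hc hc' hs hs')
      rw [h1]
      have h2 := h.mapsTo l c hc _ (embed_mem (d := c.1) (j := c.2)
        (x := fun i => stretch (a k) (b k) (normalize c.1 c.2 s i))
        fun i => ⟨stretch_nonneg _ _ _, stretch_le_one _ _ _⟩)
      exact (ArcDecomposition.proj_of_proj_eq h2 (Ne.symm hlk)).symm

end TreeFactored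

end Merge

/-! ### Merging the contents of the two halves of a box -/

section MergeStep

variable {n : ℕ} [NeZero n] {Z : Type u} [TopologicalSpace Z] {K : Type w}

/-- The properties of the content after the first step of the merging. -/
structure IsShrunk (D : ArcDecomposition Z K) (cubes : K → Set (ℕ × (Fin n → ℤ)))
    (f : (Fin n → ℝ) → Z) (a b : K → ℝ) (F : K → (Fin n → ℝ) → Z) : Prop where
  cont : ∀ k, Continuous (F k)
  range : ∀ k s, ∃ s', F k s = D.proj k (f s')
  inner : ∀ k s, F k s ≠ D.pt k → ∃ c ∈ cubes k, s ∈ (treeBox c.1 c.2).inner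
  leaf : ∀ k l, ∀ c ∈ cubes l, ∀ s ∈ (treeBox c.1 c.2).carrier,
    F k s = D.proj k (f (embed c.1 c.2 fun i => stretch (a k) (b k) (normalize c.1 c.2 s i)))

variable (D : ArcDecomposition Z K) (cubes : K → Set (ℕ × (Fin n → ℤ)))
  (f : (Fin n → ℝ) → Z) (a b : K → ℝ) (q : ℝ → ℝ) (F : K → (Fin n → ℝ) → Z)

open Classical in
/-- The content on a box of depth `d` while the contents of its two halves are merged. -/
noncomputable def cellContent (d : ℕ) (k : K) (j : Fin n → ℤ) (x : (Fin n → ℝ) × I) : Z :=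
  if IsSplit cubes d j then
    D.proj k (f (embed d j (blend (splitAxis n d) (a k) (b k) (clamp (2 * x.2 - 1))
      (normalize d j x.1))))
  else F k x.1

/-- The content while the boxes of depth `d + 1` are merged to boxes of depth `d`. -/
noncomputable def stepContent (d : ℕ) (k : K) (x : (Fin n → ℝ) × I) : Z :=
  cellContent D cubes f a b F d k (treeIndex d x.1) x

open Classical in
/-- The position on the arc, on a box of depth `d`, after merging up to depth `d`. In the middle of
the box it is a function of one coordinate, which is constant at `base k` where the content for the
index `k` is placed. The truncation keeps it close to the original position. -/
noncomputable def cellCore (d : ℕ) (j : Fin n → ℤ) (s : Fin n → ℝ) : ℝ :=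
  if IsSplit cubes d j then
    (1 - bump (normalize d j s)) * D.pos (f s) + bump (normalize d j s) *
      clampTo (D.pos (f (embed d j fun _ => 1 / 2))) (treeOsc (fun s => D.pos (f s)) d)
        (q (normalize d j s (splitAxis n (d + 1))))
  else D.pos (f s)

/-- The position on the arc after merging up to depth `d`. -/
noncomputable def levelCore (d : ℕ) (s : Fin n → ℝ) : ℝ :=
  cellCore D cubes f q d (treeIndex d s) s

/-- The position on the arc while the boxes of depth `d + 1` are merged to boxes of depth `d`. -/
noncomputable def stepCore (d : ℕ) (x : (Fin n → ℝ) × I) : ℝ :=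
  (1 - clamp (2 * x.2)) * levelCore D cubes f q (d + 1) x.1 +
    clamp (2 * x.2) * levelCore D cubes f q d x.1

variable {D cubes f a b q F} {y₀ : ℝ}

theorem splitAxis_succ_ne (hn : 2 ≤ n) (d : ℕ) : splitAxis n (d + 1) ≠ splitAxis n d := by
  intro h
  have h1 : (d + 1) % n = d % n := congrArg Fin.val h
  have h2 : (d + 1 - d) % n = 0 := Nat.sub_mod_eq_zero_of_mod_eq h1
  rw [Nat.add_sub_cancel_left, Nat.mod_eq_of_lt (by omega)] at h2
  omega

theorem not_forall_normalize {d : ℕ} {j : Fin n → ℤ} {s : Fin n → ℝ}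
    (hs : s ∈ (treeBox d j).carrier) (hs' : s ∉ (treeBox d j).inner) :
    ∃ r, normalize d j s r = 0 ∨ normalize d j s r = 1 := by
  by_contra hcon
  push Not at hcon
  rw [mem_treeBox] at hs
  exact hs' (mem_inner_treeBox.2 fun r =>
    ⟨lt_of_le_of_ne (hs r).1 (hcon r).1.symm, lt_of_le_of_ne (hs r).2 (hcon r).2⟩)

theorem clamp_mem (x : ℝ) : clamp x ∈ I := ⟨clamp_nonneg x, clamp_le_one x⟩

section

variable (h : TreeFactored D y₀ cubes f) (hq : Plateaus D.base a b q)
  (hF : IsShrunk D cubes f a b F)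

include h hq

theorem cellContent_eq_pt {d : ℕ} {j : Fin n → ℤ} (hj : IsSplit cubes d j) (k : K)
    {s : Fin n → ℝ} (hs : s ∈ (treeBox d j).carrier) (hs' : s ∉ (treeBox d j).inner) (t : I) :
    cellContent D cubes f a b F d k j (s, t) = D.pt k := by
  rw [cellContent, if_pos hj]
  refine h.proj_of_isSplit hj k (embed_mem (blend_mem _ _ _ (clamp_mem _) _)) ?_
  rw [embed_mem_inner]
  intro hcon
  have h1 := hq.ge k
  have h2 := hq.le k
  obtain ⟨r, hr | hr⟩ := not_forall_normalize hs hs'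
  · exact (hcon r).1.ne' (blend_eq_zero (by linarith) (hq.lt k) (by simp only [hr]; linarith))
  · exact (hcon r).2.ne (blend_eq_one (hq.lt k) (by linarith) (by simp only [hr]; linarith))

omit hq in
theorem exists_of_cellContent_ne {d : ℕ} {j : Fin n → ℤ} (hj : IsSplit cubes d j) {k : K}
    {x : (Fin n → ℝ) × I} (hx : cellContent D cubes f a b F d k j x ≠ D.pt k) :
    (∀ i, 0 < blend (splitAxis n d) (a k) (b k) (clamp (2 * x.2 - 1)) (normalize d j x.1) i ∧
      blend (splitAxis n d) (a k) (b k) (clamp (2 * x.2 - 1)) (normalize d j x.1) i < 1) ∧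
    ∃ s' ∈ (treeBox d j).carrier, D.pos (f s') = D.base k := by
  rw [cellContent, if_pos hj] at hx
  have h1 : embed d j (blend (splitAxis n d) (a k) (b k) (clamp (2 * x.2 - 1))
      (normalize d j x.1)) ∈ (treeBox d j).carrier := embed_mem (blend_mem _ _ _ (clamp_mem _) _)
  refine ⟨?_, _, h1, ArcDecomposition.pos_of_proj_eq (ArcDecomposition.eq_proj hx)⟩
  by_contra hcon
  refine hx (h.proj_of_isSplit hj k h1 ?_)
  rwa [embed_mem_inner]

include hF

omit hq in
theorem shrunk_eq_pt {d : ℕ} {j : Fin n → ℤ} (hj : IsSplit cubes d j) (k : K)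
    {s : Fin n → ℝ} (hs : s ∈ (treeBox d j).carrier) (hs' : s ∉ (treeBox d j).inner) :
    F k s = D.pt k := by
  by_contra hne
  obtain ⟨c, hc, hsc⟩ := hF.inner k s hne
  have h1 := Box.inter_inner_nonempty (Box.isOpen_inner _) hs hsc
  rcases le_total c.1 d with h2 | h2
  · exact hj.2 k c hc h2 (treeBox_subset h2 h1)
  · exact hs' (Box.inner_subset_inner (treeBox_subset h2 (by rwa [Set.inter_comm])) hsc)

/-- The contents agree on the intersection of two boxes. -/
theorem cellContent_congr {d : ℕ} {j j' : Fin n → ℤ} (k : K) {s : Fin n → ℝ}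
    (hs : s ∈ (treeBox d j).carrier) (hs' : s ∈ (treeBox d j').carrier) (t : I) :
    cellContent D cubes f a b F d k j (s, t) = cellContent D cubes f a b F d k j' (s, t) := by
  by_cases hjj : j = j'
  · rw [hjj]
  have hj := notMem_inner_of_mem_of_ne hjj hs'
  have hj' := notMem_inner_of_mem_of_ne (Ne.symm hjj) hs
  have key : ∀ {j}, s ∈ (treeBox d j).carrier → s ∉ (treeBox d j).inner →
      cellContent D cubes f a b F d k j (s, t) = F k s := by
    intro j h1 h2
    by_cases h3 : IsSplit cubes d j
    · rw [cellContent_eq_pt h hq h3 k h1 h2 t, shrunk_eq_pt h hF h3 k h1 h2]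
    · exact if_neg h3
  rw [key hs hj, key hs' hj']

theorem stepContent_eq {d : ℕ} {j : Fin n → ℤ} (k : K) {s : Fin n → ℝ}
    (hs : s ∈ (treeBox d j).carrier) (t : I) :
    stepContent D cubes f a b F d k (s, t) = cellContent D cubes f a b F d k j (s, t) :=
  cellContent_congr h hq hF k (mem_treeIndex d s) hs t

theorem continuous_stepContent (d : ℕ) (k : K) :
    Continuous (stepContent D cubes f a b F d k) := by
  refine continuous_treeGlue d (G := fun j x => cellContent D cubes f a b F d k j x) (fun j => ?_)
    fun j j' s t hs hs' => cellContent_congr h hq hF k hs hs' t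
  have hc := continuous_clamp
  have hb := continuous_blend (splitAxis n d) (a k) (b k)
  by_cases hj : IsSplit cubes d j
  · simp only [cellContent, if_pos hj]
    refine (D.continuous_proj k).comp (h.cont.comp ((continuous_embed d j).comp ?_))
    have hn := continuous_normalize d j
    exact hb.comp ((by fun_prop : Continuous fun x : (Fin n → ℝ) × I => clamp (2 * x.2 - 1)).prodMk
      (hn.comp continuous_fst))
  · simp only [cellContent, if_neg hj]
    exact (hF.cont k).comp continuous_fst

omit h hq in
theorem exists_stepContent_eq (d : ℕ) (k : K) (x : (Fin n → ℝ) × I) :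
    ∃ s', stepContent D cubes f a b F d k x = D.proj k (f s') := by
  unfold stepContent cellContent
  split_ifs
  · exact ⟨_, rfl⟩
  · exact hF.range k _

/-- At the beginning of a step, the content is that at the end of the preceding step. -/
theorem stepContent_of_le (d : ℕ) (k : K) (s : Fin n → ℝ) {t : I} (ht : 2 * (t : ℝ) ≤ 1) :
    stepContent D cubes f a b F d k (s, t) = stepContent D cubes f a b F (d + 1) k (s, 1) := by
  set j := treeIndex d s with hj
  set j' := treeIndex (d + 1) s with hj'
  have hsub : (treeBox (d + 1) j').carrier ⊆ (treeBox d j).carrier := treeBox_succ_subset d s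
  have hne : ((treeBox d j).inner ∩ (treeBox (d + 1) j').inner).Nonempty := by
    rw [Set.inter_eq_right.2 (Box.inner_subset_inner hsub)]
    exact Box.inner_nonempty _
  change cellContent D cubes f a b F d k j (s, t) = cellContent D cubes f a b F (d + 1) k j' (s, 1)
  by_cases h1 : IsSplit cubes d j
  · have hpt : embed d j (blend (splitAxis n d) (a k) (b k) 0 (normalize d j s)) =
        embed (d + 1) j' fun i => stretch (a k) (b k) (normalize (d + 1) j' s i) := by
      have hq1 := hq.ge k
      have hq2 := hq.le k
      funext i
      by_cases hi : i = splitAxis n d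
      · subst hi
        obtain ⟨h2, ⟨h3, h4⟩ | ⟨h3, h4⟩⟩ := treeIndex_succ d s
        · rw [← hj, ← hj'] at h3
          rw [← hj] at h4
          have h5 : normalize (d + 1) j' s (splitAxis n d) =
              2 * normalize d j s (splitAxis n d) := by
            simp only [normalize, h2, h3]; push_cast; ring
          simp only [embed, blend, if_pos, h5, h2, h3,
            stretch_of_le (hq.lt k) (x := 2 * normalize d j s (splitAxis n d) - 1) (by linarith)]
          push_cast
          field_simp
          ring
        · rw [← hj, ← hj'] at h3
          rw [← hj] at h4
          have h5 : normalize (d + 1) j' s (splitAxis n d) =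
              2 * normalize d j s (splitAxis n d) - 1 := by
            simp only [normalize, h2, h3]; push_cast; ring
          simp only [embed, blend, if_pos, h5, h2, h3,
            stretch_of_ge (hq.lt k) (x := 2 * normalize d j s (splitAxis n d)) (by linarith)]
          push_cast
          field_simp
          ring
      · obtain ⟨h2, h3⟩ := treeIndex_succ_of_ne hi s
        rw [← hj, ← hj'] at h3
        simp only [embed, blend, if_neg hi, normalize, h2, h3]
    have hl : cellContent D cubes f a b F d k j (s, t) = D.proj k (f (embed (d + 1) j' fun i =>
        stretch (a k) (b k) (normalize (d + 1) j' s i))) := by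
      rw [cellContent, if_pos h1, ← hpt, clamp_of_nonpos (by linarith : 2 * (t : ℝ) - 1 ≤ 0)]
    rw [hl]
    by_cases h2 : IsSplit cubes (d + 1) j'
    · rw [cellContent, if_pos h2, ← blend_one (splitAxis n (d + 1)), Set.Icc.coe_one,
        show clamp (2 * 1 - 1) = 1 from clamp_of_one_le (by norm_num)]
    · have h3 : ∃ l, ∃ c ∈ cubes l, c.1 ≤ d + 1 ∧
          (treeBox (d + 1) j').carrier ⊆ (treeBox c.1 c.2).carrier := by
        by_contra hcon
        push Not at hcon
        exact h2 ⟨hsub.trans h1.1, hcon⟩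
      -- The half is itself a cube of the factorization, as the box is split.
      obtain ⟨l, ⟨d', i⟩, hc, hd, hcs⟩ := h3
      obtain rfl : d' = d + 1 := by
        by_contra hd'
        refine h1.2 l _ hc (by change d' ≤ d; simp only at hd; omega) (treeBox_subset
          (by simp only at hd; omega) ?_)
        rw [Set.inter_comm]
        exact hne.mono (Set.inter_subset_inter_right _ (Box.inner_subset_inner hcs))
      obtain rfl : i = j' := by
        refine treeBox_index_eq (d := d + 1) ?_
        rw [Set.inter_eq_right.2 (Box.inner_subset_inner hcs)]
        exact Box.inner_nonempty _
      rw [cellContent, if_neg h2]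
      exact (hF.leaf k l _ hc s (mem_treeIndex (d + 1) s)).symm
  · have h2 : ¬ IsSplit cubes (d + 1) j' := by
      intro h2
      refine h1 ⟨?_, fun l c hc hd hsub' => h2.2 l c hc (by omega) (hsub.trans hsub')⟩
      exact treeBox_subset (Nat.zero_le d) ((Box.inner_nonempty (treeBox (d + 1) j')).mono
        fun x hx => ⟨Box.inner_subset_inner h2.1 hx, Box.inner_subset_inner hsub hx⟩)
    rw [cellContent, cellContent, if_neg h1, if_neg h2]

omit hq in
theorem pos_of_shrunk_ne {k : K} {s : Fin n → ℝ} (hs : F k s ≠ D.pt k) :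
    D.pos (f s) = D.base k := by
  obtain ⟨c, hc, hsc⟩ := hF.inner k s hs
  exact ArcDecomposition.pos_of_proj_eq (h.mapsTo k c hc s (Box.inner_subset _ hsc))

/-- Where the content for the index `k` is, the position is `base k`. This uses that `n ≥ 2`: the
position varies along another axis than the one along which the halves of a box are merged. -/
theorem levelCore_of_ne (hn : 2 ≤ n) {d : ℕ} {k : K} {x : (Fin n → ℝ) × I}
    (hx : stepContent D cubes f a b F d k x ≠ D.pt k) : levelCore D cubes f q d x.1 = D.base k := by
  by_cases h1 : IsSplit cubes d (treeIndex d x.1)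
  · obtain ⟨h2, s', hs', h3⟩ := exists_of_cellContent_ne h h1 hx
    obtain ⟨h4, h5, -⟩ := mem_of_blend_mem (hq.ge k) (hq.lt k) (hq.le k) h2
    rw [levelCore, cellCore, if_pos h1, bump_eq_one h4,
      hq.const k _ (Set.Ioo_subset_Icc_self (h5 _ (splitAxis_succ_ne hn d))), clampTo_of_abs_le]
    · ring
    · rw [← h3]
      refine abs_sub_le_treeOsc (p := fun s => D.pos (f s)) (fun s => D.pos_mem _) hs'
        (embed_mem ?_)
      exact fun _ => ⟨by norm_num, by norm_num⟩
  · have hx' : F k x.1 ≠ D.pt k := by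
      rwa [stepContent, cellContent, if_neg h1] at hx
    rw [levelCore, cellCore, if_neg h1, pos_of_shrunk_ne h hF hx']

/-- At each point there is content for at most one index: on a split box the contents for different
indices are placed over different intervals of the axis along which the boxes are not halved. -/
theorem index_eq_of_ne (hn : 2 ≤ n) {d : ℕ} {k l : K} {x : (Fin n → ℝ) × I}
    (hk : stepContent D cubes f a b F d k x ≠ D.pt k)
    (hl : stepContent D cubes f a b F d l x ≠ D.pt l) : k = l := by
  by_cases h1 : IsSplit cubes d (treeIndex d x.1)
  · obtain ⟨h2, -⟩ := exists_of_cellContent_ne h h1 hk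
    obtain ⟨h3, -⟩ := exists_of_cellContent_ne h h1 hl
    obtain ⟨-, h4, -⟩ := mem_of_blend_mem (hq.ge k) (hq.lt k) (hq.le k) h2
    obtain ⟨-, h5, -⟩ := mem_of_blend_mem (hq.ge l) (hq.lt l) (hq.le l) h3
    exact hq.eq_of_mem (h4 _ (splitAxis_succ_ne hn d)) (h5 _ (splitAxis_succ_ne hn d))
  · rw [stepContent, cellContent, if_neg h1] at hk hl
    obtain ⟨c, hc, hsc⟩ := hF.inner k _ hk
    obtain ⟨c', hc', hsc'⟩ := hF.inner l _ hl
    exact h.index_eq hc hc' (Box.inner_subset _ hsc) hsc'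

omit h hF in
theorem levelCore_mem (d : ℕ) (s : Fin n → ℝ) : levelCore D cubes f q d s ∈ I := by
  unfold levelCore cellCore
  split_ifs
  · exact convex_Icc (0 : ℝ) 1 (D.pos_mem _)
      (clampTo_mem (treeOsc_nonneg _ d) (D.pos_mem _) (hq.mem _))
      (by linarith [bump_le_one (normalize d (treeIndex d s) s)]) (bump_nonneg _) (by ring)
  · exact D.pos_mem _

omit h hF in
theorem stepCore_mem (d : ℕ) (x : (Fin n → ℝ) × I) : stepCore D cubes f q d x ∈ I :=
  convex_Icc (0 : ℝ) 1 (levelCore_mem hq _ _) (levelCore_mem hq _ _)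
    (by linarith [clamp_le_one (2 * x.2)]) (clamp_nonneg _) (by ring)

/-- The position and the contents during a step are the coordinates of a point. -/
theorem valid_step (hn : 2 ≤ n) (d : ℕ) (x : (Fin n → ℝ) × I) :
    D.Valid (stepCore D cubes f q d x) fun k => stepContent D cubes f a b F d k x where
  mem := stepCore_mem hq d x
  proj := fun k => by
    obtain ⟨s', hs'⟩ := exists_stepContent_eq hF d k x
    simp only [hs', D.proj_proj]
  base := fun k hk => by
    have h1 := levelCore_of_ne h hq hF hn hk
    rw [stepCore, h1]
    rcases le_total (2 * (x.2 : ℝ)) 1 with ht | ht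
    · have h2 : stepContent D cubes f a b F (d + 1) k (x.1, 1) ≠ D.pt k := by
        rwa [← stepContent_of_le h hq hF d k x.1 ht]
      have h3 := levelCore_of_ne h hq hF hn h2
      simp only at h3
      rw [h3]
      ring
    · rw [clamp_of_one_le ht]
      ring
  eq_pt := fun k hk l hl => by
    by_contra hcon
    exact hl (index_eq_of_ne h hq hF hn hcon hk)

omit h hq hF in
theorem cellCore_eq_pos {d : ℕ} {j : Fin n → ℤ} {s : Fin n → ℝ}
    (hs : s ∈ (treeBox d j).carrier) (hs' : s ∉ (treeBox d j).inner) :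
    cellCore D cubes f q d j s = D.pos (f s) := by
  unfold cellCore
  split_ifs
  · obtain ⟨r, hr⟩ := not_forall_normalize hs hs'
    rw [bump_eq_zero (r := r) (hr.imp le_of_eq ge_of_eq)]
    ring
  · rfl

omit hF in
theorem continuous_cellCore (d : ℕ) (j : Fin n → ℤ) : Continuous (cellCore D cubes f q d j) := by
  have hp : Continuous fun s => D.pos (f s) := D.continuous_pos.comp h.cont
  have hb : Continuous fun s => bump (normalize d j s) :=
    continuous_bump.comp (continuous_normalize d j)
  have hn : Continuous fun s => normalize d j s (splitAxis n (d + 1)) :=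
    (continuous_apply (splitAxis n (d + 1))).comp (continuous_normalize d j)
  have hc : Continuous fun s => clampTo (D.pos (f (embed d j fun _ => 1 / 2)))
      (treeOsc (fun s => D.pos (f s)) d) (q (normalize d j s (splitAxis n (d + 1)))) :=
    (continuous_clampTo _ _).comp (hq.cont.comp hn)
  unfold cellCore
  split_ifs
  · exact ((continuous_const.sub hb).mul hp).add (hb.mul hc)
  · exact hp

omit hF in
theorem continuous_levelCore (d : ℕ) : Continuous (levelCore D cubes f q d) := by
  have hag : ∀ j j' s (t : I), s ∈ (treeBox d j).carrier → s ∈ (treeBox d j').carrier →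
      cellCore D cubes f q d j s = cellCore D cubes f q d j' s := by
    intro j j' s _ hs hs'
    by_cases hjj : j = j'
    · rw [hjj]
    · exact (cellCore_eq_pos hs (notMem_inner_of_mem_of_ne hjj hs')).trans
        (cellCore_eq_pos hs' (notMem_inner_of_mem_of_ne (Ne.symm hjj) hs)).symm
  have hcell' : ∀ j, Continuous fun x : (Fin n → ℝ) × I => cellCore D cubes f q d j x.1 :=
    fun j => (continuous_cellCore h hq d j).comp continuous_fst
  have key := continuous_treeGlue d hcell' hag
  have h0 : Continuous fun s : Fin n → ℝ => (s, (0 : I)) := by fun_prop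
  have h1 := key.comp h0
  simp only [Function.comp_def] at h1
  exact h1

omit hF in
theorem continuous_stepCore (d : ℕ) : Continuous (stepCore D cubes f q d) := by
  have h1 := continuous_levelCore h hq (d + 1)
  have h2 := continuous_levelCore h hq d
  have h3 := continuous_clamp
  unfold stepCore
  fun_prop

omit h hq hF in
/-- The position after merging converges to the original position as the depth grows. -/
theorem abs_levelCore_sub_le (d : ℕ) (s : Fin n → ℝ) :
    |levelCore D cubes f q d s - D.pos (f s)| ≤ 2 * treeOsc (fun s => D.pos (f s)) d := by
  have h0 := treeOsc_nonneg (fun s => D.pos (f s)) d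
  unfold levelCore cellCore
  split_ifs
  · have h1 := abs_clampTo_le h0 (c := D.pos (f (embed d (treeIndex d s) fun _ => 1 / 2)))
      (q (normalize d (treeIndex d s) s (splitAxis n (d + 1))))
    have h2 : |D.pos (f (embed d (treeIndex d s) fun _ => 1 / 2)) - D.pos (f s)| ≤ _ :=
      abs_sub_le_treeOsc (p := fun s => D.pos (f s)) (fun s => D.pos_mem _)
        (embed_mem fun _ => ⟨by norm_num, by norm_num⟩) (mem_treeIndex d s)
    have h3 := bump_nonneg (normalize d (treeIndex d s) s)
    have h4 := bump_le_one (normalize d (treeIndex d s) s)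
    set m := bump (normalize d (treeIndex d s) s)
    set c := clampTo _ _ _
    have h5 : |c - D.pos (f s)| ≤ 2 * treeOsc (fun s => D.pos (f s)) d := by
      refine (abs_sub_le _ _ _).trans (by linarith)
    rw [show (1 - m) * D.pos (f s) + m * c - D.pos (f s) = m * (c - D.pos (f s)) by ring, abs_mul,
      abs_of_nonneg h3]
    exact (mul_le_of_le_one_left (abs_nonneg _) h4).trans h5
  · rw [sub_self, abs_zero]
    linarith

end

end MergeStep

/-! ### Arrangements of loops in the attached spaces -/

section MergeHomotopy

variable {n : ℕ} [NeZero n] {Z : Type u} [TopologicalSpace Z] {K : Type w}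

/-- The maps `g` on `ℝ^n` with values in `W` that represent an `n`-loop at `z₀`: outside of the open
unit cube they are constant at `z₀`. -/
def LoopIn (z₀ : Z) (W : Set Z) (g : C(Fin n → ℝ, Z)) : Prop :=
  (∀ s, s ∉ (treeBox 0 0 : Box n).inner → g s = z₀) ∧ ∀ s, g s ∈ W

theorem homotopicWith_of {P : C(Fin n → ℝ, Z) → Prop} {G : (Fin n → ℝ) × I → Z} (hG : Continuous G)
    {g₀ g₁ : C(Fin n → ℝ, Z)} (h0 : ∀ s, G (s, 0) = g₀ s) (h1 : ∀ s, G (s, 1) = g₁ s)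
    (hP : ∀ t, P ⟨fun s => G (s, t), hG.comp (by fun_prop)⟩) :
    ContinuousMap.HomotopicWith g₀ g₁ P :=
  ⟨{ toFun := fun x => G (x.2, x.1)
     continuous_toFun := hG.comp (by fun_prop)
     map_zero_left := h0
     map_one_left := h1
     prop' := hP }⟩

variable {D : ArcDecomposition Z K}

theorem ArcDecomposition.glue_mem_of_range {T : Type*} {f : T → Z} {W : Set Z}
    (hW : ∀ p, D.arc p ∈ W) (hf : ∀ s, f s ∈ W) {p : ℝ} {z : K → Z}
    (hz : ∀ k, ∃ s, z k = D.proj k (f s)) : D.glue p z ∈ W := by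
  refine ArcDecomposition.glue_mem hW fun k hk => ?_
  obtain ⟨s, hs⟩ := hz k
  rw [hs] at hk ⊢
  rw [ArcDecomposition.eq_proj hk]
  exact hf s

/-- The position on the arc of an arrangement of loops in the attached spaces. -/
noncomputable def arrangeCore (y₀ : ℝ) (q : ℝ → ℝ) (s : Fin n → ℝ) : ℝ :=
  (1 - bump s) * y₀ + bump s * q (s (splitAxis n 1))

/-- The arrangement of the loops `z k` in the attached spaces to one loop: `z k` is placed in the
cube `[a k, b k]^n`. -/
noncomputable def arrange (D : ArcDecomposition Z K) (y₀ : ℝ) (a b : K → ℝ) (q : ℝ → ℝ)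
    (z : K → (Fin n → ℝ) → Z) (s : Fin n → ℝ) : Z :=
  D.glue (arrangeCore y₀ q s) fun k => z k fun i => stretch (a k) (b k) (s i)

/-- A family of loops in the attached spaces. -/
structure LoopFamily (D : ArcDecomposition Z K) (z : K → (Fin n → ℝ) → Z) : Prop where
  cont : ∀ k, Continuous (z k)
  proj : ∀ k s, D.proj k (z k s) = z k s
  out : ∀ k s, s ∉ (treeBox 0 0 : Box n).inner → z k s = D.pt k

variable {y₀ : ℝ} {a b : K → ℝ} {q : ℝ → ℝ} {z : K → (Fin n → ℝ) → Z}

theorem stretch_notMem {a b : ℝ} (hab : a < b) (ha : 1 / 3 ≤ a) (hb : b ≤ 2 / 3) {s : Fin n → ℝ}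
    (hs : s ∉ (treeBox 0 0 : Box n).inner) :
    (fun i => stretch a b (s i)) ∉ (treeBox 0 0 : Box n).inner := by
  rw [mem_inner_unitBox] at hs ⊢
  refine fun hcon => hs fun i => ?_
  have h1 := lt_of_stretch_pos hab (hcon i).1
  have h2 := lt_of_stretch_lt_one hab (hcon i).2
  constructor <;> linarith

section

variable (hz : LoopFamily D z) (hq : Plateaus D.base a b q) (hy : y₀ ∈ I)

include hq

include hz in
/-- An arrangement is in the space with index `k` only over the interval `(a k, b k)`. -/
theorem LoopFamily.mem_Ioo {k : K} {s : Fin n → ℝ}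
    (hs : z k (fun i => stretch (a k) (b k) (s i)) ≠ D.pt k) (i : Fin n) :
    s i ∈ Set.Ioo (a k) (b k) := by
  have h1 : (fun i => stretch (a k) (b k) (s i)) ∈ (treeBox 0 0 : Box n).inner := by
    by_contra hcon
    exact hs (hz.out k _ hcon)
  rw [mem_inner_unitBox] at h1
  exact ⟨lt_of_stretch_pos (hq.lt k) (h1 i).1, lt_of_stretch_lt_one (hq.lt k) (h1 i).2⟩

theorem arrangeCore_eq {k : K} {s : Fin n → ℝ} (hs : ∀ i, s i ∈ Set.Ioo (a k) (b k)) :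
    arrangeCore y₀ q s = D.base k := by
  have h1 := hq.ge k
  have h2 := hq.le k
  rw [arrangeCore, hq.const k _ (Set.Ioo_subset_Icc_self (hs _)), bump_eq_one]
  · ring
  · intro i
    have := hs i
    constructor <;> linarith [this.1, this.2]

theorem continuous_arrangeCore : Continuous (arrangeCore (n := n) y₀ q) := by
  have h1 := continuous_bump (n := n)
  have h2 := hq.cont
  unfold arrangeCore
  fun_prop

include hy in
theorem arrangeCore_mem (s : Fin n → ℝ) : arrangeCore y₀ q s ∈ I :=
  convex_Icc (0 : ℝ) 1 hy (hq.mem _) (by linarith [bump_le_one s]) (bump_nonneg _) (by ring)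

include hz hy in
theorem valid_arrange (s : Fin n → ℝ) : D.Valid (arrangeCore y₀ q s)
    fun k => z k fun i => stretch (a k) (b k) (s i) where
  mem := arrangeCore_mem hq hy s
  proj := fun k => hz.proj k _
  base := fun k hk => arrangeCore_eq hq (hz.mem_Ioo hq hk)
  eq_pt := fun k hk l hl => by
    by_contra hcon
    exact hl (hq.eq_of_mem (hz.mem_Ioo hq hcon 0) (hz.mem_Ioo hq hk 0))

include hz hy in
theorem proj_arrange (k : K) (s : Fin n → ℝ) : D.proj k (arrange D y₀ a b q z s) =
    z k fun i => stretch (a k) (b k) (s i) :=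
  (valid_arrange hz hq hy s).proj_glue k

omit hq in
theorem arrangeCore_out {s : Fin n → ℝ} (hs : s ∉ (treeBox 0 0 : Box n).inner) :
    arrangeCore y₀ q s = y₀ := by
  rw [mem_inner_unitBox] at hs
  push Not at hs
  obtain ⟨r, hr⟩ := hs
  rw [arrangeCore, bump_eq_zero (r := r) (by
    by_cases h0 : 0 < s r
    · exact Or.inr (hr h0)
    · exact Or.inl (not_lt.1 h0))]
  ring

include hz in
theorem arrange_out {s : Fin n → ℝ} (hs : s ∉ (treeBox 0 0 : Box n).inner) :
    arrange D y₀ a b q z s = D.arc y₀ := by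
  rw [arrange, ArcDecomposition.glue_of_forall, arrangeCore_out hs]
  exact fun k => hz.out k _ (stretch_notMem (hq.lt k) (hq.ge k) (hq.le k) hs)

include hy in
/-- The arrangement depends continuously on the loops. -/
theorem continuous_arrange_family {T : Type*} [TopologicalSpace T]
    {z : K → (Fin n → ℝ) × T → Z} (hz : ∀ t, LoopFamily D fun k s => z k (s, t))
    (hc : ∀ k, Continuous (z k)) :
    Continuous fun x : (Fin n → ℝ) × T => arrange D y₀ a b q (fun k s => z k (s, x.2)) x.1 := by
  refine ArcDecomposition.continuous_glue (D := D) (p := fun x : (Fin n → ℝ) × T =>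
    arrangeCore y₀ q x.1) (z := fun k x => z k (fun i => stretch (a k) (b k) (x.1 i), x.2))
    (fun x => valid_arrange (hz x.2) hq hy x.1)
    ((continuous_arrangeCore hq).comp continuous_fst) fun k => (hc k).comp ?_
  have := continuous_stretch (a k) (b k)
  fun_prop

include hz hy in
theorem continuous_arrange : Continuous (arrange D y₀ a b q z) := by
  have h1 := continuous_arrange_family (T := I) hq hy (z := fun k x => z k x.1) (fun _ => hz)
    fun k => (hz.cont k).comp continuous_fst
  have h2 : Continuous fun s : Fin n → ℝ => (s, (0 : I)) := by fun_prop
  exact h1.comp h2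

end

section

variable {cubes : K → Set (ℕ × (Fin n → ℤ))} {f : (Fin n → ℝ) → Z}
  {F : K → (Fin n → ℝ) → Z}

theorem TreeFactored.loopFamily (h : TreeFactored D y₀ cubes f) :
    LoopFamily D fun k s => D.proj k (f s) where
  cont := fun k => (D.continuous_proj k).comp h.cont
  proj := fun k s => D.proj_proj k _
  out := fun k s hs => by rw [h.out s hs, D.proj_arc]; rfl

variable (h : TreeFactored D y₀ cubes f) (hq : Plateaus D.base a b q)
  (hF : IsShrunk D cubes f a b F)

include h

theorem TreeFactored.inner_subset {k : K} {c : ℕ × (Fin n → ℤ)} (hc : c ∈ cubes k) :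
    (treeBox c.1 c.2).inner ⊆ (treeBox 0 0).inner :=
  Box.inner_subset_inner (h.unit k c hc)

include hF

theorem shrunk_out (k : K) {s : Fin n → ℝ} (hs : s ∉ (treeBox 0 0 : Box n).inner) :
    F k s = D.pt k := by
  by_contra hne
  obtain ⟨c, hc, hsc⟩ := hF.inner k s hne
  exact hs (h.inner_subset hc hsc)

theorem valid_shrunk (s : Fin n → ℝ) : D.Valid (D.pos (f s)) fun k => F k s where
  mem := D.pos_mem _
  proj := fun k => by
    obtain ⟨s', hs'⟩ := hF.range k s
    simp only [hs', D.proj_proj]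
  base := fun k hk => pos_of_shrunk_ne h hF hk
  eq_pt := fun k hk l hl => by
    by_contra hcon
    obtain ⟨c, hc, hsc⟩ := hF.inner k s hk
    obtain ⟨c', hc', hsc'⟩ := hF.inner l s hcon
    exact hl (h.index_eq hc hc' (Box.inner_subset _ hsc) hsc').symm

omit hF in
theorem levelCore_out (d : ℕ) {s : Fin n → ℝ} (hs : s ∉ (treeBox 0 0 : Box n).inner) :
    levelCore D cubes f q d s = y₀ := by
  have h0 : D.pos (f s) = y₀ := by rw [h.out s hs, D.pos_arc _ h.mem]
  by_cases h1 : IsSplit cubes d (treeIndex d s)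
  · rw [levelCore, cellCore_eq_pos (mem_treeIndex d s)
      fun h2 => hs (Box.inner_subset_inner h1.1 h2), h0]
  · rw [levelCore, cellCore, if_neg h1, h0]

include hq in
theorem stepContent_out (d : ℕ) (k : K) {s : Fin n → ℝ}
    (hs : s ∉ (treeBox 0 0 : Box n).inner) (t : I) :
    stepContent D cubes f a b F d k (s, t) = D.pt k := by
  by_cases h1 : IsSplit cubes d (treeIndex d s)
  · exact cellContent_eq_pt h hq h1 k (mem_treeIndex d s)
      (fun h2 => hs (Box.inner_subset_inner h1.1 h2)) t
  · rw [stepContent, cellContent, if_neg h1, shrunk_out h hF k hs]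

include hq in
theorem stepContent_zero (k : K) (s : Fin n → ℝ) :
    stepContent D cubes f a b F 0 k (s, 1) =
      D.proj k (f fun i => stretch (a k) (b k) (s i)) := by
  by_cases hs : s ∈ (treeBox 0 0 : Box n).inner
  · rw [stepContent_eq h hq hF k (Box.inner_subset _ hs)]
    by_cases h1 : IsSplit cubes 0 0
    · rw [cellContent, if_pos h1, Set.Icc.coe_one,
        show clamp (2 * 1 - 1) = 1 from clamp_of_one_le (by norm_num), blend_one, embed_zero,
        normalize_zero]
    · have h2 : ∃ l, ∃ c ∈ cubes l, c.1 ≤ 0 ∧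
          (treeBox 0 0).carrier ⊆ (treeBox c.1 c.2).carrier := by
        by_contra hcon
        push Not at hcon
        exact h1 ⟨subset_rfl, hcon⟩
      obtain ⟨l, ⟨d, j⟩, hc, hd, hcs⟩ := h2
      obtain rfl : d = 0 := Nat.le_zero.1 hd
      obtain rfl : j = 0 := by
        refine treeBox_index_eq (d := 0) ?_
        rw [Set.inter_eq_right.2 (Box.inner_subset_inner hcs)]
        exact Box.inner_nonempty _
      rw [cellContent, if_neg h1]
      have h3 := hF.leaf k l _ hc s (Box.inner_subset _ hs)
      rwa [embed_zero, normalize_zero] at h3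
  · rw [stepContent_out h hq hF 0 k hs,
      h.out _ (stretch_notMem (hq.lt k) (hq.ge k) (hq.le k) hs), D.proj_arc]
    rfl

open Filter in
omit hF in
/-- The position during the steps at large depths converges to the original position, because it is
changed by at most twice the oscillation on the boxes of that depth. -/
theorem tendsto_stepCore (s : Fin n → ℝ) :
    Tendsto (fun p : ℕ × (Fin n → ℝ) × I => stepCore D cubes f q p.1 p.2)
      (atTop ×ˢ (𝓝 s ×ˢ ⊤)) (𝓝 (D.pos (f s))) := by
  let L : Filter (ℕ × (Fin n → ℝ) × I) := atTop ×ˢ (𝓝 s ×ˢ ⊤)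
  have hd : Tendsto (fun p : ℕ × (Fin n → ℝ) × I => p.1) L atTop := tendsto_fst
  have hs : Tendsto (fun p : ℕ × (Fin n → ℝ) × I => p.2.1) L (𝓝 s) := tendsto_fst.comp tendsto_snd
  have hpos : Continuous fun s => D.pos (f s) := D.continuous_pos.comp h.cont
  have h1 : Tendsto (treeOsc fun s => D.pos (f s)) atTop (𝓝 0) :=
    tendsto_treeOsc (uniformContinuous_of_const hpos (c := D.pos (D.arc y₀))
      fun s hs => by rw [h.out s hs])
  have h2 : Tendsto (fun p : ℕ × (Fin n → ℝ) × I =>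
      2 * treeOsc (fun s => D.pos (f s)) (p.1 + 1) + 2 * treeOsc (fun s => D.pos (f s)) p.1)
      L (𝓝 0) := by
    have h3 := ((h1.comp ((tendsto_add_atTop_nat 1).comp hd)).const_mul 2).add
      ((h1.comp hd).const_mul 2)
    simpa using h3
  have h4 : Tendsto (fun p : ℕ × (Fin n → ℝ) × I =>
      stepCore D cubes f q p.1 p.2 - D.pos (f p.2.1)) L (𝓝 0) := by
    refine squeeze_zero_norm (fun p => ?_) h2
    have h5 := abs_levelCore_sub_le (D := D) (cubes := cubes) (f := f) (q := q) (p.1 + 1) p.2.1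
    have h6 := abs_levelCore_sub_le (D := D) (cubes := cubes) (f := f) (q := q) p.1 p.2.1
    have h7 := clamp_nonneg (2 * (p.2.2 : ℝ))
    have h8 := clamp_le_one (2 * (p.2.2 : ℝ))
    rw [Real.norm_eq_abs, stepCore]
    set w := clamp (2 * (p.2.2 : ℝ))
    rw [show (1 - w) * levelCore D cubes f q (p.1 + 1) p.2.1 + w * levelCore D cubes f q p.1 p.2.1
      - D.pos (f p.2.1) = (1 - w) * (levelCore D cubes f q (p.1 + 1) p.2.1 - D.pos (f p.2.1)) +
      w * (levelCore D cubes f q p.1 p.2.1 - D.pos (f p.2.1)) by ring]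
    refine (abs_add_le _ _).trans ?_
    rw [abs_mul, abs_mul, abs_of_nonneg h7, abs_of_nonneg (by linarith : 0 ≤ 1 - w)]
    exact add_le_add ((mul_le_of_le_one_left (abs_nonneg _) (by linarith)).trans h5)
      ((mul_le_of_le_one_left (abs_nonneg _) h8).trans h6)
  have h9 := h4.add ((hpos.tendsto s).comp hs)
  simpa using h9

open Filter in
/-- The contents during the steps at large depths converge to the shrunk contents. At a point of the
open cube `c`, nothing is moved at depths from that of `c` on. At a point where the content is
trivial, only finitely many cubes have contents that leave a given neighbourhood of the base point,
and a box of larger depth that meets the interior of one of these is contained in it, hence not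
split. -/
theorem tendsto_stepContent (k : K) (s : Fin n → ℝ) :
    Tendsto (fun p : ℕ × (Fin n → ℝ) × I => stepContent D cubes f a b F p.1 k p.2)
      (atTop ×ˢ (𝓝 s ×ˢ ⊤)) (𝓝 (F k s)) := by
  let L : Filter (ℕ × (Fin n → ℝ) × I) := atTop ×ˢ (𝓝 s ×ˢ ⊤)
  have hd : Tendsto (fun p : ℕ × (Fin n → ℝ) × I => p.1) L atTop := tendsto_fst
  have hs : Tendsto (fun p : ℕ × (Fin n → ℝ) × I => p.2.1) L (𝓝 s) := tendsto_fst.comp tendsto_snd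
  intro V hV
  have hFV : ∀ᶠ p in L, F k p.2.1 ∈ V :=
    hs.eventually ((hF.cont k).continuousAt.eventually_mem hV)
  refine mem_map.2 ?_
  by_cases hFs : F k s = D.pt k
  · rw [hFs] at hV
    obtain ⟨d₀, hd₀⟩ := (((h.boxSupported k).finite hV).image fun c => c.1.1).bddAbove
    filter_upwards [hFV, hd.eventually (eventually_ge_atTop d₀)] with p hp hpd
    change cellContent D cubes f a b F p.1 k (treeIndex p.1 p.2.1) p.2 ∈ V
    unfold cellContent
    split_ifs with hj
    · by_contra hcon
      have hpt : ∀ z : Z, z ∉ V → z ≠ D.pt k := fun z hz h1 => hz (h1 ▸ mem_of_mem_nhds hV)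
      obtain ⟨c, hc, hsc⟩ := h.exists_inner (hpt _ hcon)
      have h1 : c.1 ≤ d₀ := hd₀ ⟨⟨c, hc⟩, ⟨_, Box.inner_subset _ hsc, hcon⟩, rfl⟩
      refine hj.2 k c hc (h1.trans hpd) (treeBox_subset (h1.trans hpd) ?_)
      exact Box.inter_inner_nonempty (Box.isOpen_inner _)
        (embed_mem (blend_mem _ _ _ (clamp_mem _) _)) hsc
    · exact hp
  · obtain ⟨c, hc, hsc⟩ := hF.inner k s hFs
    filter_upwards [hFV, hd.eventually (eventually_ge_atTop c.1),
      hs.eventually ((Box.isOpen_inner _).mem_nhds hsc)] with p hp hpd hpc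
    change cellContent D cubes f a b F p.1 k (treeIndex p.1 p.2.1) p.2 ∈ V
    unfold cellContent
    rw [if_neg]
    · exact hp
    · intro hj
      exact hj.2 k c hc hpd (treeBox_subset hpd
        (Box.inter_inner_nonempty (Box.isOpen_inner _) (mem_treeIndex p.1 p.2.1) hpc))

open Filter in
include hq in
/-- The steps of the merging at large depths are close to the map with which their infinite
concatenation starts. -/
theorem eventually_step_mem (hn : 2 ≤ n) (s : Fin n → ℝ) {V : Set Z}
    (hV : V ∈ 𝓝 (D.glue (D.pos (f s)) fun k => F k s)) :
    ∃ N ∈ 𝓝 s, ∃ d₀, ∀ d ≥ d₀, ∀ s' ∈ N, ∀ t : I,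
      D.glue (stepCore D cubes f q d (s', t))
        (fun k => stepContent D cubes f a b F d k (s', t)) ∈ V := by
  let G : ℕ × (Fin n → ℝ) × I → Z := fun p => D.glue (stepCore D cubes f q p.1 p.2)
    fun k => stepContent D cubes f a b F p.1 k p.2
  have key : map G (atTop ×ˢ (𝓝 s ×ˢ ⊤)) ≤ 𝓝 (D.glue (D.pos (f s)) fun k => F k s) := by
    refine D.le_nhds _ _ (tendsto_map'_iff.2 ?_) fun k => tendsto_map'_iff.2 ?_
    · simp only [Function.comp_def, G, (valid_step h hq hF hn _ _).pos_glue,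
        (valid_shrunk h hF s).pos_glue]
      exact tendsto_stepCore h s
    · simp only [Function.comp_def, G, (valid_step h hq hF hn _ _).proj_glue,
        (valid_shrunk h hF s).proj_glue]
      exact tendsto_stepContent h hF k s
  have hev : ∀ᶠ p in (atTop : Filter ℕ) ×ˢ (𝓝 s ×ˢ (⊤ : Filter I)), G p ∈ V := key hV
  obtain ⟨A, hA, B, hB, hAB⟩ := eventually_prod_iff.1 hev
  obtain ⟨d₀, hd₀⟩ := eventually_atTop.1 hA
  refine ⟨_, mem_prod_top.1 hB, d₀, fun d hd s' hs' t => ?_⟩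
  have hmem := hAB (hd₀ d hd) (hs' t)
  simpa only [G] using hmem

end

/-- A loop that is factored with boxes of the tree is homotopic to the arrangement of its
components in the attached spaces. -/
theorem TreeFactored.homotopicWith_arrange {cubes : K → Set (ℕ × (Fin n → ℤ))} {f : (Fin n → ℝ) → Z}
    (h : TreeFactored D y₀ cubes f) (hq : Plateaus D.base a b q) (hn : 2 ≤ n) {W : Set Z}
    (hW : ∀ p, D.arc p ∈ W) (hf : ∀ s, f s ∈ W) :
    ContinuousMap.HomotopicWith (⟨f, h.cont⟩ : C(Fin n → ℝ, Z))
      ⟨arrange D y₀ a b q fun k s => D.proj k (f s), continuous_arrange h.loopFamily hq h.mem⟩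
      (LoopIn (D.arc y₀) W) := by
  choose F hFc hF0 hFr hFi hF1 using h.exists_shrink a b hq
  have hS : ∀ t s, D.Valid (D.pos (f s)) fun k => F k (s, t) := fun t s =>
    { mem := D.pos_mem _
      proj := fun k => by
        obtain ⟨s', hs'⟩ := hFr k s t
        simp only [hs', D.proj_proj]
      base := fun k hk => by
        obtain ⟨c, hc, hsc⟩ := hFi k s t hk
        exact ArcDecomposition.pos_of_proj_eq (h.mapsTo k c hc s (Box.inner_subset _ hsc))
      eq_pt := fun k hk l hl => by
        by_contra hcon
        obtain ⟨c, hc, hsc⟩ := hFi k s t hk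
        obtain ⟨c', hc', hsc'⟩ := hFi l s t hcon
        exact hl (h.index_eq hc hc' (Box.inner_subset _ hsc) hsc').symm }
  have hF : IsShrunk D cubes f a b fun k s => F k (s, 1) :=
    { cont := fun k => (hFc k).comp (by fun_prop)
      range := fun k s => hFr k s 1
      inner := fun k s hs => hFi k s 1 hs
      leaf := fun k l c hc s hs => hF1 k l c hc s hs }
  have hpos : Continuous fun s => D.pos (f s) := D.continuous_pos.comp h.cont
  have hc1 : Continuous fun x : (Fin n → ℝ) × I => D.glue (D.pos (f x.1)) fun k => F k x :=
    ArcDecomposition.continuous_glue (fun x => hS x.2 x.1) (hpos.comp continuous_fst) hFc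
  have hcs : ∀ d, Continuous fun x : (Fin n → ℝ) × I => D.glue (stepCore D cubes f q d x)
      fun k => stepContent D cubes f a b (fun k s => F k (s, 1)) d k x := fun d =>
    ArcDecomposition.continuous_glue (valid_step h hq hF hn d) (continuous_stepCore h hq d)
      (continuous_stepContent h hq hF d)
  have hs1 : Continuous fun s : Fin n → ℝ => (s, (1 : I)) := by fun_prop
  have hout : ∀ d s, s ∉ (treeBox 0 0 : Box n).inner → ∀ t : I,
      D.glue (stepCore D cubes f q d (s, t))
        (fun k => stepContent D cubes f a b (fun k s => F k (s, 1)) d k (s, t)) = D.arc y₀ := by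
    intro d s hs t
    rw [ArcDecomposition.glue_of_forall fun k => stepContent_out h hq hF d k hs t, stepCore,
      levelCore_out h _ hs, levelCore_out h _ hs, ← add_mul, sub_add_cancel, one_mul]
  have hout1 : ∀ s, s ∉ (treeBox 0 0 : Box n).inner → ∀ t : I,
      D.glue (D.pos (f s)) (fun k => F k (s, t)) = D.arc y₀ := by
    intro s hs t
    rw [ArcDecomposition.glue_of_forall, h.out s hs, D.pos_arc _ h.mem]
    intro k
    by_contra hne
    obtain ⟨c, hc, hsc⟩ := hFi k s t hne
    exact hs (h.inner_subset hc hsc)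
  -- First, the contents are shrunk to the plateaus of their cubes.
  have H1 : ContinuousMap.HomotopicWith (⟨f, h.cont⟩ : C(Fin n → ℝ, Z))
      ⟨_, hc1.comp hs1⟩ (LoopIn (D.arc y₀) W) := by
    refine homotopicWith_of hc1 (fun s => ?_) (fun s => rfl) fun t => ⟨fun s hs => ?_, fun s => ?_⟩
    · simp only [hF0]
      exact ArcDecomposition.glue_coord (f s)
    · exact hout1 s hs t
    · exact ArcDecomposition.glue_mem_of_range hW hf fun k => hFr k s t
  -- Then, the contents are merged along the tree, from infinite depth to depth `0`.
  have H2 : ContinuousMap.HomotopicWith (⟨_, hc1.comp hs1⟩ : C(Fin n → ℝ, Z))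
      ⟨_, (hcs 0).comp hs1⟩ (LoopIn (D.arc y₀) W) := by
    have hstep : ∀ d s, D.glue (stepCore D cubes f q d (s, 0))
        (fun k => stepContent D cubes f a b (fun k s => F k (s, 1)) d k (s, 0)) =
        D.glue (stepCore D cubes f q (d + 1) (s, 1))
        fun k => stepContent D cubes f a b (fun k s => F k (s, 1)) (d + 1) k (s, 1) := by
      intro d s
      congr 1
      · simp only [stepCore, Set.Icc.coe_zero, Set.Icc.coe_one]
        rw [clamp_of_nonpos (by norm_num), clamp_of_one_le (by norm_num)]
        ring
      · funext k
        exact stepContent_of_le h hq hF d k s (by norm_num)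
    obtain ⟨G, hG, hG0, hG1, hGr⟩ := exists_infinite_concatenation hcs hstep
      (hc1.comp hs1) fun s V hV => eventually_step_mem h hq hF hn s hV
    refine homotopicWith_of hG hG0 hG1 fun t => ⟨fun s hs => ?_, fun s => ?_⟩
    · rcases hGr s t with h1 | ⟨d, t', h1⟩
      · exact h1.trans (hout1 s hs 1)
      · exact h1.trans (hout d s hs t')
    · change G (s, t) ∈ W
      rcases hGr s t with h1 | ⟨d, t', h1⟩
      · rw [h1]
        exact ArcDecomposition.glue_mem_of_range hW hf fun k => hFr k s 1
      · rw [h1]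
        exact ArcDecomposition.glue_mem_of_range hW hf fun k => exists_stepContent_eq hF d k _
  -- The contents are arranged now; it remains to move the position on the arc, linearly.
  have hv3 : ∀ x : (Fin n → ℝ) × I, D.Valid
      ((1 - x.2) * stepCore D cubes f q 0 (x.1, 1) + x.2 * arrangeCore y₀ q x.1)
      fun k => D.proj k (f fun i => stretch (a k) (b k) (x.1 i)) := by
    intro x
    have h1 := valid_step h hq hF hn 0 (x.1, 1)
    have h2 := valid_arrange h.loopFamily hq h.mem x.1
    simp only [stepContent_zero h hq hF] at h1
    exact
      { mem := convex_Icc (0 : ℝ) 1 h1.mem h2.mem (by linarith [x.2.2.2]) x.2.2.1 (by ring)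
        proj := h1.proj
        base := fun k hk => by
          rw [h1.base k hk, h2.base k hk]
          ring
        eq_pt := h1.eq_pt }
  have hc3 := ArcDecomposition.continuous_glue hv3
    (by
      have h1 : Continuous fun s => stepCore D cubes f q 0 (s, 1) :=
        (continuous_stepCore h hq 0).comp hs1
      have h2 := (continuous_arrangeCore (n := n) (y₀ := y₀) hq).comp
        (continuous_fst (X := Fin n → ℝ) (Y := I))
      have h3 := h1.comp (continuous_fst (X := Fin n → ℝ) (Y := I))
      have h4 : Continuous fun x : (Fin n → ℝ) × I => (x.2 : ℝ) := by fun_prop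
      exact ((continuous_const.sub h4).mul h3).add (h4.mul h2))
    fun k => (D.continuous_proj k).comp (h.cont.comp (by
      have := continuous_stretch (a k) (b k)
      fun_prop))
  refine (H1.trans H2).trans (homotopicWith_of hc3 (fun s => ?_) (fun s => ?_) fun t =>
    ⟨fun s hs => ?_, fun s => ?_⟩)
  · simp only [Set.Icc.coe_zero, sub_zero, one_mul, zero_mul, add_zero]
    change _ = D.glue _ _
    simp only [stepContent_zero h hq hF]
  · simp only [Set.Icc.coe_one, sub_self, one_mul, zero_mul, zero_add]
    rfl
  · change D.glue _ _ = _
    rw [ArcDecomposition.glue_of_forall, arrangeCore_out hs, stepCore, levelCore_out h _ hs,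
      levelCore_out h _ hs]
    · congr 1
      ring
    · exact fun k => h.loopFamily.out k _ (stretch_notMem (hq.lt k) (hq.ge k) (hq.le k) hs)
  · exact ArcDecomposition.glue_mem_of_range hW hf fun k => ⟨_, rfl⟩

end MergeHomotopy

/-! ### The decomposition of the iterated space over an arc -/

section Iterated

variable {A : ℕ → Type u} [∀ j, TopologicalSpace (A j)] {x : ℕ → I} {a : ∀ j, A j}
  {B : ℕ → Type v} [∀ i, TopologicalSpace (B i)] {y : ℕ → Adj x a} {b : ∀ i, B i}

theorem mem_range_core_or (p : Adj x a) :
    p ∈ Set.range (core x a) ∨ ∃ j, retraction x a j p ≠ a j := by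
  by_cases h : ∃ j, retraction x a j p ≠ a j
  · exact Or.inr h
  · push Not at h
    exact Or.inl ⟨_, (Adj.eq_core h).symm⟩

theorem retraction_of_mem_range {p : Adj x a} (hp : p ∈ Set.range (core x a)) (j : ℕ) :
    retraction x a j p = a j := by
  obtain ⟨t, rfl⟩ := hp
  rfl

theorem core_coreRetraction {p : Adj x a} (hp : p ∈ Set.range (core x a)) :
    core x a (coreRetraction x a p) = p := by
  obtain ⟨t, rfl⟩ := hp
  rfl

variable (x a y b)

open Classical in
/-- The retraction of the iterated space onto `A j` together with the spaces that are attached to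
`A j` away from its base point. -/
noncomputable def starRetraction (j : ℕ) (z : Adj y b) : Adj y b :=
  Adj.mk y b (attach x a j (retraction x a j (coreRetraction y b z))) fun i =>
    if retraction x a j (y i) ≠ a j then retraction y b i z else b i

variable {x a y b}

theorem eq_of_retraction_ne {z : Adj y b} {i : ℕ} (h : retraction y b i z ≠ b i) :
    coreRetraction y b z = y i := (Adj.fib_of_ne h).1

open Classical in
theorem valid_starRetraction (j : ℕ) (z : Adj y b) :
    Adj.Valid y b (attach x a j (retraction x a j (coreRetraction y b z))) fun i =>
      if retraction x a j (y i) ≠ a j then retraction y b i z else b i := by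
  intro i hi
  simp only at hi
  split_ifs at hi with h
  · obtain ⟨h1, h2⟩ := Adj.fib_of_ne hi
    rw [h1]
    refine ⟨(Adj.eq_attach h).symm, fun i' hi' => ?_⟩
    simp only
    split_ifs
    · exact h2 i' hi'
    · rfl
  · exact absurd rfl hi

@[simp] theorem coreRetraction_starRetraction (j : ℕ) (z : Adj y b) :
    coreRetraction y b (starRetraction x a y b j z) =
      attach x a j (retraction x a j (coreRetraction y b z)) :=
  (valid_starRetraction j z).coreRetraction_mk

open Classical in
theorem retraction_starRetraction (j : ℕ) (z : Adj y b) (i : ℕ) :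
    retraction y b i (starRetraction x a y b j z) =
      if retraction x a j (y i) ≠ a j then retraction y b i z else b i :=
  (valid_starRetraction j z).retraction_mk i

theorem retraction_starRetraction_of_ne {j i : ℕ} (h : retraction x a j (y i) ≠ a j) (z : Adj y b) :
    retraction y b i (starRetraction x a y b j z) = retraction y b i z := by
  classical
  rw [retraction_starRetraction, if_pos h]

theorem retraction_starRetraction_of_eq {j i : ℕ} (h : retraction x a j (y i) = a j) (z : Adj y b) :
    retraction y b i (starRetraction x a y b j z) = b i := by
  classical
  rw [retraction_starRetraction, if_neg (not_not.2 h)]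

theorem continuous_starRetraction (j : ℕ) : Continuous (starRetraction x a y b j) := by
  classical
  refine Adj.continuous_mk (fun z => valid_starRetraction j z) ?_ fun i => ?_
  · exact (continuous_attach j).comp
      ((retraction x a j).continuous.comp (coreRetraction y b).continuous)
  · split_ifs
    · exact (retraction y b i).continuous
    · exact continuous_const

theorem eq_core_or (z : Adj y b) :
    z = core y b (coreRetraction y b z) ∨ ∃ i, retraction y b i z ≠ b i := by
  by_cases h : ∃ i, retraction y b i z ≠ b i
  · exact Or.inr h
  · push Not at h
    exact Or.inl (Adj.eq_core h)

/-- A point is fixed by the retraction as soon as one of its coordinates for `A j` or for a space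
attached to `A j` away from the base point is not trivial. -/
theorem starRetraction_of_ne {j : ℕ} {z : Adj y b}
    (h : retraction x a j (coreRetraction y b z) ≠ a j) : starRetraction x a y b j z = z := by
  refine Adj.ext_coord ?_ fun i => ?_
  · rw [coreRetraction_starRetraction]
    exact (Adj.eq_attach h).symm
  · by_cases hi : retraction x a j (y i) = a j
    · rw [retraction_starRetraction_of_eq hi]
      by_contra hne
      rw [eq_of_retraction_ne (Ne.symm hne)] at h
      exact h hi
    · rw [retraction_starRetraction_of_ne hi]

/-- The retraction to the star of `A j` is trivial where the component in `A j` is. -/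
theorem starRetraction_core_of_eq {j : ℕ} {z : Adj y b}
    (h : retraction x a j (coreRetraction y b z) = a j) :
    starRetraction x a y b j z = core y b (core x a (x j)) := by
  refine Adj.ext_coord ?_ fun i => ?_
  · rw [coreRetraction_starRetraction, h, attach_base, coreRetraction_core]
  · rw [retraction_core]
    by_cases hi : retraction x a j (y i) = a j
    · exact retraction_starRetraction_of_eq hi z
    · rw [retraction_starRetraction_of_ne hi]
      by_contra hne
      rw [eq_of_retraction_ne hne] at h
      exact hi h

variable (x a y b)

/-- The decomposition of the iterated space into the arc, the spaces attached to the arc, and the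
spaces `A j` together with what is attached to them. -/
noncomputable def iterDecomposition :
    ArcDecomposition (Adj y b) ({i : ℕ // y i ∈ Set.range (core x a)} ⊕ ℕ) where
  base := Sum.elim (fun i => (coreRetraction x a (y i) : ℝ)) fun j => (x j : ℝ)
  arc := fun p => core y b (core x a (Set.projIcc 0 1 zero_le_one p))
  pos := fun z => (coreRetraction x a (coreRetraction y b z) : ℝ)
  proj := Sum.elim (fun i z => attach y b i (retraction y b i z)) (starRetraction x a y b)
  continuous_pos := continuous_subtype_val.comp
    ((coreRetraction x a).continuous.comp (coreRetraction y b).continuous)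
  continuous_proj := by
    rintro (i | j)
    · exact (continuous_attach _).comp (retraction y b i).continuous
    · exact continuous_starRetraction j
  base_mem := by
    rintro (i | j)
    · exact (coreRetraction x a (y i)).2
    · exact (x j).2
  pos_mem := fun z => Subtype.coe_prop _
  pos_arc := fun p hp => by
    rw [coreRetraction_core, coreRetraction_core, Set.projIcc_of_mem _ hp]
  proj_arc := by
    rintro (⟨i, hi⟩ | j) p
    · simp only [Sum.elim_inl, retraction_core, attach_base, Set.projIcc_val]
      rw [core_coreRetraction hi]
    · simp only [Sum.elim_inr, Set.projIcc_val]
      exact starRetraction_core_of_eq (retraction_core x a j _)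
  proj_proj := by
    rintro (i | j) z
    · simp only [Sum.elim_inl, retraction_attach_self]
    · simp only [Sum.elim_inr]
      by_cases h : retraction x a j (coreRetraction y b z) = a j
      · rw [starRetraction_core_of_eq h]
        exact starRetraction_core_of_eq (retraction_core x a j _)
      · rw [starRetraction_of_ne h, starRetraction_of_ne h]
  proj_proj_of_ne := by
    rintro (i | j) (⟨i', hi'⟩ | j') z hne
    · simp only [Sum.elim_inl, Set.projIcc_val]
      have hne' : (i : ℕ) ≠ i' := fun h => hne (congrArg Sum.inl (Subtype.ext h.symm))
      rw [retraction_attach_of_ne y b hne', attach_base, core_coreRetraction hi']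
    · simp only [Sum.elim_inl, Sum.elim_inr, Set.projIcc_val]
      refine starRetraction_core_of_eq ?_
      rw [coreRetraction_attach, retraction_of_mem_range i.2]
    · simp only [Sum.elim_inl, Sum.elim_inr, Set.projIcc_val]
      rw [retraction_starRetraction_of_eq (retraction_of_mem_range hi' j), attach_base,
        core_coreRetraction hi']
    · simp only [Sum.elim_inr, Set.projIcc_val]
      refine starRetraction_core_of_eq ?_
      rw [coreRetraction_starRetraction]
      exact retraction_attach_of_ne x a (fun h => hne (congrArg Sum.inr h.symm)) _
  pos_proj := by
    rintro (i | j) z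
    · simp only [Sum.elim_inl, coreRetraction_attach]
    · simp only [Sum.elim_inr, coreRetraction_starRetraction, coreRetraction_attach]
  eq_or_eq := fun z => by
    rcases eq_core_or z with h | ⟨i, hi⟩
    · rcases mem_range_core_or (coreRetraction y b z) with h1 | ⟨j, hj⟩
      · left
        rw [Set.projIcc_val, core_coreRetraction h1]
        exact h
      · exact Or.inr ⟨Sum.inr j, starRetraction_of_ne hj⟩
    · right
      rcases mem_range_core_or (y i) with h1 | ⟨j, hj⟩
      · exact ⟨Sum.inl ⟨i, h1⟩, (Adj.eq_attach hi).symm⟩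
      · exact ⟨Sum.inr j, starRetraction_of_ne (by rwa [eq_of_retraction_ne hi])⟩
  le_nhds := fun z l hp hl => by
    have h0 : Filter.map (coreRetraction y b) l ≤ 𝓝 (coreRetraction y b z) := by
      refine Adj.le_nhds (Filter.tendsto_map'_iff.2 ?_) fun j => Filter.tendsto_map'_iff.2 ?_
      · exact tendsto_subtype_rng.2 hp
      · have h1 := (((retraction x a j).continuous.comp (coreRetraction y b).continuous).tendsto
          (starRetraction x a y b j z)).comp (hl (Sum.inr j))
        simpa only [Function.comp_def, Sum.elim_inr, coreRetraction_starRetraction,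
          retraction_attach_self] using h1
    refine Adj.le_nhds h0 fun i => ?_
    rcases mem_range_core_or (y i) with h1 | ⟨j, hj⟩
    · have h2 := ((retraction y b i).continuous.tendsto _).comp (hl (Sum.inl ⟨i, h1⟩))
      simpa only [Function.comp_def, Sum.elim_inl, retraction_attach_self] using h2
    · have h2 := ((retraction y b i).continuous.tendsto _).comp (hl (Sum.inr j))
      simpa only [Function.comp_def, Sum.elim_inr, retraction_starRetraction_of_ne hj] using h2

variable {x a y b}

theorem iterDecomposition_pt (k : {i : ℕ // y i ∈ Set.range (core x a)} ⊕ ℕ) :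
    (iterDecomposition x a y b).pt k = iterPt x a y b k := by
  rcases k with ⟨i, hi⟩ | j
  · change core y b (core x a (Set.projIcc 0 1 zero_le_one (coreRetraction x a (y i) : ℝ))) = _
    rw [Set.projIcc_val, core_coreRetraction hi]
    rfl
  · change core y b (core x a (Set.projIcc 0 1 zero_le_one (x j : ℝ))) = _
    rw [Set.projIcc_val]
    rfl

theorem iterDecomposition_proj_iff {k : {i : ℕ // y i ∈ Set.range (core x a)} ⊕ ℕ} {z : Adj y b} :
    (iterDecomposition x a y b).proj k z = z ↔ z ∈ iterSet x a y b k := by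
  rcases k with ⟨i, hi⟩ | j
  · exact mem_attachSet_iff_eq.symm
  · change starRetraction x a y b j z = z ↔ z ∈ starSet x a y b j
    constructor
    · intro h
      rcases eq_core_or z with h1 | ⟨i, hi⟩
      · refine Or.inl ⟨_, ?_, h1.symm⟩
        rw [← h, coreRetraction_starRetraction]
        exact ⟨_, rfl⟩
      · refine Or.inr (Set.mem_iUnion₂.2 ⟨i, ?_, mem_attachSet_iff_eq.2 (Adj.eq_attach hi).symm⟩)
        refine retraction_ne_iff.1 fun h1 => hi ?_
        rw [← h, retraction_starRetraction_of_eq h1]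
    · rintro (⟨p, hp, rfl⟩ | h)
      · by_cases h1 : retraction x a j p = a j
        · rw [starRetraction_core_of_eq (by rwa [coreRetraction_core]),
            ← mem_attachSet_iff_eq.1 hp, h1, attach_base]
        · exact starRetraction_of_ne (by rwa [coreRetraction_core])
      · obtain ⟨i, hi, t, rfl⟩ := Set.mem_iUnion₂.1 h
        exact starRetraction_of_ne (by rw [coreRetraction_attach]; exact retraction_ne_iff.2 hi)

/-- Every attached space `B i` lies in exactly one member of the decomposition, up to base
points. -/
theorem exists_iterIndex (i : ℕ) : ∃ k : {i : ℕ // y i ∈ Set.range (core x a)} ⊕ ℕ,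
    (∀ z ∈ attachSet y b i, (iterDecomposition x a y b).proj k z = z) ∧
    (∀ z, retraction y b i ((iterDecomposition x a y b).proj k z) = retraction y b i z) ∧
    ∀ l, l ≠ k → ∀ z, retraction y b i ((iterDecomposition x a y b).proj l z) = b i := by
  rcases mem_range_core_or (y i) with h | ⟨j, hj⟩
  · refine ⟨Sum.inl ⟨i, h⟩, fun z hz => mem_attachSet_iff_eq.1 hz,
      fun z => retraction_attach_self y b i _, ?_⟩
    rintro (⟨i', hi'⟩ | j) hl z
    · exact retraction_attach_of_ne y b (fun h' => hl (congrArg Sum.inl (Subtype.ext h'))) _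
    · exact retraction_starRetraction_of_eq (retraction_of_mem_range h j) z
  · refine ⟨Sum.inr j, ?_, retraction_starRetraction_of_ne hj, ?_⟩
    · rintro _ ⟨t, rfl⟩
      exact starRetraction_of_ne (by rwa [coreRetraction_attach])
    · rintro (⟨i', hi'⟩ | j') hl z
      · refine retraction_attach_of_ne y b (fun h' => ?_) _
        subst h'
        exact hj (retraction_of_mem_range hi' j)
      · exact retraction_starRetraction_of_eq
          ((Adj.fib_of_ne hj).2 j' fun h => hl (congrArg Sum.inr h)) z

end Iterated

/-! ### The top-dimensional cubes of the Whitney decomposition -/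

section WhitneyCubes

variable {n : ℕ} [NeZero n]

theorem treeBox_mul_lo (m : ℕ) (l : Fin n → ℤ) {s : Fin n → ℝ} :
    s ∈ (treeBox (n * m) l).carrier ↔ ∀ r, (l r : ℝ) ≤ 2 ^ m * s r ∧ 2 ^ m * s r ≤ l r + 1 := by
  rw [mem_treeBox]
  refine forall_congr' fun r => ?_
  simp only [normalize, treeScale_mul]
  constructor <;> rintro ⟨h1, h2⟩ <;> constructor <;> linarith

/-- Every neighbourhood of a point contains a dyadic cube that contains the point. -/
theorem exists_treeBox_subset {O : Set (Fin n → ℝ)} (hO : IsOpen O) {s : Fin n → ℝ} (hs : s ∈ O) :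
    ∃ m l, s ∈ (treeBox (n * m) l).carrier ∧ (treeBox (n * m) l).carrier ⊆ O := by
  obtain ⟨e, he, hsub⟩ := Metric.isOpen_iff.1 hO s hs
  obtain ⟨m, hm⟩ := exists_pow_lt_of_lt_one he (show (1 / 2 : ℝ) < 1 by norm_num)
  refine ⟨m, _, mem_treeIndex (n * m) s, fun s' hs' => hsub ?_⟩
  have h1 := dist_le_of_mem_treeBox hs' (mem_treeIndex (n * m) s)
  rw [Nat.mul_div_cancel_left _ (NeZero.pos n)] at h1
  exact h1.trans_lt hm

theorem DyadicCell.hi_eq {e : DyadicCell n} (he : e.IsProper) (hd : e.dim = n) (r : Fin n) :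
    e.2.2 r = e.2.1 r + 1 := by
  refine (he r).resolve_left fun h => ?_
  have h1 : e.dirs = Finset.univ := by
    rw [← Finset.card_eq_iff_eq_univ, Fintype.card_fin]
    exact hd
  have h2 := DyadicCell.mem_dirs.1 (h1 ▸ Finset.mem_univ r)
  omega

theorem DyadicCell.carrier_eq_treeBox {e : DyadicCell n} (he : e.IsProper) (hd : e.dim = n) :
    e.carrier = (treeBox (n * e.1) e.2.1).carrier := by
  ext s
  rw [treeBox_mul_lo]
  refine forall_congr' fun r => ?_
  rw [DyadicCell.hi_eq he hd r]
  push_cast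
  rfl

theorem DyadicCell.nrm_lt_one_iff {e : DyadicCell n} (he : e.IsProper) (hd : e.dim = n)
    {s : Fin n → ℝ} : e.nrm s < 1 ↔ s ∈ (treeBox (n * e.1) e.2.1).inner := by
  rw [DyadicCell.nrm, pi_norm_lt_iff one_pos, mem_inner_treeBox]
  refine forall_congr' fun r => ?_
  rw [DyadicCell.nrm_apply, DyadicCell.hi_eq he hd r, Real.norm_eq_abs, abs_lt]
  simp only [normalize, treeScale_mul]
  push_cast
  constructor <;> rintro ⟨h1, h2⟩ <;> constructor <;> linarith

/-- The cubes of the Whitney decomposition of `U`, as boxes of the tree. -/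
def whitneyCubes (U : Set (Fin n → ℝ)) : Set (ℕ × (Fin n → ℤ)) :=
  {c | ∃ s ∈ U, (whitneyCell U s).dim = n ∧ c = (n * (whitneyCell U s).1, (whitneyCell U s).2.1)}

variable {U : Set (Fin n → ℝ)}

theorem whitneyCell_dim_le (s : Fin n → ℝ) : (whitneyCell U s).dim ≤ n :=
  (Finset.card_le_univ _).trans (Fintype.card_fin n).le

/-- The open cubes of the Whitney decomposition are cells of it. -/
theorem whitneyCell_eq_of_nrm_lt (hU : IsOpen U) {s₀ s : Fin n → ℝ} (hs₀ : s₀ ∈ U)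
    (hs : s ∈ (whitneyCell U s₀).carrier) (h : (whitneyCell U s₀).nrm s < 1) :
    whitneyCell U s = whitneyCell U s₀ := by
  refine (whitneyCell_eq_or_dim_lt hU hs₀ hs).resolve_right fun h1 => h.ne ?_
  exact (nrm_whitneyCell_eq_one_iff hU hs₀ hs).2 h1

theorem exists_mem_whitneyCubes {s : Fin n → ℝ} (hs : s ∈ U) (hd : (whitneyCell U s).dim = n) :
    ∃ c ∈ whitneyCubes U, s ∈ (treeBox c.1 c.2).carrier := by
  refine ⟨_, ⟨s, hs, hd, rfl⟩, ?_⟩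
  rw [← DyadicCell.carrier_eq_treeBox (isProper_whitneyCell U s) hd]
  exact mem_whitneyCell U s

theorem treeBox_subset_of_mem_whitneyCubes (hU : IsOpen U) {c : ℕ × (Fin n → ℤ)}
    (hc : c ∈ whitneyCubes U) : (treeBox c.1 c.2).carrier ⊆ U := by
  obtain ⟨s, hs, hd, rfl⟩ := hc
  rw [← DyadicCell.carrier_eq_treeBox (isProper_whitneyCell U s) hd]
  exact whitneyCell_subset hU hs

theorem dim_lt_of_mem_bd (hU : IsOpen U) {c : ℕ × (Fin n → ℤ)} (hc : c ∈ whitneyCubes U)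
    {s : Fin n → ℝ} (hs : s ∈ (treeBox c.1 c.2).bd) : (whitneyCell U s).dim < n := by
  obtain ⟨s₀, hs₀, hd, rfl⟩ := hc
  have hp := isProper_whitneyCell U s₀
  have h1 : s ∈ (whitneyCell U s₀).carrier := by
    rw [DyadicCell.carrier_eq_treeBox hp hd]
    exact hs.1
  have h2 : (whitneyCell U s₀).nrm s = 1 := by
    refine le_antisymm (hp.mem_carrier_iff.1 h1).2 (not_lt.1 fun h3 => ?_)
    exact Box.notMem_inner_of_mem_bd hs ((DyadicCell.nrm_lt_one_iff hp hd).1 h3)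
  have h3 := (nrm_whitneyCell_eq_one_iff hU hs₀ h1).1 h2
  omega

theorem disjoint_whitneyCubes (hU : IsOpen U) {c c' : ℕ × (Fin n → ℤ)} (hc : c ∈ whitneyCubes U)
    (hc' : c' ∈ whitneyCubes U) (hne : c ≠ c') :
    Disjoint (treeBox c.1 c.2).inner (treeBox c'.1 c'.2).inner := by
  refine Set.disjoint_left.2 fun s hs hs' => hne ?_
  have key : ∀ {c : ℕ × (Fin n → ℤ)}, c ∈ whitneyCubes U → s ∈ (treeBox c.1 c.2).inner →
      c = (n * (whitneyCell U s).1, (whitneyCell U s).2.1) := by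
    rintro _ ⟨s₀, hs₀, hd, rfl⟩ hs
    have hp := isProper_whitneyCell U s₀
    rw [whitneyCell_eq_of_nrm_lt hU hs₀ _ ((DyadicCell.nrm_lt_one_iff hp hd).2 hs)]
    rw [DyadicCell.carrier_eq_treeBox hp hd]
    exact Box.inner_subset _ hs
  rw [key hc hs, key hc' hs']

/-- Every box in `U` contains a dyadic cube that lies in an open cube of the Whitney
decomposition. -/
theorem exists_treeBox_subset_whitneyCell {C : Box n} (hC : C.carrier ⊆ U) :
    ∃ c : ℕ × (Fin n → ℤ), (treeBox c.1 c.2).carrier ⊆ C.carrier ∧ ∃ s₀ ∈ U,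
      (whitneyCell U s₀).dim = n ∧
      ∀ s ∈ (treeBox c.1 c.2).carrier, (whitneyCell U s₀).nrm s < 1 := by
  -- A point with irrational coordinates lies on no face of a dyadic cube, so that its cell has
  -- dimension `n`.
  choose p hp using fun r => exists_irrational_btwn (C.lt r)
  have hpC : p ∈ C.inner := fun r => (hp r).2
  have hpU := hC (Box.inner_subset _ hpC)
  have hd : (whitneyCell U p).dim = n := by
    have h1 : (whitneyCell U p).dirs = Finset.univ := by
      refine Finset.eq_univ_iff_forall.2 fun r => DyadicCell.mem_dirs.2 ?_
      by_contra hcon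
      have h2 := DyadicCell.not_floor_lt_ceil.1 hcon
      have h3 : Irrational ((2 ^ whitneyScale U p : ℕ) * p r) :=
        (hp r).1.natCast_mul (by positivity)
      push_cast at h3
      exact h3.ne_int _ h2
    rw [DyadicCell.dim, h1, Finset.card_univ, Fintype.card_fin]
  have hpr := isProper_whitneyCell U p
  have hnp : (whitneyCell U p).nrm p < 1 := by
    refine lt_of_le_of_ne (hpr.mem_carrier_iff.1 (mem_whitneyCell U p)).2 fun h1 => ?_
    exact lt_irrefl _ ((DyadicCell.nrm_eq_one_iff (mem_whitneyCell U p)).1 h1)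
  obtain ⟨m, l, -, h2⟩ := exists_treeBox_subset (O := C.inner ∩ {s | (whitneyCell U p).nrm s < 1})
    (C.isOpen_inner.inter (isOpen_lt (DyadicCell.continuous_nrm _) continuous_const)) ⟨hpC, hnp⟩
  exact ⟨(n * m, l), fun s hs => Box.inner_subset _ (h2 hs).1, p, hpU, hd, fun s hs => (h2 hs).2⟩

/-- The image of a box under the homothety with ratio `1/2` and the given centre. -/
noncomputable def Box.half {n : ℕ} (ctr : Fin n → ℝ) (C : Box n) : Box n where
  lo := fun r => (ctr r + C.lo r) / 2
  hi := fun r => (ctr r + C.hi r) / 2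
  lt := fun r => by have := C.lt r; linarith

theorem Box.interp_self {n : ℕ} (C : Box n) (t : I) : C.interp C t = C := by
  ext <;> simp only [Box.interp_lo, Box.interp_hi] <;> ring

theorem mem_interp_half_aux {c l s t : ℝ} (ht : 0 < 1 - t / 2) :
    ((1 - t) * l + t * ((c + l) / 2) ≤ s ↔ l ≤ c + (1 - t / 2)⁻¹ * (s - c)) ∧
    (s ≤ (1 - t) * l + t * ((c + l) / 2) ↔ c + (1 - t / 2)⁻¹ * (s - c) ≤ l) := by
  have h : (1 - t) * l + t * ((c + l) / 2) = c + (1 - t / 2) * (l - c) := by ring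
  rw [h]
  constructor
  · rw [← sub_le_iff_le_add', ← le_sub_iff_add_le', mul_comm (1 - t / 2)⁻¹, ← div_eq_mul_inv,
      le_div_iff₀ ht, mul_comm]
  · rw [← sub_le_iff_le_add', ← le_sub_iff_add_le', mul_comm (1 - t / 2)⁻¹, ← div_eq_mul_inv,
      div_le_iff₀ ht, mul_comm]

theorem Box.mem_interp_half {n : ℕ} {ctr : Fin n → ℝ} {C : Box n} {t : I} {s : Fin n → ℝ} :
    s ∈ (C.interp (C.half ctr) t).carrier ↔
      ctr + (1 - (t : ℝ) / 2)⁻¹ • (s - ctr) ∈ C.carrier := by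
  have ht : 0 < 1 - (t : ℝ) / 2 := by linarith [t.2.2]
  exact forall_congr' fun r =>
    and_congr (mem_interp_half_aux ht).1 (mem_interp_half_aux ht).2

theorem Box.mem_inner_interp_half {n : ℕ} {ctr : Fin n → ℝ} {C : Box n} {t : I} {s : Fin n → ℝ} :
    s ∈ (C.interp (C.half ctr) t).inner ↔
      ctr + (1 - (t : ℝ) / 2)⁻¹ • (s - ctr) ∈ C.inner := by
  have ht : 0 < 1 - (t : ℝ) / 2 := by linarith [t.2.2]
  refine forall_congr' fun r => and_congr ?_ ?_
  · exact lt_iff_lt_of_le_iff_le (mem_interp_half_aux ht).2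
  · exact lt_iff_lt_of_le_iff_le (mem_interp_half_aux ht).1

end WhitneyCubes

/-! ### Loops that are factored with boxes -/

section Factored

variable {n : ℕ} [NeZero n]

/-- A factorization by boxes of a map on `ℝ^n` that represents an `n`-loop. -/
structure BoxFactored {Z : Type u} {K : Type w} (S : K → Set Z) (p : K → Z)
    (f : (Fin n → ℝ) → Z) (𝒟 : K → Set (Box n)) : Prop where
  disjoint : ∀ k l, ∀ C ∈ 𝒟 k, ∀ D ∈ 𝒟 l, (k, C) ≠ (l, D) → Disjoint C.inner D.inner
  mapsTo : ∀ k, ∀ C ∈ 𝒟 k, ∀ s ∈ C.carrier, f s ∈ S k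
  bd_eq : ∀ k, ∀ C ∈ 𝒟 k, ∀ s ∈ C.bd, f s = p k
  cover : ∀ k s, f s ∈ S k → f s ≠ p k → ∃ C ∈ 𝒟 k, s ∈ C.carrier
  unit : ∀ k, ∀ C ∈ 𝒟 k, C.carrier ⊆ (treeBox 0 0).carrier

section Attach

variable {X : Type u} [TopologicalSpace X] {B : ℕ → Type v} [∀ i, TopologicalSpace (B i)]
  {y : ℕ → X} {b : ∀ i, B i} {f : (Fin n → ℝ) → Adj y b} {𝒟 : ℕ → Set (Box n)}

theorem BoxFactored.coreRetraction_eq (h : BoxFactored (attachSet y b) (attachPt y b) f 𝒟)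
    {i : ℕ} {C : Box n} (hC : C ∈ 𝒟 i) {s : Fin n → ℝ} (hs : s ∈ C.carrier) :
    coreRetraction y b (f s) = y i := (mem_attachSet_iff.1 (h.mapsTo i C hC s hs)).1

theorem BoxFactored.boxSupported (h : BoxFactored (attachSet y b) (attachPt y b) f 𝒟)
    (hf : Continuous f) (i : ℕ) :
    BoxSupported (fun C : 𝒟 i => C.1) (b i) fun s => retraction y b i (f s) where
  cont := (retraction y b i).continuous.comp hf
  disjoint := fun C D hCD => h.disjoint i i C C.2 D D.2 fun h1 =>
    hCD (Subtype.ext (Prod.ext_iff.1 h1).2)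
  bd := fun C s hs => by rw [h.bd_eq i C C.2 s hs]; rfl
  cover := fun s hs => by
    obtain ⟨h1, h2⟩ := retraction_ne_iff.1 hs
    obtain ⟨C, hC, hsC⟩ := h.cover i s h1 h2
    exact ⟨⟨C, hC⟩, hsC⟩
  unit := fun C s hs => by
    have := mem_unitBox.1 (h.unit i C C.2 hs)
    exact ⟨fun r => (this r).1, fun r => (this r).2⟩

/-- Boxes that contain the content of a map, and in which the core coordinate is that of the
attachment points, are a factorization. -/
theorem boxFactored_of
    (hd : ∀ k l, ∀ C ∈ 𝒟 k, ∀ D ∈ 𝒟 l, (k, C) ≠ (l, D) → Disjoint C.inner D.inner)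
    (hr : ∀ i s, retraction y b i (f s) ≠ b i → ∃ C ∈ 𝒟 i, s ∈ C.inner)
    (hc : ∀ i, ∀ C ∈ 𝒟 i, ∀ s ∈ C.carrier, coreRetraction y b (f s) = y i)
    (hu : ∀ i, ∀ C ∈ 𝒟 i, C.carrier ⊆ (treeBox 0 0).carrier) :
    BoxFactored (attachSet y b) (attachPt y b) f 𝒟 where
  disjoint := hd
  mapsTo := fun i C hC s hs => by
    refine mem_attachSet_iff.2 ⟨hc i C hC s hs, fun i' hi' => ?_⟩
    by_contra hne
    obtain ⟨D, hD, hsD⟩ := hr i' s hne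
    exact Box.notMem_inner_of_disjoint
      (hd i i' C hC D hD fun h => hi' (Prod.ext_iff.1 h).1.symm) hs hsD
  bd_eq := fun i C hC s hs => by
    refine Adj.ext_coord (hc i C hC s hs.1) fun i' => ?_
    change _ = b i'
    by_contra hne
    obtain ⟨D, hD, hsD⟩ := hr i' s hne
    by_cases h : (i, C) = (i', D)
    · obtain ⟨rfl, rfl⟩ := Prod.ext_iff.1 h
      exact Box.notMem_inner_of_mem_bd hs hsD
    · exact Box.notMem_inner_of_disjoint (hd i i' C hC D hD h) hs.1 hsD
  cover := fun i s h1 h2 => by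
    obtain ⟨C, hC, hs⟩ := hr i s (retraction_ne_iff.2 ⟨h1, h2⟩)
    exact ⟨C, hC, Box.inner_subset _ hs⟩
  unit := hu

/-- A point all of whose coordinates in the attached spaces are coordinates of points of `W` lies in
`W`, if `W` contains the core. -/
theorem mem_of_retraction {W : Set (Adj y b)} (hW : Set.range (core y b) ⊆ W) {z : Adj y b}
    (h : ∀ i, retraction y b i z ≠ b i → ∃ w ∈ W, retraction y b i z = retraction y b i w) :
    z ∈ W := by
  by_cases hz : ∃ i, retraction y b i z ≠ b i
  · obtain ⟨i, hi⟩ := hz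
    obtain ⟨w, hw, hzw⟩ := h i hi
    rw [Adj.eq_attach hi, hzw, ← Adj.eq_attach (hzw ▸ hi)]
    exact hw
  · push Not at hz
    rw [Adj.eq_core hz]
    exact hW ⟨_, rfl⟩

/-- The contents of the boxes of a factorization can be shrunk to smaller boxes. -/
theorem BoxFactored.exists_shrink (h : BoxFactored (attachSet y b) (attachPt y b) f 𝒟)
    (hf : Continuous f) {z₀ : X} (hout : ∀ s, s ∉ (treeBox 0 0 : Box n).inner → f s = core y b z₀)
    {W : Set (Adj y b)} (hW : Set.range (core y b) ⊆ W) (hfW : ∀ s, f s ∈ W)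
    (D : ∀ i, ∀ C ∈ 𝒟 i, Box n) (hD : ∀ i C hC, (D i C hC).carrier ⊆ C.carrier) :
    ∃ g : C(Fin n → ℝ, Adj y b), (∀ s, coreRetraction y b (g s) = coreRetraction y b (f s)) ∧
      BoxFactored (attachSet y b) (attachPt y b) g (fun i => {E | ∃ C hC, E = D i C hC}) ∧
      ContinuousMap.HomotopicWith ⟨f, hf⟩ g (LoopIn (core y b z₀) W) := by
  choose F hF hF1 hF2 hF0 using fun i => (h.boxSupported hf i).exists_move
    (D := fun C => D i C.1 C.2) fun C C' hC t => ((h.boxSupported hf i).disjoint C C' hC).mono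
      (Box.interp_subset (hD i _ _) t) (Box.interp_subset (hD i _ _) t)
  have hFne : ∀ i s t, F i (s, t) ≠ b i →
      ∃ C, ∃ hC : C ∈ 𝒟 i, s ∈ (C.interp (D i C hC) t).inner := by
    intro i s t hne
    by_contra hcon
    push Not at hcon
    exact hne (hF2 i s t fun C => hcon C.1 C.2)
  have hFin : ∀ i s t, F i (s, t) ≠ b i → ∃ C ∈ 𝒟 i, s ∈ C.inner := by
    intro i s t hne
    obtain ⟨C, hC, hs⟩ := hFne i s t hne
    exact ⟨C, hC, Box.interp_subset (hD i C hC) t hs⟩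
  have hv : ∀ x : (Fin n → ℝ) × I, Adj.Valid y b (coreRetraction y b (f x.1)) fun i => F i x := by
    rintro ⟨s, t⟩ i hi
    obtain ⟨C, hC, hs⟩ := hFin i s t hi
    refine ⟨h.coreRetraction_eq hC (Box.inner_subset _ hs), fun i' hi' => ?_⟩
    by_contra hne
    obtain ⟨C', hC', hs'⟩ := hFin i' s t hne
    exact Set.disjoint_left.1 (h.disjoint i i' C hC C' hC' fun h => hi' (Prod.ext_iff.1 h).1.symm)
      hs hs'
  have hc := Adj.continuous_mk hv (((coreRetraction y b).continuous.comp hf).comp continuous_fst) hF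
  have hs1 : Continuous fun s : Fin n → ℝ => (s, (1 : I)) := by fun_prop
  refine ⟨⟨_, hc.comp hs1⟩, fun s => (hv (s, 1)).coreRetraction_mk, boxFactored_of ?_ ?_ ?_ ?_,
    homotopicWith_of hc (fun s => ?_) (fun s => rfl) fun t => ⟨fun s hs => ?_, fun s => ?_⟩⟩
  · rintro i i' _ ⟨C, hC, rfl⟩ _ ⟨C', hC', rfl⟩ hne
    refine (h.disjoint i i' C hC C' hC' fun h => hne ?_).mono
      (Box.inner_subset_inner (hD i C hC)) (Box.inner_subset_inner (hD i' C' hC'))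
    obtain ⟨rfl, rfl⟩ := Prod.ext_iff.1 h
    rfl
  · intro i s hs
    have h1 : F i (s, 1) ≠ b i := by
      rwa [← (hv (s, 1)).retraction_mk i]
    obtain ⟨C, hC, hs'⟩ := hFne i s 1 h1
    rw [Box.interp_one] at hs'
    exact ⟨_, ⟨C, hC, rfl⟩, hs'⟩
  · rintro i _ ⟨C, hC, rfl⟩ s hs
    rw [← h.coreRetraction_eq hC (hD i C hC hs)]
    exact (hv (s, 1)).coreRetraction_mk
  · rintro i _ ⟨C, hC, rfl⟩
    exact (hD i C hC).trans (h.unit i C hC)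
  · simp only [hF0]
    exact Adj.mk_coord (f s)
  · refine Adj.ext_coord ((hv (s, t)).coreRetraction_mk.trans ?_) fun i =>
      ((hv (s, t)).retraction_mk i).trans ?_
    · rw [hout s hs]
    · by_contra hne
      obtain ⟨C, hC, hsC⟩ := hFin i s t hne
      exact hs (Box.inner_subset_inner (h.unit i C hC) hsC)
  · refine mem_of_retraction hW fun i hi => ?_
    have h1 : retraction y b i _ = F i (s, t) := (hv (s, t)).retraction_mk i
    obtain ⟨C, hC, hs⟩ := hFne i s t fun h2 => hi (h1.trans h2)
    exact ⟨_, hfW _, h1.trans (hF1 i ⟨C, hC⟩ s t (Box.inner_subset _ hs))⟩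

end Attach

/-! ### Deforming the components to the cubes of Whitney decompositions -/

section WhitneyFamily

variable {A : ℕ → Type u} [∀ j, TopologicalSpace (A j)] [∀ j, T2Space (A j)] {x : ℕ → I}
  {a : ∀ j, A j} {p : (Fin n → ℝ) → Adj x a}

/-- The open set where a map to a shrinking adjunction space takes values in `A j`, away from the
base point. -/
def support (p : (Fin n → ℝ) → Adj x a) (j : ℕ) : Set (Fin n → ℝ) :=
  {s | retraction x a j (p s) ≠ a j}

theorem isOpen_support (hp : Continuous p) (j : ℕ) : IsOpen (support p j) :=
  isOpen_compl_singleton.preimage ((retraction x a j).continuous.comp hp)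

omit [∀ j, T2Space (A j)] in
theorem index_eq_of_mem_support {j j' : ℕ} {s : Fin n → ℝ} (hs : s ∈ support p j)
    (hs' : s ∈ support p j') : j = j' := by
  by_contra hne
  exact hs ((Adj.fib_of_ne hs').2 j hne)

omit [∀ j, T2Space (A j)] in
theorem support_subset {z₀ : I} (hout : ∀ s, s ∉ (treeBox 0 0 : Box n).inner → p s = core x a z₀)
    (j : ℕ) : support p j ⊆ (treeBox 0 0 : Box n).inner := by
  intro s hs
  by_contra hcon
  exact hs (by rw [hout s hcon]; rfl)

/-- The components of a loop in all `A j` can be deformed simultaneously to maps that are supported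
in the cubes of the Whitney decompositions of their supports. -/
theorem exists_whitney_family (hA : ∀ j, SeqConnected (n - 1) (a j)) (hp : Continuous p) {z₀ : I}
    (hout : ∀ s, s ∉ (treeBox 0 0 : Box n).inner → p s = core x a z₀) :
    ∃ P : (Fin n → ℝ) × I → Adj x a, Continuous P ∧ (∀ s, P (s, 0) = p s) ∧
      (∀ s t, coreRetraction x a (P (s, t)) = coreRetraction x a (p s)) ∧
      (∀ j s t, s ∉ support p j → retraction x a j (P (s, t)) = a j) ∧
      (∀ j, ∀ s ∈ support p j, (whitneyCell (support p j) s).dim < n →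
        retraction x a j (P (s, 1)) = a j) ∧
      ∀ j, ∀ s₀ ∈ support p j, (whitneyCell (support p j) s₀).dim = n →
        ∀ s ∈ (whitneyCell (support p j) s₀).carrier, ∀ t : I,
          (whitneyCell (support p j) s₀).nrm s ≤ 1 - t / 2 →
          retraction x a j (P (s, t)) = retraction x a j (p ((whitneyCell (support p j) s₀).ctr +
            (1 - (t : ℝ) / 2)⁻¹ • (s - (whitneyCell (support p j) s₀).ctr))) := by
  have hb : ∀ j, support p j ⊆ Set.Icc 0 1 := fun j s hs => by
    have := mem_inner_unitBox.1 (support_subset hout j hs)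
    exact ⟨fun r => (this r).1.le, fun r => (this r).2.le⟩
  choose h hc h0 hoff h1 hn using fun j => exists_whitney_homotopy (isOpen_support hp j) (hb j)
    ((retraction x a j).continuous.comp hp) (fun s hs => not_not.1 hs) (NeZero.one_le) (hA j)
  have hv : ∀ q : (Fin n → ℝ) × I,
      Adj.Valid x a (coreRetraction x a (p q.1)) fun j => h j q.1 q.2 := by
    rintro ⟨s, t⟩ j hj
    have hs : s ∈ support p j := by
      by_contra hcon
      exact hj (hoff j s hcon t)
    refine ⟨(Adj.fib_of_ne hs).1, fun j' hj' => hoff j' s (fun hs' => hj' ?_) t⟩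
    exact index_eq_of_mem_support hs' hs
  have hcI : ∀ j, Continuous fun q : (Fin n → ℝ) × I => h j q.1 q.2 := fun j => by
    refine (hc j).comp_continuous (f := fun q : (Fin n → ℝ) × I => (q.1, (q.2 : ℝ)))
      (by fun_prop) ?_
    exact fun q => ⟨trivial, q.2.2⟩
  refine ⟨fun q => Adj.mk x a (coreRetraction x a (p q.1)) fun j => h j q.1 q.2,
    Adj.continuous_mk hv (((coreRetraction x a).continuous.comp hp).comp continuous_fst) hcI,
    fun s => ?_, fun s t => (hv (s, t)).coreRetraction_mk, fun j s t hs => ?_, fun j s hs hd => ?_,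
    fun j s₀ hs₀ hd s hs t ht => ?_⟩
  · simp only [Set.Icc.coe_zero, h0]
    exact Adj.mk_coord (p s)
  · exact ((hv (s, t)).retraction_mk j).trans (hoff j s hs t)
  · exact ((hv (s, 1)).retraction_mk j).trans (h1 j s hs hd)
  · exact ((hv (s, t)).retraction_mk j).trans (hn j s₀ hs₀ hd s hs t t.2 ht)

end WhitneyFamily

end Factored

/-! ### Moving the boxes of a factorization along with a deformation -/

section Stage

variable {n : ℕ} [NeZero n] {A : ℕ → Type u} [∀ j, TopologicalSpace (A j)] [∀ j, T2Space (A j)]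
  {x : ℕ → I} {a : ∀ j, A j} {B : ℕ → Type v} [∀ i, TopologicalSpace (B i)] {y : ℕ → Adj x a}
  {b : ∀ i, B i}

theorem eq_of_retraction_eq {p q : Adj x a} {j : ℕ} (hq : retraction x a j q ≠ a j)
    (h : retraction x a j p = retraction x a j q) : p = q := by
  rw [Adj.eq_attach hq, ← h]
  exact Adj.eq_attach (h ▸ hq)

/-- A box `C` of the factorization of a loop in the iterated space is placed well if the space `B i`
is attached to the arc and `C` is a box of the tree, or `B i` is attached to a point of `A j` away
from the base point and `C` lies in an open cube of the Whitney decomposition of the support of the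
component in `A j`. In the second case the box `D`, to which `C` will be moved, is the image of `C`
under the homothety with ratio `1/2` at the centre of that cube. -/
def WellPlaced (x : ℕ → I) (a : ∀ j, A j) (p : (Fin n → ℝ) → Adj x a) (q : Adj x a)
    (C : Box n) (c : ℕ × (Fin n → ℤ)) (D : Box n) : Prop :=
  (q ∈ Set.range (core x a) ∧ C = treeBox c.1 c.2 ∧ D = C) ∨
  ∃ j, retraction x a j q ≠ a j ∧ ∃ s₀ ∈ support p j, (whitneyCell (support p j) s₀).dim = n ∧
    (∀ s ∈ C.carrier, (whitneyCell (support p j) s₀).nrm s < 1) ∧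
    D = C.half (whitneyCell (support p j) s₀).ctr

theorem exists_wellPlaced {p : (Fin n → ℝ) → Adj x a} {q : Adj x a} {C : Box n}
    (hC : ∀ s ∈ C.carrier, p s = q) :
    ∃ E : Box n, E.carrier ⊆ C.carrier ∧ ∃ c D, WellPlaced x a p q E c D := by
  rcases mem_range_core_or q with h | ⟨j, hj⟩
  · obtain ⟨s, hs⟩ := C.inner_nonempty
    obtain ⟨m, l, -, hsub⟩ := exists_treeBox_subset C.isOpen_inner hs
    exact ⟨treeBox (n * m) l, hsub.trans (Box.inner_subset C), (n * m, l), _, Or.inl ⟨h, rfl, rfl⟩⟩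
  · have hCU : C.carrier ⊆ support p j := fun s hs => by
      change retraction x a j (p s) ≠ a j
      rwa [hC s hs]
    obtain ⟨c, hcC, s₀, hs₀, hd, hn⟩ := exists_treeBox_subset_whitneyCell hCU
    exact ⟨treeBox c.1 c.2, hcC, c, _, Or.inr ⟨j, hj, s₀, hs₀, hd, hn, rfl⟩⟩

variable {f : (Fin n → ℝ) → Adj y b} {𝒟 : ℕ → Set (Box n)}

/-- The motion of a well placed box is compatible with the deformation to the Whitney cubes. -/
theorem WellPlaced.eq {p : (Fin n → ℝ) → Adj x a} {q : Adj x a} {C D : Box n}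
    {c : ℕ × (Fin n → ℤ)} (h : WellPlaced x a p q C c D) (hC : ∀ s ∈ C.carrier, p s = q)
    {P : (Fin n → ℝ) × I → Adj x a}
    (hPc : ∀ s t, coreRetraction x a (P (s, t)) = coreRetraction x a (p s))
    (hPoff : ∀ j s t, s ∉ support p j → retraction x a j (P (s, t)) = a j)
    (hPn : ∀ j, ∀ s₀ ∈ support p j, (whitneyCell (support p j) s₀).dim = n →
        ∀ s ∈ (whitneyCell (support p j) s₀).carrier, ∀ t : I,
          (whitneyCell (support p j) s₀).nrm s ≤ 1 - t / 2 →
          retraction x a j (P (s, t)) = retraction x a j (p ((whitneyCell (support p j) s₀).ctr +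
            (1 - (t : ℝ) / 2)⁻¹ • (s - (whitneyCell (support p j) s₀).ctr))))
    {s : Fin n → ℝ} {t : I} (hs : s ∈ (C.interp D t).carrier) : P (s, t) = q := by
  rcases h with ⟨h1, -, rfl⟩ | ⟨j, hj, s₀, hs₀, hd, hn, rfl⟩
  · rw [Box.interp_self] at hs
    have h2 := hC s hs
    rw [← h2] at h1
    refine Adj.ext_coord ((hPc s t).trans (by rw [h2])) fun j => ?_
    rw [hPoff j s t fun h3 => h3 (retraction_of_mem_range h1 j), ← h2,
      retraction_of_mem_range h1 j]
  · set Q := whitneyCell (support p j) s₀ with hQ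
    have ht : 0 < 1 - (t : ℝ) / 2 := by linarith [t.2.2]
    rw [Box.mem_interp_half] at hs
    set e := Q.ctr + (1 - (t : ℝ) / 2)⁻¹ • (s - Q.ctr) with he
    have hpr : Q.IsProper := isProper_whitneyCell _ _
    have hse : s = Q.ctr + (1 - (t : ℝ) / 2) • (e - Q.ctr) := by
      rw [he, add_sub_cancel_left, smul_smul, mul_inv_cancel₀ ht.ne', one_smul, add_sub_cancel]
    have hne := hn e hs
    have hns : Q.nrm s ≤ 1 - t / 2 := by
      rw [hse, DyadicCell.nrm_ray Q ht.le]
      exact mul_le_of_le_one_right ht.le hne.le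
    have hsQ : s ∈ Q.carrier := by
      refine hpr.mem_carrier_iff.2 ⟨fun r hr => ?_, hns.trans (by linarith [t.2.1])⟩
      rw [DyadicCell.hi_eq hpr hd r] at hr
      omega
    refine eq_of_retraction_eq hj ?_
    rw [hPn j s₀ hs₀ hd s hsQ t hns, hC e hs]

/-- At every time, a moved box of the second kind lies in one cube of the Whitney decomposition of
the support of the component in `A j`. -/
theorem mem_whitneyCell_of_mem_interp {p : (Fin n → ℝ) → Adj x a} (hp : Continuous p) {C : Box n}
    {j : ℕ} {s₀ : Fin n → ℝ} (hs₀ : s₀ ∈ support p j) (hd : (whitneyCell (support p j) s₀).dim = n)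
    (hn : ∀ s ∈ C.carrier, (whitneyCell (support p j) s₀).nrm s < 1) {s : Fin n → ℝ} {t : I}
    (hs : s ∈ (C.interp (C.half (whitneyCell (support p j) s₀).ctr) t).carrier) :
    s ∈ support p j ∧ whitneyCell (support p j) s = whitneyCell (support p j) s₀ := by
  have hU := isOpen_support hp j
  set Q := whitneyCell (support p j) s₀ with hQ
  have ht : 0 < 1 - (t : ℝ) / 2 := by linarith [t.2.2]
  rw [Box.mem_interp_half] at hs
  set e := Q.ctr + (1 - (t : ℝ) / 2)⁻¹ • (s - Q.ctr) with he
  have hpr : Q.IsProper := isProper_whitneyCell _ _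
  have hse : s = Q.ctr + (1 - (t : ℝ) / 2) • (e - Q.ctr) := by
    rw [he, add_sub_cancel_left, smul_smul, mul_inv_cancel₀ ht.ne', one_smul, add_sub_cancel]
  have hns : Q.nrm s < 1 := by
    rw [hse, DyadicCell.nrm_ray Q ht.le]
    exact mul_lt_one_of_nonneg_of_lt_one_right (by linarith [t.2.1]) (Q.nrm_nonneg e) (hn e hs)
  have hsQ : s ∈ Q.carrier := by
    refine hpr.mem_carrier_iff.2 ⟨fun r hr => ?_, hns.le⟩
    rw [DyadicCell.hi_eq hpr hd r] at hr
    omega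
  exact ⟨whitneyCell_subset hU hs₀ hsQ, whitneyCell_eq_of_nrm_lt hU hs₀ hsQ hns⟩

/-- Well placed boxes stay disjoint while they are moved. -/
theorem disjoint_interp_of_wellPlaced {p : (Fin n → ℝ) → Adj x a} (hp : Continuous p)
    {q q' : Adj x a} {C D C' D' : Box n} {c c' : ℕ × (Fin n → ℤ)}
    (h : WellPlaced x a p q C c D) (h' : WellPlaced x a p q' C' c' D')
    (hC : ∀ s ∈ C.carrier, p s = q) (hC' : ∀ s ∈ C'.carrier, p s = q')
    (hd : Disjoint C.inner C'.inner) (t : I) :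
    Disjoint (C.interp D t).inner (C'.interp D' t).inner := by
  refine Set.disjoint_left.2 fun s hs hs' => ?_
  rcases h with ⟨h1, -, rfl⟩ | ⟨j, hj, s₀, hs₀, hd₀, hn, rfl⟩ <;>
    rcases h' with ⟨h1', -, rfl⟩ | ⟨j', hj', s₀', hs₀', hd₀', hn', rfl⟩
  · rw [Box.interp_self] at hs hs'
    exact Set.disjoint_left.1 hd hs hs'
  · rw [Box.interp_self] at hs
    have h2 := (mem_whitneyCell_of_mem_interp hp hs₀' hd₀' hn' (Box.inner_subset _ hs')).1
    refine h2 ?_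
    rw [hC s (Box.inner_subset _ hs)]
    exact retraction_of_mem_range h1 j'
  · rw [Box.interp_self] at hs'
    have h2 := (mem_whitneyCell_of_mem_interp hp hs₀ hd₀ hn (Box.inner_subset _ hs)).1
    refine h2 ?_
    rw [hC' s (Box.inner_subset _ hs')]
    exact retraction_of_mem_range h1' j
  · obtain ⟨h2, h3⟩ := mem_whitneyCell_of_mem_interp hp hs₀ hd₀ hn (Box.inner_subset _ hs)
    obtain ⟨h2', h3'⟩ := mem_whitneyCell_of_mem_interp hp hs₀' hd₀' hn' (Box.inner_subset _ hs')
    obtain rfl := index_eq_of_mem_support h2 h2'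
    rw [Box.mem_inner_interp_half, ← h3] at hs
    rw [Box.mem_inner_interp_half, ← h3'] at hs'
    exact Set.disjoint_left.1 hd hs hs'

/-- A loop with a factorization by well placed boxes can be deformed to a loop that is factored with
boxes of the tree for the decomposition of the iterated space over the arc. -/
theorem BoxFactored.exists_treeFactored_of_wellPlaced
    (h : BoxFactored (attachSet y b) (attachPt y b) f 𝒟) (hA : ∀ j, SeqConnected (n - 1) (a j))
    (hf : Continuous f) {z₀ : I}
    (hout : ∀ s, s ∉ (treeBox 0 0 : Box n).inner → f s = core y b (core x a z₀))
    {W : Set (Adj y b)} (hW : Set.range (core y b) ⊆ W) (hfW : ∀ s, f s ∈ W)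
    (hwp : ∀ i, ∀ C ∈ 𝒟 i, ∃ c D, WellPlaced x a (fun s => coreRetraction y b (f s)) (y i) C c D) :
    ∃ (g : (Fin n → ℝ) → Adj y b) (cubes : _) (𝒟' : _)
      (hg : TreeFactored (iterDecomposition x a y b) (z₀ : ℝ) cubes g),
      BoxFactored (attachSet y b) (attachPt y b) g 𝒟' ∧
      ContinuousMap.HomotopicWith (⟨f, hf⟩ : C(Fin n → ℝ, Adj y b)) ⟨g, hg.cont⟩
        (LoopIn (core y b (core x a z₀)) W) := by
  -- The core component `p` of `f` is deformed to the Whitney cubes by `P`, and the content `G i` of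
  -- the boxes for `B i` is moved with the boxes, on which `P` remains constant.
  choose c D hD using hwp
  set p : (Fin n → ℝ) → Adj x a := fun s => coreRetraction y b (f s) with hpdef
  have hp : Continuous p := (coreRetraction y b).continuous.comp hf
  have hpout : ∀ s, s ∉ (treeBox 0 0 : Box n).inner → p s = core x a z₀ := fun s hs => by
    simp only [hpdef, hout s hs, coreRetraction_core]
  have hCp : ∀ i, ∀ C ∈ 𝒟 i, ∀ s ∈ C.carrier, p s = y i := fun i C hC s hs =>
    h.coreRetraction_eq hC hs
  obtain ⟨P, hP, hP0, hPc, hPoff, hP1, hPn⟩ := exists_whitney_family hA hp hpout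
  have hdis : ∀ i i' C C' (hC : C ∈ 𝒟 i) (hC' : C' ∈ 𝒟 i'), (i, C) ≠ (i', C') → ∀ t,
      Disjoint (C.interp (D i C hC) t).inner (C'.interp (D i' C' hC') t).inner :=
    fun i i' C C' hC hC' hne t => disjoint_interp_of_wellPlaced hp (hD i C hC) (hD i' C' hC')
      (hCp i C hC) (hCp i' C' hC') (h.disjoint i i' C hC C' hC' hne) t
  have hPeq : ∀ i C (hC : C ∈ 𝒟 i) s t, s ∈ (C.interp (D i C hC) t).carrier → P (s, t) = y i :=
    fun i C hC s t hs => (hD i C hC).eq (hCp i C hC) hPc hPoff hPn hs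
  choose G hG hG1 hG2 hG0 using fun i => (h.boxSupported hf i).exists_move
    (D := fun C => D i C.1 C.2) fun C C' hC t => hdis i i C C' C.2 C'.2
      (fun h1 => hC (Subtype.ext (Prod.ext_iff.1 h1).2)) t
  have hGne : ∀ i s t, G i (s, t) ≠ b i →
      ∃ C, ∃ hC : C ∈ 𝒟 i, s ∈ (C.interp (D i C hC) t).inner := by
    intro i s t hne
    by_contra hcon
    push Not at hcon
    exact hne (hG2 i s t fun C => hcon C.1 C.2)
  have hv : ∀ q : (Fin n → ℝ) × I, Adj.Valid y b (P q) fun i => G i q := by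
    rintro ⟨s, t⟩ i hi
    obtain ⟨C, hC, hs⟩ := hGne i s t hi
    refine ⟨hPeq i C hC s t (Box.inner_subset _ hs), fun i' hi' => ?_⟩
    by_contra hne
    obtain ⟨C', hC', hs'⟩ := hGne i' s t hne
    exact Set.disjoint_left.1
      (hdis i i' C C' hC hC' (fun h => hi' (Prod.ext_iff.1 h).1.symm) t) hs hs'
  let H : (Fin n → ℝ) × I → Adj y b := fun q => Adj.mk y b (P q) fun i => G i q
  have hH : Continuous H := Adj.continuous_mk hv hP hG
  have hHc : ∀ q, coreRetraction y b (H q) = P q := fun q => (hv q).coreRetraction_mk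
  have hHr : ∀ i q, retraction y b i (H q) = G i q := fun i q => (hv q).retraction_mk i
  have hs1 : Continuous fun s : Fin n → ℝ => (s, (1 : I)) := by fun_prop
  have hHout : ∀ s t, s ∉ (treeBox 0 0 : Box n).inner → H (s, t) = core y b (core x a z₀) := by
    intro s t hs
    have h1 : P (s, t) = core x a z₀ := by
      refine Adj.ext_coord ?_ fun j => ?_
      · rw [hPc, hpout s hs]
      · rw [hPoff j s t fun h2 => hs (support_subset hpout j h2), retraction_core]
    refine Adj.ext_coord ?_ fun i => ?_
    · rw [hHc, h1, coreRetraction_core]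
    · rw [hHr, retraction_core]
      by_contra hne
      obtain ⟨C, hC, hsC⟩ := hGne i s t hne
      rcases hD i C hC with ⟨-, -, h3⟩ | ⟨j, hj, -⟩
      · rw [h3, Box.interp_self] at hsC
        exact hs (Box.inner_subset_inner (h.unit i C hC) hsC)
      · rw [← hPeq i C hC s t (Box.inner_subset _ hsC), h1] at hj
        exact hj rfl
  have hDu : ∀ i C (hC : C ∈ 𝒟 i), (D i C hC).carrier ⊆ (treeBox 0 0 : Box n).carrier := by
    intro i C hC s hs
    rcases hD i C hC with ⟨-, -, h3⟩ | ⟨j, hj, s₀, hs₀, hd, hn, h3⟩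
    · rw [h3] at hs
      exact h.unit i C hC hs
    · rw [h3, ← Box.interp_one C (C.half _)] at hs
      exact Box.inner_subset _ (support_subset hpout j
        (mem_whitneyCell_of_mem_interp hp hs₀ hd hn hs).1)
  have hBF : BoxFactored (attachSet y b) (attachPt y b) (fun s => H (s, 1))
      (fun i => {E | ∃ C hC, E = D i C hC}) := by
    refine boxFactored_of ?_ ?_ ?_ ?_
    · rintro i i' _ ⟨C, hC, rfl⟩ _ ⟨C', hC', rfl⟩ hne
      have h1 := hdis i i' C C' hC hC' (fun h1 => hne (by
        obtain ⟨rfl, rfl⟩ := Prod.ext_iff.1 h1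
        rfl)) 1
      rwa [Box.interp_one, Box.interp_one] at h1
    · intro i s hs
      rw [hHr] at hs
      obtain ⟨C, hC, hsC⟩ := hGne i s 1 hs
      rw [Box.interp_one] at hsC
      exact ⟨_, ⟨C, hC, rfl⟩, hsC⟩
    · rintro i _ ⟨C, hC, rfl⟩ s hs
      rw [hHc]
      exact hPeq i C hC s 1 (by rwa [Box.interp_one])
    · rintro i _ ⟨C, hC, rfl⟩
      exact hDu i C hC
  -- Where the component in `A j` is trivial, inside of its original support, everything is trivial.
  have hpt : ∀ j s, s ∈ support p j → retraction x a j (P (s, 1)) = a j →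
      H (s, 1) = core y b (core x a (x j)) := by
    intro j s hs h1
    have h2 : P (s, 1) = core x a (x j) := by
      refine Adj.ext_coord ?_ fun j' => ?_
      · rw [hPc, coreRetraction_core]
        exact (Adj.fib_of_ne hs).1
      · rw [retraction_core]
        by_cases hj : j' = j
        · rw [hj, h1]
        · exact hPoff j' s 1 fun h3 => hj (index_eq_of_mem_support h3 hs)
    refine Adj.ext_coord ?_ fun i => ?_
    · rw [hHc, h2, coreRetraction_core]
    · rw [hHr, retraction_core]
      by_contra hne
      obtain ⟨C, hC, hsC⟩ := hGne i s 1 hne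
      have h3 := hPeq i C hC s 1 (Box.inner_subset _ hsC)
      rcases hD i C hC with ⟨h4, -, h5⟩ | ⟨j', hj', -⟩
      · rw [h5, Box.interp_self] at hsC
        refine hs ?_
        rw [hCp i C hC s (Box.inner_subset _ hsC)]
        exact retraction_of_mem_range h4 j
      · rw [← h3, h2] at hj'
        exact hj' rfl
  have hcore : ∀ i C (hC : C ∈ 𝒟 i), y i ∈ Set.range (core x a) →
      C = treeBox (c i C hC).1 (c i C hC).2 ∧ D i C hC = C := by
    intro i C hC hi
    rcases hD i C hC with ⟨-, h2, h3⟩ | ⟨j, hj, -⟩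
    · exact ⟨h2, h3⟩
    · exact absurd (retraction_of_mem_range hi j) hj
  have hnot : ∀ i C, C ∈ 𝒟 i → y i ∈ Set.range (core x a) → ∀ s ∈ C.carrier, ∀ j,
      s ∉ support p j := by
    intro i C hC hi s hs j hsj
    refine hsj ?_
    rw [hCp i C hC s hs]
    exact retraction_of_mem_range hi j
  have hTF : TreeFactored (iterDecomposition x a y b) (z₀ : ℝ)
      (Sum.elim (fun i => {e | ∃ C, ∃ hC : C ∈ 𝒟 i, e = c i C hC})
        fun j => whitneyCubes (support p j)) (fun s => H (s, 1)) :=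
    { cont := hH.comp hs1
      mem := z₀.2
      out := fun s hs => by
        rw [hHout s 1 hs]
        change _ = core y b (core x a (Set.projIcc 0 1 zero_le_one (z₀ : ℝ)))
        rw [Set.projIcc_val]
      disjoint := ?_
      mapsTo := ?_
      bd := ?_
      cover := ?_
      unit := ?_ }
  · exact ⟨fun s => H (s, 1), _, _, hTF, hBF, homotopicWith_of hH (fun s => by
      simp only [H, hP0, hG0]
      exact Adj.mk_coord (f s)) (fun s => rfl) fun t => ⟨fun s hs => hHout s t hs, fun s => by
        refine mem_of_retraction hW fun i hi => ?_
        have h1 := hHr i (s, t)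
        obtain ⟨C, hC, hs⟩ := hGne i s t fun h2 => hi (h1.trans h2)
        exact ⟨_, hfW _, h1.trans (hG1 i ⟨C, hC⟩ s t (Box.inner_subset _ hs))⟩⟩⟩
  · rintro (⟨i, hi⟩ | j) (⟨i', hi'⟩ | j') e he e' he' hne
    · obtain ⟨C, hC, rfl⟩ := he
      obtain ⟨C', hC', rfl⟩ := he'
      rw [← (hcore i C hC hi).1, ← (hcore i' C' hC' hi').1]
      refine h.disjoint i i' C hC C' hC' fun h1 => hne ?_
      obtain ⟨rfl, rfl⟩ := Prod.ext_iff.1 h1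
      rfl
    · obtain ⟨C, hC, rfl⟩ := he
      rw [← (hcore i C hC hi).1]
      refine Set.disjoint_left.2 fun s hs hs' => ?_
      exact hnot i C hC hi s (Box.inner_subset _ hs) j' (treeBox_subset_of_mem_whitneyCubes
        (isOpen_support hp j') he' (Box.inner_subset _ hs'))
    · obtain ⟨C, hC, rfl⟩ := he'
      rw [← (hcore i' C hC hi').1]
      refine Set.disjoint_left.2 fun s hs hs' => ?_
      exact hnot i' C hC hi' s (Box.inner_subset _ hs') j (treeBox_subset_of_mem_whitneyCubes
        (isOpen_support hp j) he (Box.inner_subset _ hs))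
    · by_cases hj : j = j'
      · subst hj
        exact disjoint_whitneyCubes (isOpen_support hp j) he he' fun h1 => hne (by rw [h1])
      · refine Set.disjoint_left.2 fun s hs hs' => hj (index_eq_of_mem_support
          (treeBox_subset_of_mem_whitneyCubes (isOpen_support hp j) he (Box.inner_subset _ hs))
          (treeBox_subset_of_mem_whitneyCubes (isOpen_support hp j') he' (Box.inner_subset _ hs')))
  · rintro (⟨i, hi⟩ | j) e he s hs
    · obtain ⟨C, hC, rfl⟩ := he
      obtain ⟨h1, h2⟩ := hcore i C hC hi
      rw [← h1] at hs
      exact iterDecomposition_proj_iff.2 (hBF.mapsTo i _ ⟨C, hC, rfl⟩ s (by rwa [h2]))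
    · change starRetraction x a y b j (H (s, 1)) = H (s, 1)
      by_cases h1 : retraction x a j (P (s, 1)) = a j
      · rw [hpt j s (treeBox_subset_of_mem_whitneyCubes (isOpen_support hp j) he hs) h1]
        exact starRetraction_core_of_eq (retraction_core x a j _)
      · exact starRetraction_of_ne (by rwa [hHc])
  · rintro (⟨i, hi⟩ | j) e he s hs
    · obtain ⟨C, hC, rfl⟩ := he
      obtain ⟨h1, h2⟩ := hcore i C hC hi
      rw [← h1] at hs
      rw [iterDecomposition_pt]
      exact hBF.bd_eq i _ ⟨C, hC, rfl⟩ s (by rwa [h2])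
    · rw [iterDecomposition_pt]
      have hsU := treeBox_subset_of_mem_whitneyCubes (isOpen_support hp j) he hs.1
      exact hpt j s hsU (hP1 j s hsU (dim_lt_of_mem_bd (isOpen_support hp j) he hs))
  · rintro (⟨i, hi⟩ | j) s hs
    · have h1 : G i (s, 1) ≠ b i := by
        intro h2
        refine hs ?_
        rw [iterDecomposition_pt]
        change attach y b i (retraction y b i (H (s, 1))) = core y b (y i)
        rw [hHr, h2, attach_base]
      obtain ⟨C, hC, hsC⟩ := hGne i s 1 h1
      obtain ⟨h3, h4⟩ := hcore i C hC hi
      rw [h4, Box.interp_self, h3] at hsC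
      exact ⟨_, ⟨C, hC, rfl⟩, Box.inner_subset _ hsC⟩
    · have h1 : retraction x a j (P (s, 1)) ≠ a j := by
        intro h2
        refine hs ?_
        rw [iterDecomposition_pt]
        exact starRetraction_core_of_eq (by rwa [hHc])
      have hsU : s ∈ support p j := by
        by_contra hcon
        exact h1 (hPoff j s 1 hcon)
      refine exists_mem_whitneyCubes hsU (le_antisymm (whitneyCell_dim_le s) ?_)
      by_contra hlt
      exact h1 (hP1 j s hsU (not_le.1 hlt))
  · rintro (⟨i, hi⟩ | j) e he
    · obtain ⟨C, hC, rfl⟩ := he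
      rw [← (hcore i C hC hi).1]
      exact h.unit i C hC
    · exact (treeBox_subset_of_mem_whitneyCubes (isOpen_support hp j) he).trans
        ((support_subset hpout j).trans (Box.inner_subset _))

/-- A loop in the iterated space that is factored with respect to the spaces `B i` can be deformed
to a loop that is also factored, with boxes of the tree, for the decomposition over the arc. -/
theorem BoxFactored.exists_treeFactored
    (h : BoxFactored (attachSet y b) (attachPt y b) f 𝒟) (hA : ∀ j, SeqConnected (n - 1) (a j))
    (hf : Continuous f) {z₀ : I}
    (hout : ∀ s, s ∉ (treeBox 0 0 : Box n).inner → f s = core y b (core x a z₀))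
    {W : Set (Adj y b)} (hW : Set.range (core y b) ⊆ W) (hfW : ∀ s, f s ∈ W) :
    ∃ (g : (Fin n → ℝ) → Adj y b) (cubes : _) (𝒟' : _)
      (hg : TreeFactored (iterDecomposition x a y b) (z₀ : ℝ) cubes g),
      BoxFactored (attachSet y b) (attachPt y b) g 𝒟' ∧
      ContinuousMap.HomotopicWith (⟨f, hf⟩ : C(Fin n → ℝ, Adj y b)) ⟨g, hg.cont⟩
        (LoopIn (core y b (core x a z₀)) W) := by
  -- The contents are shrunk to boxes that are placed well before anything is deformed.
  choose E hE hwp using fun i C (hC : C ∈ 𝒟 i) =>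
    exists_wellPlaced (p := fun s => coreRetraction y b (f s)) (C := C)
      fun s hs => h.coreRetraction_eq hC hs
  obtain ⟨g, hcr, hg, hfg⟩ := h.exists_shrink hf hout hW hfW E hE
  have hgL : LoopIn (core y b (core x a z₀)) W g := by
    obtain ⟨F⟩ := hfg
    have h1 := F.prop' 1
    have h2 : (⟨fun s => F.toFun (1, s), F.continuous_toFun.comp (by fun_prop)⟩ :
        C(Fin n → ℝ, Adj y b)) = g :=
      ContinuousMap.ext F.map_one_left
    rwa [h2] at h1
  obtain ⟨g', cubes, 𝒟', hg', hB, hgg'⟩ := hg.exists_treeFactored_of_wellPlaced hA g.continuous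
    hgL.1 hW hgL.2 (by
      rintro i _ ⟨C, hC, rfl⟩
      simp only [hcr]
      exact hwp i C hC)
  exact ⟨g', cubes, 𝒟', hg', hB, hfg.trans hgg'⟩

end Stage

/-! ### Loops on the cube and their extensions to `ℝ^n` -/

section Extension

variable {n : ℕ} [NeZero n] {Z : Type u} [TopologicalSpace Z] {z₀ : Z}

/-- The point of `ℝ^n` given by a point of the cube. -/
def cubeCoe (s : Fin n → I) (i : Fin n) : ℝ := s i

theorem continuous_cubeCoe : Continuous (cubeCoe (n := n)) := by unfold cubeCoe; fun_prop

/-- The extension of an `n`-loop to `ℝ^n` that is constant outside of the unit cube. -/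
noncomputable def extend (f : Ω^ (Fin n) Z z₀) : C(Fin n → ℝ, Z) :=
  ⟨fun s => f fun i => Set.projIcc 0 1 zero_le_one (s i), f.1.continuous.comp
    (continuous_pi fun i => continuous_projIcc.comp (continuous_apply i))⟩

theorem extend_cubeCoe (f : Ω^ (Fin n) Z z₀) (s : Fin n → I) : extend f (cubeCoe s) = f s := by
  simp [extend, cubeCoe]

theorem projIcc_mem_boundary {s : Fin n → ℝ} (hs : s ∉ (treeBox 0 0 : Box n).inner) :
    (fun i => Set.projIcc (0 : ℝ) 1 zero_le_one (s i)) ∈ Cube.boundary (Fin n) := by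
  rw [mem_inner_unitBox] at hs
  push Not at hs
  obtain ⟨r, hr⟩ := hs
  refine ⟨r, ?_⟩
  by_cases h0 : 0 < s r
  · exact Or.inr (Set.projIcc_of_right_le _ (hr h0))
  · exact Or.inl (Set.projIcc_of_le_left _ (not_lt.1 h0))

theorem cubeCoe_notMem {s : Fin n → I} (hs : s ∈ Cube.boundary (Fin n)) :
    cubeCoe s ∉ (treeBox 0 0 : Box n).inner := by
  rw [mem_inner_unitBox]
  obtain ⟨r, hr⟩ := hs
  intro hcon
  have h1 := hcon r
  rcases hr with hr | hr <;> simp [cubeCoe, hr] at h1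

theorem loopIn_extend (f : Ω^ (Fin n) Z z₀) {W : Set Z} (hf : ∀ s, f s ∈ W) :
    LoopIn z₀ W (extend f) :=
  ⟨fun _ hs => f.2 _ (projIcc_mem_boundary hs), fun _ => hf _⟩

/-- The restriction to the cube of a map on `ℝ^n` that represents an `n`-loop. -/
def LoopIn.toLoop {W : Set Z} {g : C(Fin n → ℝ, Z)} (hg : LoopIn z₀ W g) : Ω^ (Fin n) Z z₀ :=
  ⟨g.comp ⟨cubeCoe, continuous_cubeCoe⟩, fun _ hs => hg.1 _ (cubeCoe_notMem hs)⟩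

theorem exists_homotopyRel {f f' : Ω^ (Fin n) Z z₀} {g g' : C(Fin n → ℝ, Z)} {W : Set Z}
    (h : ContinuousMap.HomotopicWith g g' (LoopIn z₀ W)) (hf : ∀ s, f s = g (cubeCoe s))
    (hf' : ∀ s, f' s = g' (cubeCoe s)) :
    ∃ H : ContinuousMap.HomotopyRel f.1 f'.1 (Cube.boundary (Fin n)), ∀ s, H s ∈ W := by
  obtain ⟨F⟩ := h
  exact ⟨{ toFun := fun x => F.toFun (x.1, cubeCoe x.2)
           continuous_toFun := F.continuous_toFun.comp
             (continuous_fst.prodMk (continuous_cubeCoe.comp continuous_snd))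
           map_zero_left := fun s => (F.map_zero_left _).trans (hf s).symm
           map_one_left := fun s => (F.map_one_left _).trans (hf' s).symm
           prop' := fun t s hs =>
             ((F.prop' t).1 _ (cubeCoe_notMem hs)).trans (f.2 s hs).symm },
    fun x => (F.prop' x.1).2 _⟩

theorem homotopicWith_extend {f f' : Ω^ (Fin n) Z z₀} (h : GenLoop.Homotopic f f') :
    ContinuousMap.HomotopicWith (extend f) (extend f') (LoopIn z₀ Set.univ) := by
  obtain ⟨F⟩ := h
  refine homotopicWith_of (G := fun x => F (x.2, fun i => Set.projIcc 0 1 zero_le_one (x.1 i)))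
    (F.continuous.comp (continuous_snd.prodMk (continuous_pi fun i => continuous_projIcc.comp
      ((continuous_apply i).comp continuous_fst)))) (fun s => F.apply_zero _)
    (fun s => F.apply_one _) fun t => ⟨fun s hs => ?_, fun _ => Set.mem_univ _⟩
  exact (F.prop' t _ (projIcc_mem_boundary hs)).trans (f.2 _ (projIcc_mem_boundary hs))

theorem LoopIn.of_homotopicWith {W : Set Z} {g g' : C(Fin n → ℝ, Z)}
    (h : ContinuousMap.HomotopicWith g g' (LoopIn z₀ W)) : LoopIn z₀ W g' := by
  obtain ⟨F⟩ := h
  have h1 := F.prop' 1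
  have h2 : (⟨fun s => F.toFun (1, s), F.continuous_toFun.comp (by fun_prop)⟩ :
      C(Fin n → ℝ, Z)) = g' := ContinuousMap.ext F.map_one_left
  rwa [h2] at h1

end Extension

section Cubes

variable {n : ℕ} [NeZero n]

/-- The box in `ℝ^n` given by an `n`-cube in `I^n`. -/
def NCube.toBox (C : NCube n) : Box n where
  lo i := C.lo i
  hi i := C.hi i
  lt i := C.lt i

theorem NCube.toBox_injective : Function.Injective (NCube.toBox (n := n)) := by
  rintro ⟨lo, hi, h⟩ ⟨lo', hi', h'⟩ heq
  have h1 : lo = lo' := funext fun i => Subtype.ext (congrFun (congrArg Box.lo heq) i)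
  have h2 : hi = hi' := funext fun i => Subtype.ext (congrFun (congrArg Box.hi heq) i)
  subst h1 h2
  rfl

theorem NCube.toBox_subset (C : NCube n) : C.toBox.carrier ⊆ (treeBox 0 0 : Box n).carrier :=
  fun _ hs => mem_unitBox.2 fun r =>
    ⟨(C.lo r).2.1.trans (hs r).1, (hs r).2.trans (C.hi r).2.2⟩

theorem Box.exists_toBox {D : Box n} (h : D.carrier ⊆ (treeBox 0 0 : Box n).carrier) :
    ∃ C : NCube n, C.toBox = D := by
  have h1 := mem_unitBox.1 (h (show D.lo ∈ D.carrier from fun i => ⟨le_rfl, (D.lt i).le⟩))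
  have h2 := mem_unitBox.1 (h (show D.hi ∈ D.carrier from fun i => ⟨(D.lt i).le, le_rfl⟩))
  exact ⟨⟨fun i => ⟨D.lo i, h1 i⟩, fun i => ⟨D.hi i, h2 i⟩, D.lt⟩, rfl⟩

theorem exists_cubeCoe {s : Fin n → ℝ} (hs : s ∈ (treeBox 0 0 : Box n).carrier) :
    ∃ s' : Fin n → I, cubeCoe s' = s :=
  ⟨fun i => ⟨s i, mem_unitBox.1 hs i⟩, rfl⟩

variable {Z : Type u} [TopologicalSpace Z] {z₀ : Z} {K : Type w} {S : K → Set Z} {p : K → Z}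

theorem BoxFactored.isFactorization {f : Ω^ (Fin n) Z z₀} {g : (Fin n → ℝ) → Z}
    {𝒟 : K → Set (Box n)} (h : BoxFactored S p g 𝒟) (hf : ∀ s, f s = g (cubeCoe s)) :
    IsFactorization S p f fun k => {C | C.toBox ∈ 𝒟 k} where
  disjoint := fun k l C hC D hD hne => by
    have h1 := h.disjoint k l _ hC _ hD fun h => hne
      (Prod.ext (Prod.ext_iff.1 h).1 (NCube.toBox_injective (Prod.ext_iff.1 h).2))
    refine Set.disjoint_left.2 fun s hs hs' => Set.disjoint_left.1 h1
      (show cubeCoe s ∈ C.toBox.inner from hs) (show cubeCoe s ∈ D.toBox.inner from hs')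
  mapsTo := fun k C hC s hs => by
    rw [hf]
    exact h.mapsTo k _ hC _ hs
  bd_eq := fun k C hC s hs => by
    rw [hf]
    refine h.bd_eq k _ hC _ ⟨hs.1, ?_⟩
    obtain ⟨i, hi⟩ := hs.2
    exact ⟨i, hi.imp (congrArg Subtype.val) (congrArg Subtype.val)⟩
  cover := fun k s h1 h2 => by
    rw [hf] at h1 h2
    obtain ⟨D, hD, hs⟩ := h.cover k _ h1 h2
    obtain ⟨C, rfl⟩ := Box.exists_toBox (h.unit k D hD)
    exact ⟨C, hD, hs⟩

theorem IsFactorization.boxFactored {f : Ω^ (Fin n) Z z₀} {𝒞 : K → Set (NCube n)}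
    (h : IsFactorization S p f 𝒞) (hz : ∀ k, z₀ ∈ S k → z₀ = p k) :
    BoxFactored S p (extend f) fun k => NCube.toBox '' 𝒞 k where
  disjoint := by
    rintro k l _ ⟨C, hC, rfl⟩ _ ⟨D, hD, rfl⟩ hne
    have h1 := h.disjoint k l C hC D hD fun h => hne (by
      obtain ⟨rfl, rfl⟩ := Prod.ext_iff.1 h
      rfl)
    refine Set.disjoint_left.2 fun s hs hs' => ?_
    obtain ⟨s, rfl⟩ := exists_cubeCoe (C.toBox_subset (Box.inner_subset _ hs))
    exact Set.disjoint_left.1 h1 (show s ∈ C.inner from hs) (show s ∈ D.inner from hs')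
  mapsTo := by
    rintro k _ ⟨C, hC, rfl⟩ s hs
    obtain ⟨s, rfl⟩ := exists_cubeCoe (C.toBox_subset hs)
    rw [extend_cubeCoe]
    exact h.mapsTo k C hC s hs
  bd_eq := by
    rintro k _ ⟨C, hC, rfl⟩ s hs
    obtain ⟨s, rfl⟩ := exists_cubeCoe (C.toBox_subset hs.1)
    rw [extend_cubeCoe]
    refine h.bd_eq k C hC s ⟨hs.1, ?_⟩
    obtain ⟨i, hi⟩ := hs.2
    exact ⟨i, hi.imp Subtype.ext Subtype.ext⟩
  cover := fun k s h1 h2 => by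
    by_cases hs : s ∈ (treeBox 0 0 : Box n).inner
    · obtain ⟨s, rfl⟩ := exists_cubeCoe (Box.inner_subset _ hs)
      rw [extend_cubeCoe] at h1 h2
      obtain ⟨C, hC, hsC⟩ := h.cover k s h1 h2
      exact ⟨_, ⟨C, hC, rfl⟩, hsC⟩
    · rw [(loopIn_extend f (W := Set.univ) fun _ => Set.mem_univ _).1 s hs] at h1 h2
      exact absurd (hz k h1) h2
  unit := by
    rintro k _ ⟨C, -, rfl⟩
    exact C.toBox_subset

end Cubes

/-! ### The factorizations of an arrangement -/

section Place

variable {n : ℕ} [NeZero n]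

/-- The box in `[a, b]^n` that corresponds to a box in the unit cube. -/
def Box.place {a b : ℝ} (hab : a < b) (C : Box n) : Box n where
  lo i := a + (b - a) * C.lo i
  hi i := a + (b - a) * C.hi i
  lt i := by
    have := mul_lt_mul_of_pos_left (C.lt i) (sub_pos.2 hab)
    linarith

variable {a b : ℝ} (hab : a < b) {C : Box n}

theorem Box.place_subset {D : Box n} (h : C.carrier ⊆ D.carrier) :
    (C.place hab).carrier ⊆ (D.place hab).carrier := by
  have h1 := h (show C.lo ∈ C.carrier from fun i => ⟨le_rfl, (C.lt i).le⟩)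
  have h2 := h (show C.hi ∈ C.carrier from fun i => ⟨(C.lt i).le, le_rfl⟩)
  intro s hs i
  have h3 := mul_le_mul_of_nonneg_left (h1 i).1 (sub_pos.2 hab).le
  have h4 := mul_le_mul_of_nonneg_left (h2 i).2 (sub_pos.2 hab).le
  have h5 := (hs i).1
  have h6 := (hs i).2
  simp only [Box.place] at h5 h6 ⊢
  constructor <;> linarith

theorem Box.mem_place_unit {s : Fin n → ℝ} :
    s ∈ ((treeBox 0 0 : Box n).place hab).carrier ↔ ∀ i, s i ∈ Set.Icc a b := by
  simp [Box.place, Box.carrier, treeScale_zero]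

theorem Box.mem_inner_place_unit {s : Fin n → ℝ} :
    s ∈ ((treeBox 0 0 : Box n).place hab).inner ↔ ∀ i, s i ∈ Set.Ioo a b := by
  simp [Box.place, Box.inner, treeScale_zero]

variable (hC : C.carrier ⊆ (treeBox 0 0 : Box n).carrier)

include hC

theorem Box.lo_nonneg (i : Fin n) : 0 ≤ C.lo i :=
  (mem_unitBox.1 (hC (show C.lo ∈ C.carrier from fun i => ⟨le_rfl, (C.lt i).le⟩)) i).1

theorem Box.hi_le_one (i : Fin n) : C.hi i ≤ 1 :=
  (mem_unitBox.1 (hC (show C.hi ∈ C.carrier from fun i => ⟨(C.lt i).le, le_rfl⟩)) i).2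

theorem Box.stretch_mem {s : Fin n → ℝ} (hs : s ∈ (C.place hab).carrier) :
    (fun i => stretch a b (s i)) ∈ C.carrier := by
  intro i
  have h1 := (hs i).1
  have h2 := (hs i).2
  simp only [Box.place] at h1 h2
  have h3 : C.lo i ≤ (s i - a) / (b - a) := by rw [le_div_iff₀ (sub_pos.2 hab)]; linarith
  have h4 : (s i - a) / (b - a) ≤ C.hi i := by rw [div_le_iff₀ (sub_pos.2 hab)]; linarith
  simp only [stretch, clamp_of_mem ((C.lo_nonneg hC i).trans h3) (h4.trans (C.hi_le_one hC i))]
  exact ⟨h3, h4⟩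

theorem Box.stretch_mem_inner_iff {s : Fin n → ℝ} :
    (fun i => stretch a b (s i)) ∈ C.inner ↔ s ∈ (C.place hab).inner := by
  have hab' := sub_pos.2 hab
  constructor
  · intro hs i
    have h1 := C.lo_nonneg hC i
    have h2 := C.hi_le_one hC i
    have h3 := hs i
    simp only at h3
    have h0 : (s i - a) / (b - a) ∈ I := by
      constructor
      · by_contra hcon
        rw [stretch, clamp_of_nonpos (not_le.1 hcon).le] at h3
        linarith [h3.1]
      · by_contra hcon
        rw [stretch, clamp_of_one_le (not_le.1 hcon).le] at h3
        linarith [h3.2]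
    rw [stretch, clamp_of_mem h0.1 h0.2, lt_div_iff₀ hab', div_lt_iff₀ hab'] at h3
    simp only [Box.place]
    constructor <;> linarith [h3.1, h3.2]
  · intro hs i
    have h1 := (hs i).1
    have h2 := (hs i).2
    simp only [Box.place] at h1 h2
    have h3 : C.lo i < (s i - a) / (b - a) := by rw [lt_div_iff₀ hab']; linarith
    have h4 : (s i - a) / (b - a) < C.hi i := by rw [div_lt_iff₀ hab']; linarith
    simp only [stretch,
      clamp_of_mem ((C.lo_nonneg hC i).trans h3.le) (h4.le.trans (C.hi_le_one hC i))]
    exact ⟨h3, h4⟩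

end Place

section Arrange

variable {n : ℕ} [NeZero n] {Z : Type u} [TopologicalSpace Z] {K : Type w}
  {D : ArcDecomposition Z K} {y₀ : ℝ} {a b : K → ℝ} {q : ℝ → ℝ} {z : K → (Fin n → ℝ) → Z}
  (hz : LoopFamily D z) (hq : Plateaus D.base a b q) (hy : y₀ ∈ I)

theorem ArcDecomposition.proj_eq_of_forall_ne {p : Z} {k : K} (h : D.pos p = D.base k)
    (h' : ∀ l, l ≠ k → D.proj l p = D.pt l) : D.proj k p = p := by
  have key : p = D.pt k → D.proj k p = p := fun h1 => by rw [h1, D.proj_pt]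
  rcases D.eq_or_eq p with h1 | ⟨l, hl⟩
  · exact key (by rw [h1, h]; rfl)
  · by_cases hlk : l = k
    · rwa [hlk] at hl
    · refine key ?_
      have h2 := ArcDecomposition.pos_of_proj_eq hl
      rw [← hl, h' l hlk, ArcDecomposition.pt, ArcDecomposition.pt, ← h2, h]

/-- The cubes in which the loops are placed. -/
noncomputable def plateauBox (hq : Plateaus D.base a b q) (k : K) : Box n :=
  (treeBox 0 0).place (hq.lt k)

theorem disjoint_plateauBox {k l : K} (h : k ≠ l) :
    Disjoint (plateauBox (n := n) hq k).inner (plateauBox hq l).inner :=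
  Set.disjoint_left.2 fun _ hs hs' => Set.disjoint_left.1 (hq.disjoint k l h)
    ((Box.mem_inner_place_unit _).1 hs 0) ((Box.mem_inner_place_unit _).1 hs' 0)

theorem plateauBox_subset (k : K) :
    (plateauBox (n := n) hq k).carrier ⊆ (treeBox 0 0 : Box n).carrier := fun s hs => by
  rw [mem_unitBox]
  intro i
  have h1 := (Box.mem_place_unit _).1 hs i
  constructor
  · linarith [hq.ge k, h1.1]
  · linarith [hq.le k, h1.2]

include hz hq in
theorem LoopFamily.mem_plateauBox {k : K} {s : Fin n → ℝ}
    (hs : z k (fun i => stretch (a k) (b k) (s i)) ≠ D.pt k) : s ∈ (plateauBox hq k).inner :=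
  (Box.mem_inner_place_unit _).2 fun i => hz.mem_Ioo hq hs i

theorem arrangeCore_of_mem {k : K} {s : Fin n → ℝ} (hs : s ∈ (plateauBox hq k).carrier) :
    arrangeCore y₀ q s = D.base k := by
  have h0 := (Box.mem_place_unit _).1 hs
  have h1 := hq.ge k
  have h2 := hq.le k
  rw [arrangeCore, hq.const k _ (h0 _), bump_eq_one]
  · ring
  · intro i
    have := h0 i
    constructor <;> linarith [this.1, this.2]

include hz hy in
theorem proj_arrange_of_mem {k : K} {s : Fin n → ℝ} (hs : s ∈ (plateauBox hq k).carrier) :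
    D.proj k (arrange D y₀ a b q z s) = arrange D y₀ a b q z s := by
  refine ArcDecomposition.proj_eq_of_forall_ne ?_ fun l hl => ?_
  · rw [arrange, (valid_arrange hz hq hy s).pos_glue, arrangeCore_of_mem hq hs]
  · by_contra hne
    rw [proj_arrange hz hq hy] at hne
    exact Box.notMem_inner_of_disjoint (disjoint_plateauBox hq hl.symm) hs
      (hz.mem_plateauBox hq hne)

include hz hy in
/-- An arrangement is factored with one box for each attached space. -/
theorem boxFactored_arrange {S : K → Set Z} (hS : ∀ k p, D.proj k p = p ↔ p ∈ S k) :
    BoxFactored S D.pt (arrange D y₀ a b q z) fun k => {plateauBox hq k} where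
  disjoint := by
    rintro k l _ rfl _ rfl hne
    exact disjoint_plateauBox hq fun h => hne (by rw [h])
  mapsTo := by
    rintro k _ rfl s hs
    exact (hS k _).1 (proj_arrange_of_mem hz hq hy hs)
  bd_eq := by
    rintro k _ rfl s hs
    rw [← proj_arrange_of_mem hz hq hy hs.1, proj_arrange hz hq hy]
    by_contra hne
    exact Box.notMem_inner_of_mem_bd hs (hz.mem_plateauBox hq hne)
  cover := fun k s h1 h2 => by
    refine ⟨_, rfl, Box.inner_subset _ (hz.mem_plateauBox hq ?_)⟩
    rwa [← proj_arrange hz hq hy, (hS k _).2 h1]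
  unit := by
    rintro k _ rfl
    exact plateauBox_subset hq k

end Arrange

section IteratedArrange

variable {n : ℕ} [NeZero n]
  {A : ℕ → Type u} [∀ j, TopologicalSpace (A j)] {x : ℕ → I} {a : ∀ j, A j}
  {B : ℕ → Type v} [∀ i, TopologicalSpace (B i)] {y : ℕ → Adj x a} {b : ∀ i, B i}
  {y₀ : ℝ} {u v : {i : ℕ // y i ∈ Set.range (core x a)} ⊕ ℕ → ℝ} {q : ℝ → ℝ}

/-- The arrangement of the components of a loop is factored with respect to the spaces `B i` if the
loop is. -/
theorem BoxFactored.arrange {g : (Fin n → ℝ) → Adj y b} {𝒟 : ℕ → Set (Box n)}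
    (h : BoxFactored (attachSet y b) (attachPt y b) g 𝒟) (hg : Continuous g)
    (hq : Plateaus (iterDecomposition x a y b).base u v q) (hy : y₀ ∈ I)
    (hz : LoopFamily (iterDecomposition x a y b)
      fun k s => (iterDecomposition x a y b).proj k (g s)) :
    ∃ 𝒟', BoxFactored (attachSet y b) (attachPt y b) (arrange (iterDecomposition x a y b) y₀ u v q
      fun k s => (iterDecomposition x a y b).proj k (g s)) 𝒟' := by
  choose κ hκ hκr _ using exists_iterIndex (x := x) (a := a) (y := y) (b := b)
  have hsub : ∀ i, ∀ C ∈ 𝒟 i, (C.place (hq.lt (κ i))).carrier ⊆ (plateauBox hq (κ i)).carrier :=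
    fun i C hC => Box.place_subset _ (h.unit i C hC)
  refine ⟨fun i => {E | ∃ C ∈ 𝒟 i, E = C.place (hq.lt (κ i))}, boxFactored_of ?_ ?_ ?_ ?_⟩
  · rintro i i' _ ⟨C, hC, rfl⟩ _ ⟨C', hC', rfl⟩ hne
    by_cases hii : κ i = κ i'
    · refine Set.disjoint_left.2 fun s hs hs' => Set.disjoint_left.1
        (h.disjoint i i' C hC C' hC' fun h => hne ?_)
        ((Box.stretch_mem_inner_iff (hq.lt (κ i)) (h.unit i C hC)).2 hs) ?_
      · obtain ⟨rfl, rfl⟩ := Prod.ext_iff.1 h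
        rfl
      · have h1 := (Box.stretch_mem_inner_iff (hq.lt (κ i')) (h.unit i' C' hC')).2 hs'
        rwa [← hii] at h1
    · exact (disjoint_plateauBox hq hii).mono (Box.inner_subset_inner (hsub i C hC))
        (Box.inner_subset_inner (hsub i' C' hC'))
  · intro i s hs
    rw [← hκr, proj_arrange hz hq hy, hκr] at hs
    obtain ⟨C, hC⟩ := (h.boxSupported hg i).exists_inner hs
    exact ⟨_, ⟨C.1, C.2, rfl⟩,
      (Box.stretch_mem_inner_iff (hq.lt (κ i)) (h.unit i C.1 C.2)).1 hC⟩
  · rintro i _ ⟨C, hC, rfl⟩ s hs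
    have h1 := h.mapsTo i C hC _ (Box.stretch_mem (hq.lt (κ i)) (h.unit i C hC) hs)
    rw [← proj_arrange_of_mem hz hq hy (hsub i C hC hs), proj_arrange hz hq hy, hκ i _ h1]
    exact (mem_attachSet_iff.1 h1).1
  · rintro i _ ⟨C, hC, rfl⟩
    exact (hsub i C hC).trans (plateauBox_subset hq _)

end IteratedArrange

/-! ### Homotopies of arrangements -/

section ArrangeHomotopy

variable {n : ℕ} [NeZero n] {Z : Type u} [TopologicalSpace Z] {K : Type w}

theorem HomotopicWith.map {Z' : Type v} [TopologicalSpace Z'] {z₀ : Z} {W : Set Z} {W' : Set Z'}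
    {g g' : C(Fin n → ℝ, Z)} (h : ContinuousMap.HomotopicWith g g' (LoopIn z₀ W)) (φ : C(Z, Z'))
    (hφ : ∀ p ∈ W, φ p ∈ W') :
    ContinuousMap.HomotopicWith (φ.comp g) (φ.comp g') (LoopIn (φ z₀) W') := by
  obtain ⟨F⟩ := h
  refine homotopicWith_of (G := fun x => φ (F.toFun (x.2, x.1)))
    (φ.continuous.comp (F.continuous_toFun.comp (by fun_prop))) (fun s => ?_) (fun s => ?_)
    fun t => ⟨fun s hs => congrArg φ ((F.prop' t).1 s hs), fun s => hφ _ ((F.prop' t).2 s)⟩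
  · exact congrArg φ (F.map_zero_left s)
  · exact congrArg φ (F.map_one_left s)

variable {D : ArcDecomposition Z K} {y₀ : ℝ} {a b : K → ℝ} {q : ℝ → ℝ}
  {z z' : K → (Fin n → ℝ) → Z}

theorem homotopicWith_arrange_of (hz : LoopFamily D z) (hz' : LoopFamily D z')
    (hq : Plateaus D.base a b q) (hy : y₀ ∈ I)
    (h : ∀ k, ContinuousMap.HomotopicWith ⟨z k, hz.cont k⟩ ⟨z' k, hz'.cont k⟩
      (LoopIn (D.pt k) Set.univ)) :
    ContinuousMap.HomotopicWith (⟨_, continuous_arrange hz hq hy⟩ : C(Fin n → ℝ, Z))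
      ⟨_, continuous_arrange hz' hq hy⟩ (LoopIn (D.arc y₀) Set.univ) := by
  have F := fun k => (h k).some
  have hF : ∀ k, Continuous fun x : (Fin n → ℝ) × I => D.proj k ((F k).toFun (x.2, x.1)) :=
    fun k => (D.continuous_proj k).comp ((F k).continuous_toFun.comp (by fun_prop))
  have hL : ∀ t : I, LoopFamily D fun k s => D.proj k ((F k).toFun (t, s)) := fun t =>
    { cont := fun k => (hF k).comp (by fun_prop : Continuous fun s : Fin n → ℝ => (s, t))
      proj := fun k s => D.proj_proj k _
      out := fun k s hs => by
        rw [show (F k).toFun (t, s) = D.pt k from ((F k).prop' t).1 s hs, D.proj_pt] }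
  refine homotopicWith_of (continuous_arrange_family hq hy hL hF) (fun s => ?_) (fun s => ?_)
    fun t => ⟨fun s hs => arrange_out (hL t) hq hs, fun _ => Set.mem_univ _⟩
  · have h1 : ∀ k s, (F k).toFun (0, s) = z k s := fun k => (F k).map_zero_left
    simp only [h1, hz.proj]
    rfl
  · have h1 : ∀ k s, (F k).toFun (1, s) = z' k s := fun k => (F k).map_one_left
    simp only [h1, hz'.proj]
    rfl

/-- Stretching a loop does not change its homotopy class. -/
theorem homotopicWith_stretch {z₀ : Z} {g : C(Fin n → ℝ, Z)} {W : Set Z} (hg : LoopIn z₀ W g)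
    {a b : ℝ} (hab : a < b) (ha : 0 ≤ a) (hb : b ≤ 1)
    {g' : C(Fin n → ℝ, Z)} (hg' : ∀ s, g' s = g fun i => stretch a b (s i)) :
    ContinuousMap.HomotopicWith g' g (LoopIn z₀ W) := by
  have hc := continuous_stretch a b
  refine homotopicWith_of
    (G := fun x => g fun i => (1 - (x.2 : ℝ)) * stretch a b (x.1 i) + x.2 * x.1 i)
    (g.continuous.comp (by fun_prop)) (fun s => by simp [hg']) (fun s => by simp)
    fun t => ⟨fun s hs => hg.1 _ fun h => hs ?_, fun s => hg.2 _⟩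
  rw [mem_inner_unitBox] at h ⊢
  intro i
  have h1 := h i
  have ht0 := t.2.1
  have ht1 := t.2.2
  constructor
  · by_contra hcon
    rw [stretch_of_le hab (by linarith)] at h1
    nlinarith [h1.1, not_lt.1 hcon]
  · by_contra hcon
    rw [stretch_of_ge hab (by linarith)] at h1
    nlinarith [h1.2, not_lt.1 hcon]

end ArrangeHomotopy

section Iterated

variable {n : ℕ} [NeZero n]
  {A : ℕ → Type u} [∀ j, TopologicalSpace (A j)] [∀ j, T2Space (A j)] {x : ℕ → I} {a : ∀ j, A j}
  {B : ℕ → Type v} [∀ i, TopologicalSpace (B i)] {y : ℕ → Adj x a} {b : ∀ i, B i}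
  {f : (Fin n → ℝ) → Adj y b} {𝒟 : ℕ → Set (Box n)}

/-- A loop in the iterated space that is factored with respect to the spaces `B i` is homotopic to
an arrangement of loops in the spaces attached to the arc, which are homotopic to the components of
the given loop. -/
theorem BoxFactored.exists_arrangement (hn : 2 ≤ n)
    (h : BoxFactored (attachSet y b) (attachPt y b) f 𝒟) (hA : ∀ j, SeqConnected (n - 1) (a j))
    (hf : Continuous f) {z₀ : I}
    (hout : ∀ s, s ∉ (treeBox 0 0 : Box n).inner → f s = core y b (core x a z₀))
    {W : Set (Adj y b)} (hW : Set.range (core y b) ⊆ W) (hfW : ∀ s, f s ∈ W)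
    {u v : {i : ℕ // y i ∈ Set.range (core x a)} ⊕ ℕ → ℝ} {q : ℝ → ℝ}
    (hq : Plateaus (iterDecomposition x a y b).base u v q) :
    ∃ (z : _ → (Fin n → ℝ) → Adj y b) (hz : LoopFamily (iterDecomposition x a y b) z),
      ContinuousMap.HomotopicWith (⟨f, hf⟩ : C(Fin n → ℝ, Adj y b))
        ⟨_, continuous_arrange hz hq z₀.2⟩ (LoopIn (core y b (core x a z₀)) W) ∧
      (∃ 𝒟', BoxFactored (attachSet y b) (attachPt y b)
        (ShrinkingAdjunction.arrange (iterDecomposition x a y b) z₀ u v q z) 𝒟') ∧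
      ∀ k, ContinuousMap.HomotopicWith
        ⟨fun s => (iterDecomposition x a y b).proj k (f s),
          ((iterDecomposition x a y b).continuous_proj k).comp hf⟩
        ⟨z k, hz.cont k⟩ (LoopIn ((iterDecomposition x a y b).pt k) Set.univ) := by
  obtain ⟨g, cubes, 𝒟', hg, hB, hfg⟩ := h.exists_treeFactored hA hf hout hW hfW
  have harc : (iterDecomposition x a y b).arc (z₀ : ℝ) = core y b (core x a z₀) := by
    change core y b (core x a (Set.projIcc 0 1 zero_le_one (z₀ : ℝ))) = _
    rw [Set.projIcc_val]
  have h1 := hg.homotopicWith_arrange hq hn (W := W) (fun p => hW ⟨_, rfl⟩)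
    (LoopIn.of_homotopicWith hfg).2
  rw [harc] at h1
  refine ⟨_, hg.loopFamily, hfg.trans h1, hB.arrange hg.cont hq z₀.2 hg.loopFamily, fun k => ?_⟩
  have h2 := HomotopicWith.map (W' := Set.univ) hfg
    ⟨_, (iterDecomposition x a y b).continuous_proj k⟩ fun _ _ => Set.mem_univ _
  have h3 : (iterDecomposition x a y b).proj k (core y b (core x a z₀)) =
      (iterDecomposition x a y b).pt k := by
    rw [← harc]
    exact (iterDecomposition x a y b).proj_arc k _
  simp only [ContinuousMap.coe_mk, h3] at h2
  exact h2

variable (x a y b) in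
theorem exists_plateaus_iterDecomposition : ∃ u v q,
    Plateaus (iterDecomposition x a y b).base u v q := by
  obtain ⟨u, v, q, h1, h2, h3, h4, h5⟩ := exists_plateaus (iterDecomposition x a y b).base
    (iterDecomposition x a y b).base_mem
  exact ⟨u, v, q, h1, h2, fun k => (h3 k).1, fun k => (h3 k).2.1, fun k => (h3 k).2.2, h4, h5⟩

/-- Single-factor forms in the iterated space. -/
theorem exists_singleFactorForm (hn : 2 ≤ n) (hA : ∀ j, SeqConnected (n - 1) (a j)) (z₀ : I)
    (f : Ω^ (Fin n) (Adj y b) (core y b (core x a z₀)))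
    (hf : FactoredForm (attachSet y b) (attachPt y b) f) :
    ∃ (g : Ω^ (Fin n) (Adj y b) (core y b (core x a z₀)))
      (H : ContinuousMap.HomotopyRel f.1 g.1 (Cube.boundary (Fin n))),
      (∀ s, H s ∈ Set.range (core y b) ∪ Set.range f) ∧
      FactoredForm (attachSet y b) (attachPt y b) g ∧
      SingleFactorForm (iterSet x a y b) (iterPt x a y b) g := by
  obtain ⟨𝒞, h𝒞⟩ := hf
  have hz₀ : ∀ i, core y b (core x a z₀) ∈ attachSet y b i →
      core y b (core x a z₀) = attachPt y b i := fun i hi => by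
    rw [attachPt, ← (mem_attachSet_iff.1 hi).1, coreRetraction_core]
  obtain ⟨u, v, q, hq⟩ := exists_plateaus_iterDecomposition x a y b
  have hL := loopIn_extend f (W := Set.range (core y b) ∪ Set.range f) fun s => Or.inr ⟨s, rfl⟩
  obtain ⟨z, hz, hh, ⟨𝒟', hB⟩, -⟩ := (h𝒞.boxFactored hz₀).exists_arrangement hn hA
    (extend f).continuous hL.1 (W := Set.range (core y b) ∪ Set.range f) Set.subset_union_left
    hL.2 hq
  have hg := LoopIn.of_homotopicWith hh
  obtain ⟨H, hH⟩ := exists_homotopyRel (f := f) (f' := hg.toLoop) hh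
    (fun s => (extend_cubeCoe f s).symm) fun s => rfl
  refine ⟨hg.toLoop, H, hH, ⟨_, hB.isFactorization fun s => rfl⟩, ?_⟩
  have hS := boxFactored_arrange hz hq z₀.2 (S := iterSet x a y b)
    fun k p => iterDecomposition_proj_iff
  rw [show (iterDecomposition x a y b).pt = iterPt x a y b from funext iterDecomposition_pt] at hS
  exact ⟨_, hS.isFactorization fun s => rfl, fun k C hC C' hC' =>
    NCube.toBox_injective (Eq.trans hC (Eq.symm hC'))⟩

end Iterated

/-! ### The homotopy groups of the space with arc core -/

section Induced

variable {X : Type u} {Y : Type v} [TopologicalSpace X] [TopologicalSpace Y] {N : Type w}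
  [DecidableEq N] [Nonempty N] {p : X} {q : Y}

theorem loopMap_transAt (φ : C(X, Y)) (h : φ p = q) (i : N) (f g : Ω^ N X p) :
    loopMap φ h (GenLoop.transAt i f g) = GenLoop.transAt i (loopMap φ h f) (loopMap φ h g) :=
  GenLoop.ext _ _ fun t => apply_ite φ ((t i : ℝ) ≤ 1 / 2)
    (f (Function.update t i (Set.projIcc 0 1 zero_le_one (2 * t i))))
    (g (Function.update t i (Set.projIcc 0 1 zero_le_one (2 * t i - 1))))

theorem piMap_mul (φ : C(X, Y)) (h : φ p = q) (α β : HomotopyGroup N X p) :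
    piMap φ h (α * β) = piMap φ h α * piMap φ h β := by
  induction α using Quotient.inductionOn with | _ f
  induction β using Quotient.inductionOn with | _ g
  have h1 := HomotopyGroup.mul_spec (i := Classical.arbitrary N) (p := f) (q := g)
  have h2 := HomotopyGroup.mul_spec (i := Classical.arbitrary N) (p := loopMap φ h f)
    (q := loopMap φ h g)
  refine (congrArg (piMap φ h) h1).trans (Eq.trans ?_ h2.symm)
  exact congrArg (Quotient.mk _) (loopMap_transAt φ h _ g f)

end Induced

section ArcCore

variable {n : ℕ} [NeZero n]
  {A : ℕ → Type u} [∀ j, TopologicalSpace (A j)] [∀ j, T2Space (A j)] {x : ℕ → I} {a : ∀ j, A j}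

variable (x a) in
/-- The space with arc core is regarded as an iterated space, with one-point spaces attached. -/
def pointBase (_ : ℕ) : Adj x a := core x a 0

/-- The base points of the one-point spaces. -/
def pointPt (_ : ℕ) : PUnit.{1} := PUnit.unit

variable (x a) in
/-- The decomposition of the space with arc core, to which one-point spaces are attached. -/
noncomputable abbrev pointDecomposition :=
  iterDecomposition x a (pointBase x a) pointPt

theorem boxFactored_point {f : (Fin n → ℝ) → Adj (pointBase x a) pointPt} :
    BoxFactored (attachSet (pointBase x a) pointPt) (attachPt (pointBase x a) pointPt) f
      fun _ => ∅ where
  disjoint := fun _ _ _ h => h.elim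
  mapsTo := fun _ _ h => h.elim
  bd_eq := fun _ _ h => h.elim
  cover := fun i s h1 h2 => by
    obtain ⟨t, ht⟩ := h1
    rw [← ht] at h2
    exact absurd (attach_base _ _ i) h2
  unit := fun _ _ h => h.elim

theorem pointDecomposition_proj_inr (j : ℕ) (p : Adj x a) :
    (pointDecomposition x a).proj (Sum.inr j) (core (pointBase x a) pointPt p) =
      core (pointBase x a) pointPt (attach x a j (retraction x a j p)) :=
  Adj.ext_coord (coreRetraction_starRetraction j _) fun _ => Subsingleton.elim _ _

theorem pointDecomposition_proj_inl (i) (p : Adj x a) :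
    (pointDecomposition x a).proj (Sum.inl i) (core (pointBase x a) pointPt p) =
      (pointDecomposition x a).pt (Sum.inl i) := by
  rw [iterDecomposition_pt]
  exact attach_base _ _ _

theorem retraction_coreRetraction_proj (j : ℕ) (p : Adj (pointBase x a) pointPt) :
    retraction x a j (coreRetraction _ _ ((pointDecomposition x a).proj (Sum.inr j) p)) =
      retraction x a j (coreRetraction _ _ p) := by
  change retraction x a j (coreRetraction _ _ (starRetraction x a _ _ j p)) = _
  rw [coreRetraction_starRetraction, retraction_attach_self]

variable {u v : {i : ℕ // pointBase x a i ∈ Set.range (core x a)} ⊕ ℕ → ℝ} {q : ℝ → ℝ} {y₀ : ℝ}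
  {z : _ → (Fin n → ℝ) → Adj (pointBase x a) pointPt}

theorem boxFactored_arrange_point (hz : LoopFamily (pointDecomposition x a) z)
    (hq : Plateaus (pointDecomposition x a).base u v q) (hy : y₀ ∈ I) :
    BoxFactored (attachSet x a) (attachPt x a)
      (fun s => coreRetraction _ _ (arrange (pointDecomposition x a) y₀ u v q z s))
      fun j => {plateauBox hq (Sum.inr j)} := by
  have h := boxFactored_arrange hz hq hy (S := iterSet x a (pointBase x a) pointPt)
    fun k p => iterDecomposition_proj_iff
  refine boxFactored_of ?_ ?_ ?_ ?_
  · exact fun k l C hC D hD hne => h.disjoint _ _ C hC D hD fun h => hne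
      (Prod.ext (Sum.inr_injective (Prod.ext_iff.1 h).1) (Prod.ext_iff.1 h).2)
  · intro j s hs
    refine ⟨_, rfl, hz.mem_plateauBox hq ?_⟩
    rw [← proj_arrange hz hq hy]
    intro h1
    rw [← retraction_coreRetraction_proj, h1, iterDecomposition_pt] at hs
    exact hs rfl
  · rintro j _ rfl s hs
    rw [← proj_arrange_of_mem hz hq hy hs]
    change coreRetraction x a (coreRetraction _ _ (starRetraction x a _ _ j _)) = _
    rw [coreRetraction_starRetraction, coreRetraction_attach]
  · exact fun j => h.unit (Sum.inr j)

section

variable (hn : 2 ≤ n) (hA : ∀ j, SeqConnected (n - 1) (a j)) {z₀ : I}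

include hn hA

/-- Every loop is homotopic to an arrangement of loops, which are homotopic to its components. -/
theorem exists_arrangement_point (f : Ω^ (Fin n) (Adj x a) (core x a z₀))
    (hq : Plateaus (pointDecomposition x a).base u v q) :
    ∃ (z : _ → (Fin n → ℝ) → Adj (pointBase x a) pointPt)
      (hz : LoopFamily (pointDecomposition x a) z),
      ContinuousMap.HomotopicWith (extend f)
        ((coreRetraction _ _).comp ⟨_, continuous_arrange hz hq z₀.2⟩)
        (LoopIn (core x a z₀) Set.univ) ∧
      ∀ k, ContinuousMap.HomotopicWith
        ⟨fun s => (pointDecomposition x a).proj k (core _ _ (extend f s)),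
          ((pointDecomposition x a).continuous_proj k).comp
            (continuous_core.comp (extend f).continuous)⟩
        ⟨z k, hz.cont k⟩ (LoopIn ((pointDecomposition x a).pt k) Set.univ) := by
  have hL := loopIn_extend f (W := Set.univ) fun _ => Set.mem_univ _
  have hf := boxFactored_point (f := fun s => core (pointBase x a) pointPt (extend f s))
  obtain ⟨z, hz, h1, -, h2⟩ := hf.exists_arrangement hn hA
    (continuous_core.comp (extend f).continuous)
    (z₀ := z₀) (fun s hs => congrArg (core _ _) (hL.1 s hs)) (Set.subset_univ _)
    (fun _ => Set.mem_univ _) hq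
  exact ⟨z, hz, HomotopicWith.map h1 (coreRetraction _ _) fun _ _ => Set.mem_univ _, h2⟩

/-- Single-factor forms in the space with arc core. -/
theorem exists_singleFactorForm_point (f : Ω^ (Fin n) (Adj x a) (core x a z₀)) :
    ∃ g : Ω^ (Fin n) (Adj x a) (core x a z₀), GenLoop.Homotopic f g ∧
      SingleFactorForm (attachSet x a) (attachPt x a) g := by
  obtain ⟨u, v, q, hq⟩ := exists_plateaus_iterDecomposition x a (pointBase x a) pointPt
  obtain ⟨z, hz, h, -⟩ := exists_arrangement_point hn hA f hq
  have hg := LoopIn.of_homotopicWith h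
  obtain ⟨H, -⟩ := exists_homotopyRel (f := f) (f' := hg.toLoop) h
    (fun s => (extend_cubeCoe f s).symm) fun s => rfl
  exact ⟨hg.toLoop, ⟨H⟩, _, (boxFactored_arrange_point hz hq z₀.2).isFactorization fun s => rfl,
    fun k C hC C' hC' => NCube.toBox_injective (Eq.trans hC (Eq.symm hC'))⟩

/-- Two loops are homotopic if their components in the attached spaces are. -/
theorem homotopic_of_forall_retraction {f f' : Ω^ (Fin n) (Adj x a) (core x a z₀)}
    (h : ∀ j, GenLoop.Homotopic
      (loopMap (retraction x a j) (retraction_core x a j z₀) f)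
      (loopMap (retraction x a j) (retraction_core x a j z₀) f')) :
    GenLoop.Homotopic f f' := by
  obtain ⟨u, v, q, hq⟩ := exists_plateaus_iterDecomposition x a (pointBase x a) pointPt
  obtain ⟨z, hz, h1, h2⟩ := exists_arrangement_point hn hA f hq
  obtain ⟨z', hz', h1', h2'⟩ := exists_arrangement_point hn hA f' hq
  have h3 : ∀ k, ContinuousMap.HomotopicWith (⟨z k, hz.cont k⟩ : C(_, _)) ⟨z' k, hz'.cont k⟩
      (LoopIn ((pointDecomposition x a).pt k) Set.univ) := by
    intro k
    refine (h2 k).symm.trans (ContinuousMap.HomotopicWith.trans ?_ (h2' k))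
    rcases k with i | j
    · simp only [pointDecomposition_proj_inl]
      exact ContinuousMap.HomotopicWith.refl _ ⟨fun _ _ => rfl, fun _ => Set.mem_univ _⟩
    · simp only [pointDecomposition_proj_inr]
      have h4 := HomotopicWith.map (W' := Set.univ) (homotopicWith_extend (h j))
        ⟨fun t => core (pointBase x a) pointPt (attach x a j t),
          continuous_core.comp (continuous_attach j)⟩ fun _ _ => Set.mem_univ _
      have h5 : core (pointBase x a) pointPt (attach x a j (a j)) =
          (pointDecomposition x a).pt (Sum.inr j) := by
        rw [iterDecomposition_pt, attach_base]
        rfl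
      simp only [ContinuousMap.coe_mk, h5] at h4
      exact h4
  have h4 := HomotopicWith.map (W' := Set.univ) (homotopicWith_arrange_of hz hz' hq z₀.2 h3)
    (coreRetraction _ _) fun _ _ => Set.mem_univ _
  have h5 : coreRetraction _ _ ((pointDecomposition x a).arc (z₀ : ℝ)) = core x a z₀ := by
    change core x a (Set.projIcc 0 1 zero_le_one (z₀ : ℝ)) = _
    rw [Set.projIcc_val]
  rw [h5] at h4
  obtain ⟨H, -⟩ := exists_homotopyRel (f := f) (f' := f') ((h1.trans h4).trans h1'.symm)
    (fun s => (extend_cubeCoe f s).symm) fun s => (extend_cubeCoe f' s).symm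
  exact ⟨H⟩

end

/-- Every sequence of loops in the attached spaces consists of the components of a loop. -/
theorem exists_forall_retraction_homotopic {z₀ : I} (γ : ∀ j, Ω^ (Fin n) (A j) (a j)) :
    ∃ f : Ω^ (Fin n) (Adj x a) (core x a z₀), ∀ j, GenLoop.Homotopic
      (loopMap (retraction x a j) (retraction_core x a j z₀) f) (γ j) := by
  obtain ⟨u, v, q, hq⟩ := exists_plateaus_iterDecomposition x a (pointBase x a) pointPt
  have hL := fun j => loopIn_extend (γ j) (W := Set.univ) fun _ => Set.mem_univ _
  let z : {i : ℕ // pointBase x a i ∈ Set.range (core x a)} ⊕ ℕ → (Fin n → ℝ) →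
      Adj (pointBase x a) pointPt :=
    Sum.elim (fun i _ => (pointDecomposition x a).pt (Sum.inl i))
      fun j s => core (pointBase x a) pointPt (attach x a j (extend (γ j) s))
  have hz : LoopFamily (pointDecomposition x a) z :=
    { cont := by
        rintro (i | j)
        · exact continuous_const
        · exact continuous_core.comp ((continuous_attach j).comp (extend (γ j)).continuous)
      proj := by
        rintro (i | j) s
        · exact (pointDecomposition x a).proj_pt _ _
        · change (pointDecomposition x a).proj _ (core _ _ _) = core _ _ _
          rw [pointDecomposition_proj_inr, retraction_attach_self]
      out := by
        rintro (i | j) s hs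
        · rfl
        · change core _ _ _ = _
          rw [(hL j).1 s hs, attach_base, iterDecomposition_pt]
          rfl }
  have hg : LoopIn (core x a z₀) Set.univ ((coreRetraction (pointBase x a) pointPt).comp
      ⟨_, continuous_arrange hz hq z₀.2⟩) := by
    refine ⟨fun s hs => ?_, fun _ => Set.mem_univ _⟩
    change coreRetraction (pointBase x a) pointPt
      (arrange (pointDecomposition x a) z₀ u v q z s) = _
    rw [arrange_out hz hq hs]
    change core x a (Set.projIcc 0 1 zero_le_one (z₀ : ℝ)) = _
    rw [Set.projIcc_val]
  refine ⟨hg.toLoop, fun j => ?_⟩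
  have hr : ∀ s, retraction x a j (coreRetraction _ _
      (arrange (pointDecomposition x a) z₀ u v q z s)) =
      extend (γ j) fun i => stretch (u (Sum.inr j)) (v (Sum.inr j)) (s i) := fun s => by
    rw [← retraction_coreRetraction_proj, proj_arrange hz hq z₀.2]
    exact retraction_attach_self x a j _
  obtain ⟨H, -⟩ := exists_homotopyRel
    (f := loopMap (retraction x a j) (retraction_core x a j z₀) hg.toLoop) (f' := γ j)
    (homotopicWith_stretch (hL j) (hq.lt (Sum.inr j))
      (by linarith [hq.ge (Sum.inr j)]) (by linarith [hq.le (Sum.inr j)])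
      (g' := (retraction x a j).comp ((coreRetraction (pointBase x a) pointPt).comp
      ⟨_, continuous_arrange hz hq z₀.2⟩)) hr) (fun s => rfl)
    fun s => (extend_cubeCoe (γ j) s).symm
  exact ⟨H⟩

variable (x a) in
/-- The homomorphism of homotopy groups given by the retractions to the attached spaces. -/
noncomputable def piRetraction (z₀ : I) :
    π_ n (Adj x a) (core x a z₀) →* ∀ j, π_ n (A j) (a j) :=
  MonoidHom.mk' (fun α j => piMap (retraction x a j) (retraction_core x a j z₀) α)
    fun α β => funext fun _ => piMap_mul _ _ α β

theorem bijective_piRetraction (hn : 2 ≤ n) (hA : ∀ j, SeqConnected (n - 1) (a j)) (z₀ : I) :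
    Function.Bijective (piRetraction (n := n) x a z₀) := by
  constructor
  · intro α β h
    induction α using Quotient.inductionOn with | _ f
    induction β using Quotient.inductionOn with | _ g
    exact Quotient.sound (homotopic_of_forall_retraction hn hA fun _ =>
      Quotient.exact (congrFun h _))
  · intro γ
    choose γ' hγ' using fun j => Quotient.exists_rep (γ j)
    obtain ⟨f, hf⟩ := exists_forall_retraction_homotopic (x := x) (z₀ := z₀) γ'
    exact ⟨Quotient.mk _ f, funext fun j => (Quotient.sound (hf j)).trans (hγ' j)⟩

end ArcCore

end ShrinkingAdjunction

theorem mainTheorem6 (n : ℕ) [NeZero n] (hn : 2 ≤ n) :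
    -- the space with arc core
    (∀ (B : ℕ → Type v) [∀ i, TopologicalSpace (B i)] [∀ i, T2Space (B i)]
        (y : ℕ → I) (b : ∀ i, B i),
      (∀ i, ShrinkingAdjunction.SeqConnected (n - 1) (b i)) →
      ∀ y₀ : I,
        (∀ f : Ω^ (Fin n) (ShrinkingAdjunction.Adj y b) (ShrinkingAdjunction.core y b y₀),
          ∃ g : Ω^ (Fin n) (ShrinkingAdjunction.Adj y b) (ShrinkingAdjunction.core y b y₀),
            GenLoop.Homotopic f g ∧
            ShrinkingAdjunction.SingleFactorForm (ShrinkingAdjunction.attachSet y b)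
              (ShrinkingAdjunction.attachPt y b) g) ∧
        ∃ Φ : (π_ n (ShrinkingAdjunction.Adj y b) (ShrinkingAdjunction.core y b y₀)) ≃*
            (∀ i, π_ n (B i) (b i)),
          ∀ α i, Φ α i = ShrinkingAdjunction.piMap (ShrinkingAdjunction.retraction y b i)
            (ShrinkingAdjunction.retraction_core y b i y₀) α) ∧
    -- the iterated space over an arc
    (∀ (A : ℕ → Type u) [∀ j, TopologicalSpace (A j)] [∀ j, T2Space (A j)]
        (x : ℕ → I) (a : ∀ j, A j)
        (B : ℕ → Type v) [∀ i, TopologicalSpace (B i)] [∀ i, T2Space (B i)]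
        (y : ℕ → ShrinkingAdjunction.Adj x a) (b : ∀ i, B i),
      (∀ j, ShrinkingAdjunction.SeqConnected (n - 1) (a j)) →
      ∀ (z₀ : I)
        (f : Ω^ (Fin n) (ShrinkingAdjunction.Adj y b)
          (ShrinkingAdjunction.core y b (ShrinkingAdjunction.core x a z₀))),
        ShrinkingAdjunction.FactoredForm (ShrinkingAdjunction.attachSet y b)
          (ShrinkingAdjunction.attachPt y b) f →
        ∃ (g : Ω^ (Fin n) (ShrinkingAdjunction.Adj y b)
            (ShrinkingAdjunction.core y b (ShrinkingAdjunction.core x a z₀)))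
          (H : ContinuousMap.HomotopyRel f.1 g.1 (Cube.boundary (Fin n))),
          (∀ s, H s ∈ Set.range (ShrinkingAdjunction.core y b) ∪ Set.range f) ∧
          ShrinkingAdjunction.FactoredForm (ShrinkingAdjunction.attachSet y b)
            (ShrinkingAdjunction.attachPt y b) g ∧
          ShrinkingAdjunction.SingleFactorForm (ShrinkingAdjunction.iterSet x a y b)
            (ShrinkingAdjunction.iterPt x a y b) g) := by
  refine ⟨fun B _ _ y b hB y₀ =>
    ⟨ShrinkingAdjunction.exists_singleFactorForm_point hn hB, ?_⟩, ?_⟩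
  · exact ⟨MulEquiv.ofBijective _ (ShrinkingAdjunction.bijective_piRetraction hn hB y₀),
      fun α i => rfl⟩
  · intro A _ _ x a B _ _ y b hA z₀ f hf
    exact ShrinkingAdjunction.exists_singleFactorForm hn hA z₀ f hf
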